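/- **Setting.** An instance of *Multidimensional Stable Roommates with a master poset* (MDSR-Poset) consists of an integer $d\ge 1$, a set $A$ of $n\ge 1$ agents, a partial order $\succeq$ on $A$ (the master poset), and for each agent $a$ a strict linear order $\succ_a$ (the preference list) on the $(d-1)$-element subsets of $A\setminus\{a\}$. The preference lists are derived from $\succeq$: if $t,t'$ are $(d-1)$-subsets of $A\setminus\{a\}$ and there is a bijection $\sigma:t\to t'$ with $x\succeq\sigma(x)$ for all $x\in t$, then $t=t'$ or $t\succ_a t'$. A matching is a set $M$ of pairwise disjoint $d$-subsets of $A$. A $d$-subset $t$ of $A$ blocks $M$ if every $a\in t$ is either in no member of $M$, or satisfies $t\setminus\{a\}\succ_a s\setminus\{a\}$ for the $s\in M$ with $a\in s$. A matching is stable if no $d$-subset blocks it. The problem is to decide whether a stable matching exists. Let $\kappa$ be the maximum, over all agents $a$, of the number of agents incomparable to $a$ in $\succeq$. Algorithms are programs for a unit-cost random access machine with addition and truncated subtraction on natural numbers. The machine is given $n$ and $d$ and accesses the rest of the instance through two kinds of queries: whether $a\succeq b$ for two agents $a,b$ (one step), and whether $t\succ_a t'$ for an agent $a$ and two $(d-1)$-sets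 $t,t'$ that are listed in memory ($2d$ steps). **Theorem.** MDSR-Poset, with $d$ part of the input, can be solved in time $$O(n^2)+(\kappa^5 2^{16\kappa})^{O(\kappa^5 2^{16\kappa})}\cdot n ,$$ with absolute constants in both $O$'s (and $0^0=1$). In particular it is fixed-parameter tractable with respect to $\kappa$: the running time is at most $f(\kappa)\cdot n^{O(1)}$ for a computable function $f$. Moreover, for the same algorithm: if $4\kappa 2^{4\kappa}\le d$, then a stable matching exists and the algorithm answers yes in time $O(n^2)$; if $d<4\kappa 2^{4\kappa}$, then its running time is $O(n^2)+(\kappa d^4)^{O(\kappa d^4)}\cdot n$. -/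

import Mathlib

namespace MDSR

/-- The `(d-1)`-element subsets of `A ∖ {a}`, where the set of agents is `A = Fin n`. -/
abbrev PartnerSet (n d : ℕ) (a : Fin n) : Type :=
  {t : Finset (Fin n) // a ∉ t ∧ t.card + 1 = d}

/-- An instance of Multidimensional Stable Roommates with a master poset, with agents `Fin n` and
group size `d`. `geq a b` is the master poset relation `a ⪰ b`; `pref a t t'` says that agent `a`
strictly prefers the `(d-1)`-set `t` to the `(d-1)`-set `t'`. -/
structure Instance (n d : ℕ) where
  geq : Fin n → Fin n → Prop
  geq_refl : ∀ a, geq a a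
  geq_antisymm : ∀ a b, geq a b → geq b a → a = b
  geq_trans : ∀ a b c, geq a b → geq b c → geq a c
  pref : (a : Fin n) → PartnerSet n d a → PartnerSet n d a → Prop
  pref_strict : ∀ a, IsStrictTotalOrder (PartnerSet n d a) (pref a)
  /-- The preferences are derived from the master poset. -/
  derived : ∀ (a : Fin n) (t t' : PartnerSet n d a),
    (∃ σ : {x // x ∈ t.1} ≃ {x // x ∈ t'.1}, ∀ x, geq x.1 (σ x).1) → t = t' ∨ pref a t t'

namespace Instance

variable {n d : ℕ}

/-- Agents `a` and `b` are incomparable in the master poset. -/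
def Incomparable (I : Instance n d) (a b : Fin n) : Prop := ¬ I.geq a b ∧ ¬ I.geq b a

/-- The maximum, over all agents, of the number of agents incomparable to that agent. -/
noncomputable def kappa (I : Instance n d) : ℕ :=
  Finset.univ.sup fun a : Fin n => {b : Fin n | I.Incomparable a b}.ncard

/-- `t` and `t'` are `(d-1)`-sets of agents other than `a`, and `a` prefers `t` to `t'`. -/
def Prefers (I : Instance n d) (a : Fin n) (t t' : Finset (Fin n)) : Prop :=
  ∃ (h : a ∉ t ∧ t.card + 1 = d) (h' : a ∉ t' ∧ t'.card + 1 = d), I.pref a ⟨t, h⟩ ⟨t', h'⟩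

/-- A `d`-dimensional matching: a set of pairwise disjoint `d`-sets of agents. -/
def IsMatching (_I : Instance n d) (M : Finset (Finset (Fin n))) : Prop :=
  (∀ t ∈ M, t.card = d) ∧ ∀ s ∈ M, ∀ t ∈ M, s ≠ t → Disjoint s t

/-- A blocking `d`-set: each of its members is unmatched or prefers the other members to its
partners in `M`. -/
def IsBlocking (I : Instance n d) (M : Finset (Finset (Fin n))) (t : Finset (Fin n)) : Prop :=
  t.card = d ∧ ∀ a ∈ t, (∀ s ∈ M, a ∉ s) ∨ ∃ s ∈ M, a ∈ s ∧ I.Prefers a (t.erase a) (s.erase a)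

/-- Some `d`-dimensional matching admits no blocking `d`-set. -/
def HasStableMatching (I : Instance n d) : Prop :=
  ∃ M, I.IsMatching M ∧ ∀ t, ¬ I.IsBlocking M t

open Classical in
/-- Answer to the query whether `x ⪰ y` in the master poset (`0` if `x` or `y` is not an agent). -/
noncomputable def posetAnswer (I : Instance n d) (x y : ℕ) : ℕ :=
  if ∃ a b : Fin n, a.val = x ∧ b.val = y ∧ I.geq a b then 1 else 0

/-- The first `d - 1` cells of the array `f` list the elements of `t`. -/
def Lists (_I : Instance n d) (f : ℕ → ℕ) (t : Finset (Fin n)) : Prop :=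
  t.image Fin.val = (Finset.range (d - 1)).image f

open Classical in
/-- Answer to the query whether agent `x` prefers the `(d-1)`-set listed in the array `f` to the
`(d-1)`-set listed in the array `g` (`0` if the query is malformed). -/
noncomputable def prefAnswer (I : Instance n d) (x : ℕ) (f g : ℕ → ℕ) : ℕ :=
  if ∃ (a : Fin n) (t t' : Finset (Fin n)),
    a.val = x ∧ I.Lists f t ∧ I.Lists g t' ∧ I.Prefers a t t' then 1 else 0

end Instance

/-! A unit-cost random access machine, in structured form. Registers and arrays hold natural
numbers; the arithmetic is addition and truncated subtraction. The machine sees an instance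
only through `n`, `d`, pairwise comparisons in the master poset and pairwise comparisons in the
preference lists. -/

/-- Programs. Arguments are indices of registers, or of arrays where so indicated. -/
inductive Program : Type
  | skip : Program
  /-- `x := c`, where `c` is a literal. -/
  | const (x c : ℕ) : Program
  /-- `x := y`. -/
  | copy (x y : ℕ) : Program
  /-- `x := y + z`. -/
  | add (x y z : ℕ) : Program
  /-- `x := max (y - z) 0`. -/
  | sub (x y z : ℕ) : Program
  /-- `x := f[y]`, where `f` is an array. -/
  | load (x f y : ℕ) : Program
  /-- `f[x] := y`, where `f` is an array. -/
  | store (f x y : ℕ) : Program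
  /-- `x := 1` if agent `y` is at least agent `z` in the master poset, and `x := 0` otherwise. -/
  | askPoset (x y z : ℕ) : Program
  /-- `x := 1` if agent `y` prefers the set listed in array `f` to the set listed in array `g`, and
  `x := 0` otherwise. -/
  | askPref (x y f g : ℕ) : Program
  | seq (p q : Program) : Program
  /-- Run `p` if register `x` is nonzero, and `q` otherwise. -/
  | ite (x : ℕ) (p q : Program) : Program
  /-- Repeat `p` as long as register `x` is nonzero. -/
  | loop (x : ℕ) (p : Program) : Program

/-- The memory of the machine. -/
structure State where
  reg : ℕ → ℕ
  arr : ℕ → ℕ → ℕ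

/-- Assign the value `v` to register `x`. -/
def State.setReg (s : State) (x v : ℕ) : State :=
  { s with reg := Function.update s.reg x v }

/-- Assign the value `v` to cell `i` of array `f`. -/
def State.setArr (s : State) (f i v : ℕ) : State :=
  { s with arr := Function.update s.arr f (Function.update (s.arr f) i v) }

/-- Initially register `0` holds `n`, register `1` holds `d`, and everything else is `0`. -/
def State.init (n d : ℕ) : State where
  reg := fun x => if x = 0 then n else if x = 1 then d else 0
  arr := fun _ _ => 0

/-- `Exec I p s t s'`: on the instance `I`, the program `p` started in the state `s` halts in the
state `s'` after `t` steps. Every instruction and every test costs one step, except that a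
preference comparison costs `2 * d` steps. -/
inductive Exec {n d : ℕ} (I : Instance n d) : Program → State → ℕ → State → Prop
  | skip (s : State) : Exec I .skip s 0 s
  | const (x c : ℕ) (s : State) : Exec I (.const x c) s 1 (s.setReg x c)
  | copy (x y : ℕ) (s : State) : Exec I (.copy x y) s 1 (s.setReg x (s.reg y))
  | add (x y z : ℕ) (s : State) : Exec I (.add x y z) s 1 (s.setReg x (s.reg y + s.reg z))
  | sub (x y z : ℕ) (s : State) : Exec I (.sub x y z) s 1 (s.setReg x (s.reg y - s.reg z))
  | load (x f y : ℕ) (s : State) : Exec I (.load x f y) s 1 (s.setReg x (s.arr f (s.reg y)))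
  | store (f x y : ℕ) (s : State) :
      Exec I (.store f x y) s 1 (s.setArr f (s.reg x) (s.reg y))
  | askPoset (x y z : ℕ) (s : State) :
      Exec I (.askPoset x y z) s 1 (s.setReg x (I.posetAnswer (s.reg y) (s.reg z)))
  | askPref (x y f g : ℕ) (s : State) :
      Exec I (.askPref x y f g) s (2 * d)
        (s.setReg x (I.prefAnswer (s.reg y) (s.arr f) (s.arr g)))
  | seq {p q : Program} {s₁ s₂ s₃ : State} {t₁ t₂ : ℕ} :
      Exec I p s₁ t₁ s₂ → Exec I q s₂ t₂ s₃ → Exec I (.seq p q) s₁ (t₁ + t₂) s₃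
  | ite_true {x : ℕ} {p q : Program} {s s' : State} {t : ℕ} :
      s.reg x ≠ 0 → Exec I p s t s' → Exec I (.ite x p q) s (t + 1) s'
  | ite_false {x : ℕ} {p q : Program} {s s' : State} {t : ℕ} :
      s.reg x = 0 → Exec I q s t s' → Exec I (.ite x p q) s (t + 1) s'
  | loop_done {x : ℕ} {p : Program} {s : State} :
      s.reg x = 0 → Exec I (.loop x p) s 1 s
  | loop_step {x : ℕ} {p : Program} {s₁ s₂ s₃ : State} {t₁ t₂ : ℕ} :
      s₁.reg x ≠ 0 → Exec I p s₁ t₁ s₂ → Exec I (.loop x p) s₂ t₂ s₃ →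
        Exec I (.loop x p) s₁ (t₁ + t₂ + 1) s₃

/-- On the instance `I`, the program `p` halts after `t` steps and answers correctly whether `I`
has a stable matching; the answer is yes if register `0` is nonzero at the end. -/
def Program.Solves {n d : ℕ} (p : Program) (I : Instance n d) (t : ℕ) : Prop :=
  ∃ s : State, Exec I p (State.init n d) t s ∧ (s.reg 0 ≠ 0 ↔ I.HasStableMatching)

end MDSR

/-! Fix a linear extension of the master poset. A group `X` is preferred to a group `T` by a common
member as soon as `X \ T` maps injectively into `T \ X` with every element sent to a worse one. All
exchange arguments rest on this.

Large groups (`hasStableMatching_of_large`). Call a `d`-subset `F` of the remaining agents `R` upper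
if it contains everything in `R` above its members. An agent with few agents above it has an upper
favourite group, and there are at most `2 ^ (2 * κ)` upper `d`-sets: all contain a common core and
differ only within a set of at most `2 * κ` agents. If `d` is large, the pigeonhole principle gives
an upper `F` that is the favourite of at least `2 * κ` of its members. Fix `F` as a group and
recurse on `R \ F`. A blocking set that meets `F` avoids those members, so it misses at least `2 *
κ` elements of `F`; Hall's theorem then matches them to worse agents, and everybody common to both
prefers `F`.

Small groups. Blocking is a local matter. If many groups of a matching cross a position of the
linear extension, then `d` of them are mutually comparable, and the foremost agents in them block
(`exists_blocking_of_crossing`). If few groups cross, then a group that belongs to the matching or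
blocks it, and that has a long gap, can have its part after the gap replaced by agents inside the
gap; the result blocks and has smaller total position (`exists_blocking_of_gap`). Consequently the
groups of a stable matching span fewer than `width = 7 * κ * d ^ 4` positions, and for matchings
with such groups only blocking sets of that span need to be excluded (`hasStableMatching_iff`).

The decision procedure. A matching with short groups is a labeling: each agent carries the distance
to the last member of its group. Whether a set inside an interval of length `width` blocks depends
only on the labels in a window of length `3 * width`. A dynamic program over the `n` windows and the
`width ^ (3 * width)` labelings of a window decides whether consistent good labelings exist
(`hasStableMatching_iff_reach`). Its time per window is polynomial in the number of labelings.

The machine. Tests are written as expressions with bounded sums and compiled to programs;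
`Expr.compile_spec` proves value and running time once for all expressions. Sorting, computing κ and
the threshold `4 * κ * 2 ^ (4 * κ)` take `O(n ^ 2)` steps. Then the algorithm answers yes if `d`
reaches the threshold or `d = 1`, and runs the dynamic program otherwise. -/

namespace MDSR

open Finset

/-! ### Time-bounded total correctness -/

/-- On the instance `I`, the program `p` started in `s` halts within `T` steps in a state satisfying
`Q`. -/
def Runs {n d : ℕ} (I : Instance n d) (p : Program) (s : State) (T : ℕ) (Q : State → Prop) : Prop :=
  ∃ t s', Exec I p s t s' ∧ t ≤ T ∧ Q s'

namespace Runs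

variable {n d : ℕ} {I : Instance n d} {p q : Program} {s : State} {T T' T₁ T₂ : ℕ}
  {Q Q' : State → Prop}

theorem mono (h : Runs I p s T Q) (hT : T ≤ T') (hQ : ∀ s', Q s' → Q' s') : Runs I p s T' Q' := by
  obtain ⟨t, s', he, ht, hq⟩ := h
  exact ⟨t, s', he, ht.trans hT, hQ _ hq⟩

theorem const {x c : ℕ} (h : Q (s.setReg x c)) : Runs I (.const x c) s 1 Q :=
  ⟨_, _, .const x c s, le_rfl, h⟩

theorem copy {x y : ℕ} (h : Q (s.setReg x (s.reg y))) : Runs I (.copy x y) s 1 Q :=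
  ⟨_, _, .copy x y s, le_rfl, h⟩

theorem add {x y z : ℕ} (h : Q (s.setReg x (s.reg y + s.reg z))) : Runs I (.add x y z) s 1 Q :=
  ⟨_, _, .add x y z s, le_rfl, h⟩

theorem sub {x y z : ℕ} (h : Q (s.setReg x (s.reg y - s.reg z))) : Runs I (.sub x y z) s 1 Q :=
  ⟨_, _, .sub x y z s, le_rfl, h⟩

theorem load {x f y : ℕ} (h : Q (s.setReg x (s.arr f (s.reg y)))) : Runs I (.load x f y) s 1 Q :=
  ⟨_, _, .load x f y s, le_rfl, h⟩

theorem store {f x y : ℕ} (h : Q (s.setArr f (s.reg x) (s.reg y))) :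
    Runs I (.store f x y) s 1 Q :=
  ⟨_, _, .store f x y s, le_rfl, h⟩

theorem askPoset {x y z : ℕ} (h : Q (s.setReg x (I.posetAnswer (s.reg y) (s.reg z)))) :
    Runs I (.askPoset x y z) s 1 Q :=
  ⟨_, _, .askPoset x y z s, le_rfl, h⟩

theorem askPref {x y f g : ℕ}
    (h : Q (s.setReg x (I.prefAnswer (s.reg y) (s.arr f) (s.arr g)))) :
    Runs I (.askPref x y f g) s (2 * d) Q :=
  ⟨_, _, .askPref x y f g s, le_rfl, h⟩

theorem seq (h : Runs I p s T₁ fun s' => Runs I q s' T₂ Q) : Runs I (.seq p q) s (T₁ + T₂) Q := by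
  obtain ⟨t, s', he, ht, t', s'', he', ht', hq⟩ := h
  exact ⟨_, _, .seq he he', Nat.add_le_add ht ht', hq⟩

theorem ite {x : ℕ} (h₁ : s.reg x ≠ 0 → Runs I p s T Q) (h₂ : s.reg x = 0 → Runs I q s T Q) :
    Runs I (.ite x p q) s (T + 1) Q := by
  by_cases hx : s.reg x = 0
  · obtain ⟨t, s', he, ht, hq⟩ := h₂ hx
    exact ⟨_, _, .ite_false hx he, Nat.add_le_add_right ht 1, hq⟩
  · obtain ⟨t, s', he, ht, hq⟩ := h₁ hx
    exact ⟨_, _, .ite_true hx he, Nat.add_le_add_right ht 1, hq⟩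

/-- A loop whose counter register `c` runs down from `b` to `0`, with invariant `Inv`. -/
theorem loop {c b : ℕ} (Inv : ℕ → State → Prop) (hc : ∀ i s, Inv i s → s.reg c = b - i)
    (step : ∀ i s, i < b → Inv i s → Runs I p s T (Inv (i + 1))) (h₀ : Inv 0 s)
    (hQ : ∀ s', Inv b s' → Q s') : Runs I (.loop c p) s (b * (T + 1) + 1) Q := by
  -- Induction on the number `m` of remaining rounds, with `i` rounds already done.
  suffices H : ∀ m i s, i + m = b → Inv i s → Runs I (.loop c p) s (m * (T + 1) + 1) (Inv b) from
    (H b 0 s (Nat.zero_add b) h₀).mono le_rfl hQ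
  intro m
  induction m with
  | zero =>
    intro i s hi hs
    obtain rfl : i = b := by omega
    exact ⟨_, _, .loop_done (by rw [hc _ _ hs]; omega), by omega, hs⟩
  | succ m ih =>
    intro i s hi hs
    obtain ⟨t, s', he, ht, hs'⟩ := step i s (by omega) hs
    obtain ⟨t', s'', he', ht', hs''⟩ := ih (i + 1) s' (by omega) hs'
    refine ⟨_, _, .loop_step (by rw [hc _ _ hs]; omega) he he', ?_, hs''⟩
    rw [Nat.succ_mul]
    omega

end Runs

/-! ### States -/

@[simp] theorem State.reg_setReg (s : State) (x v y : ℕ) :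
    (s.setReg x v).reg y = if y = x then v else s.reg y := by
  simp [State.setReg, Function.update_apply]

@[simp] theorem State.arr_setReg (s : State) (x v : ℕ) : (s.setReg x v).arr = s.arr := rfl

@[simp] theorem State.reg_setArr (s : State) (f i v : ℕ) : (s.setArr f i v).reg = s.reg := rfl

theorem State.arr_setArr (s : State) (f i v g : ℕ) :
    (s.setArr f i v).arr g = if g = f then Function.update (s.arr f) i v else s.arr g := by
  simp only [State.setArr, Function.update_apply]

/-- The states `s` and `s'` agree on the registers and arrays with index below `k`. -/
def Agree (k : ℕ) (s s' : State) : Prop :=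
  (∀ x < k, s.reg x = s'.reg x) ∧ ∀ f < k, s.arr f = s'.arr f

namespace Agree

variable {k l : ℕ} {s s' s'' : State}

theorem rfl' : Agree k s s := ⟨fun _ _ => rfl, fun _ _ => rfl⟩

theorem symm (h : Agree k s s') : Agree k s' s :=
  ⟨fun x hx => (h.1 x hx).symm, fun f hf => (h.2 f hf).symm⟩

theorem trans (h : Agree k s s') (h' : Agree k s' s'') : Agree k s s'' :=
  ⟨fun x hx => (h.1 x hx).trans (h'.1 x hx), fun f hf => (h.2 f hf).trans (h'.2 f hf)⟩

theorem mono (h : Agree k s s') (hl : l ≤ k) : Agree l s s' :=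
  ⟨fun x hx => h.1 x (hx.trans_le hl), fun f hf => h.2 f (hf.trans_le hl)⟩

theorem setReg (h : Agree k s s') (x v : ℕ) : Agree k (s.setReg x v) (s'.setReg x v) := by
  refine ⟨fun y hy => ?_, h.2⟩
  simp only [State.reg_setReg]
  split_ifs
  · rfl
  · exact h.1 y hy

theorem setReg_left (h : Agree k s s') {x : ℕ} (v : ℕ) (hx : k ≤ x) :
    Agree k (s.setReg x v) s' := by
  refine ⟨fun y hy => ?_, h.2⟩
  rw [State.reg_setReg, if_neg (by omega)]
  exact h.1 y hy

theorem setArr_left (h : Agree k s s') {f : ℕ} (i v : ℕ) (hf : k ≤ f) :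
    Agree k (s.setArr f i v) s' := by
  refine ⟨h.1, fun g hg => ?_⟩
  rw [State.arr_setArr, if_neg (by omega)]
  exact h.2 g hg

end Agree

/-! ### Expressions -/

/-- Expressions over registers and arrays, with bounded sums and queries. -/
inductive Expr : Type
  | var (x : ℕ) : Expr
  | lit (c : ℕ) : Expr
  | add (a b : Expr) : Expr
  | sub (a b : Expr) : Expr
  | mul (a b : Expr) : Expr
  /-- The cell with index `a` of the array `f`. -/
  | load (f : ℕ) (a : Expr) : Expr
  | geq (a b : Expr) : Expr
  /-- `a` if `c` is nonzero and `b` otherwise. -/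
  | cond (c a b : Expr) : Expr
  /-- The sum of `e` over all values of the register `x` smaller than `b`. -/
  | sum (x : ℕ) (b e : Expr) : Expr
  /-- The answer to the preference query for the agent `a` and the arrays `x ↦ f`, `x ↦ g`. -/
  | pref (a : Expr) (x : ℕ) (f g : Expr) : Expr

namespace Expr

/-- The value of an expression. -/
noncomputable def eval {n d : ℕ} (I : Instance n d) : Expr → State → ℕ
  | var x, s => s.reg x
  | lit c, _ => c
  | add a b, s => eval I a s + eval I b s
  | sub a b, s => eval I a s - eval I b s
  | mul a b, s => eval I a s * eval I b s
  | load f a, s => s.arr f (eval I a s)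
  | geq a b, s => I.posetAnswer (eval I a s) (eval I b s)
  | cond c a b, s => if eval I c s ≠ 0 then eval I a s else eval I b s
  | sum x b e, s => ∑ i ∈ range (eval I b s), eval I e (s.setReg x i)
  | pref a x f g, s => I.prefAnswer (eval I a s) (fun i => eval I f (s.setReg x i))
      (fun i => eval I g (s.setReg x i))

/-- A strict upper bound on the indices of registers and arrays in an expression. -/
def bound : Expr → ℕ
  | var x => x + 1
  | lit _ => 0
  | add a b => max a.bound b.bound
  | sub a b => max a.bound b.bound
  | mul a b => max a.bound b.bound
  | load f a => max (f + 1) a.bound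
  | geq a b => max a.bound b.bound
  | cond c a b => max c.bound (max a.bound b.bound)
  | sum x b e => max (x + 1) (max b.bound e.bound)
  | pref a x f g => max (max 2 (x + 1)) (max a.bound (max f.bound g.bound))

/-- The nesting depth of loops. -/
def depth : Expr → ℕ
  | var _ => 0
  | lit _ => 0
  | add a b => max a.depth b.depth
  | sub a b => max a.depth b.depth
  | mul a b => max 1 (max a.depth b.depth)
  | load _ a => a.depth
  | geq a b => max a.depth b.depth
  | cond c a b => max c.depth (max a.depth b.depth)
  | sum _ b e => max b.depth (e.depth + 1)
  | pref a _ f g => max a.depth (max f.depth g.depth + 1)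

/-- The constant factor in the running time of an expression. -/
def cst : Expr → ℕ
  | var _ => 1
  | lit _ => 1
  | add a b => a.cst + b.cst + 1
  | sub a b => a.cst + b.cst + 1
  | mul a b => a.cst + b.cst + 4
  | load _ a => a.cst + 1
  | geq a b => a.cst + b.cst + 1
  | cond c a b => c.cst + a.cst + b.cst + 1
  | sum _ b e => b.cst + e.cst + 7
  | pref a _ f g => a.cst + f.cst + g.cst + 7

/-- All loops in the evaluation of the expression have at most `M` rounds. -/
def Bdd {n d : ℕ} (I : Instance n d) (M : ℕ) : Expr → State → Prop
  | var _, _ => True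
  | lit _, _ => True
  | add a b, s => Bdd I M a s ∧ Bdd I M b s
  | sub a b, s => Bdd I M a s ∧ Bdd I M b s
  | mul a b, s => Bdd I M a s ∧ Bdd I M b s ∧ eval I b s ≤ M
  | load _ a, s => Bdd I M a s
  | geq a b, s => Bdd I M a s ∧ Bdd I M b s
  | cond c a b, s => Bdd I M c s ∧ Bdd I M a s ∧ Bdd I M b s
  | sum x b e, s => Bdd I M b s ∧ eval I b s ≤ M ∧ ∀ i < eval I b s, Bdd I M e (s.setReg x i)
  | pref a x f g, s => Bdd I M a s ∧ s.reg 1 = d ∧ d ≤ M ∧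
      ∀ i < d, Bdd I M f (s.setReg x i) ∧ Bdd I M g (s.setReg x i)

/-- A program that evaluates the expression into register `k`, using only registers and arrays from
`k` on as scratch space. -/
def compile : ℕ → Expr → Program
  | k, var x => .copy k x
  | k, lit c => .const k c
  | k, add a b => .seq (compile k a) (.seq (compile (k + 1) b) (.add k k (k + 1)))
  | k, sub a b => .seq (compile k a) (.seq (compile (k + 1) b) (.sub k k (k + 1)))
  | k, mul a b => .seq (compile k a) (.seq (compile (k + 1) b) (.seq (.const (k + 2) 0)
      (.seq (.const (k + 3) 1) (.seq
        (.loop (k + 1) (.seq (.add (k + 2) (k + 2) k) (.sub (k + 1) (k + 1) (k + 3))))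
        (.copy k (k + 2))))))
  | k, load f a => .seq (compile k a) (.load k f k)
  | k, geq a b => .seq (compile k a) (.seq (compile (k + 1) b) (.askPoset k k (k + 1)))
  | k, cond c a b => .seq (compile k c) (.ite k (compile k a) (compile k b))
  | k, sum x b e => .seq (compile k b) (.seq (.copy (k + 1) x) (.seq (.const (k + 2) 0)
      (.seq (.const (k + 3) 1) (.seq (.const x 0) (.seq
        (.loop k (.seq (compile (k + 4) e) (.seq (.add (k + 2) (k + 2) (k + 4))
          (.seq (.add x x (k + 3)) (.sub k k (k + 3))))))
        (.seq (.copy x (k + 1)) (.copy k (k + 2))))))))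
  | k, pref a x f g => .seq (compile k a) (.seq (.copy (k + 1) x) (.seq (.const (k + 2) 1)
      (.seq (.copy (k + 3) 1) (.seq (.const x 0) (.seq
        (.loop (k + 3) (.seq (compile (k + 4) f) (.seq (.store k x (k + 4))
          (.seq (compile (k + 4) g) (.seq (.store (k + 1) x (k + 4))
            (.seq (.add x x (k + 2)) (.sub (k + 3) (k + 3) (k + 2))))))))
        (.seq (.copy x (k + 1)) (.askPref k k k (k + 1))))))))

variable {n d : ℕ} {I : Instance n d}

/-- An expression reads only below its `bound`, so scratch values written from `k` on while a
sibling is evaluated do not change it. -/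
theorem eval_congr {k : ℕ} {e : Expr} (hk : e.bound ≤ k) {s s' : State} (h : Agree k s s') :
    e.eval I s = e.eval I s' := by
  induction e generalizing s s' with
  | var x => exact h.1 x hk
  | lit c => rfl
  | add a b iha ihb | sub a b iha ihb | mul a b iha ihb | geq a b iha ihb =>
    simp only [bound, max_le_iff] at hk
    simp only [eval, iha hk.1 h, ihb hk.2 h]
  | load f a iha =>
    simp only [bound, max_le_iff] at hk
    simp only [eval, iha hk.2 h, h.2 f hk.1]
  | cond c a b ihc iha ihb =>
    simp only [bound, max_le_iff] at hk
    simp only [eval, ihc hk.1 h, iha hk.2.1 h, ihb hk.2.2 h]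
  | sum x b e ihb ihe =>
    simp only [bound, max_le_iff] at hk
    simp only [eval, ihb hk.2.1 h, ihe hk.2.2 (h.setReg x _)]
  | pref a x f g iha ihf ihg =>
    simp only [bound, max_le_iff] at hk
    simp only [eval, iha hk.2.1 h, ihf hk.2.2.1 (h.setReg x _), ihg hk.2.2.2 (h.setReg x _)]

theorem Bdd.congr {M k : ℕ} {e : Expr} (hk : e.bound ≤ k) {s s' : State} (h : Agree k s s')
    (hb : e.Bdd I M s) : e.Bdd I M s' := by
  induction e generalizing s s' with
  | var x => trivial
  | lit c => trivial
  | add a b iha ihb | sub a b iha ihb | geq a b iha ihb =>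
    simp only [bound, max_le_iff] at hk
    exact ⟨iha hk.1 h hb.1, ihb hk.2 h hb.2⟩
  | mul a b iha ihb =>
    simp only [bound, max_le_iff] at hk
    exact ⟨iha hk.1 h hb.1, ihb hk.2 h hb.2.1, eval_congr hk.2 h ▸ hb.2.2⟩
  | load f a iha =>
    simp only [bound, max_le_iff] at hk
    exact iha hk.2 h hb
  | cond c a b ihc iha ihb =>
    simp only [bound, max_le_iff] at hk
    exact ⟨ihc hk.1 h hb.1, iha hk.2.1 h hb.2.1, ihb hk.2.2 h hb.2.2⟩
  | sum x b e ihb ihe =>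
    simp only [bound, max_le_iff] at hk
    refine ⟨ihb hk.2.1 h hb.1, eval_congr hk.2.1 h ▸ hb.2.1, fun i hi => ?_⟩
    rw [← eval_congr hk.2.1 h] at hi
    exact ihe hk.2.2 (h.setReg x i) (hb.2.2 i hi)
  | pref a x f g iha ihf ihg =>
    simp only [bound, max_le_iff] at hk
    refine ⟨iha hk.2.1 h hb.1, (h.1 1 (by omega)).symm.trans hb.2.1, hb.2.2.1, fun i hi => ?_⟩
    exact ⟨ihf hk.2.2.1 (h.setReg x i) (hb.2.2.2 i hi).1,
      ihg hk.2.2.2 (h.setReg x i) (hb.2.2.2 i hi).2⟩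

end Expr

theorem Instance.lists_congr {n d : ℕ} (I : Instance n d) {f f' : ℕ → ℕ}
    (h : ∀ i < d, f i = f' i) (t : Finset (Fin n)) : I.Lists f t ↔ I.Lists f' t := by
  unfold Instance.Lists
  rw [Finset.image_congr (s := Finset.range (d - 1)) (f := f) (g := f')]
  intro i hi
  have : i < d - 1 := by simpa using hi
  exact h i (by omega)

/-- Queries read only `d - 1` cells, so it suffices that the compiled loop fills the first `d` cells
of its two arrays. -/
theorem Instance.prefAnswer_congr {n d : ℕ} (I : Instance n d) (x : ℕ) {f f' g g' : ℕ → ℕ}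
    (hf : ∀ i < d, f i = f' i) (hg : ∀ i < d, g i = g' i) :
    I.prefAnswer x f g = I.prefAnswer x f' g' := by
  classical
  unfold Instance.prefAnswer
  refine if_congr ?_ rfl rfl
  simp only [I.lists_congr hf, I.lists_congr hg]

/-! ### Correctness and running time of compiled expressions -/

namespace Expr

variable {n d : ℕ} {I : Instance n d}

/-- The time bound of an expression. -/
def time (M : ℕ) (e : Expr) : ℕ := e.cst * (M + 1) ^ e.depth

theorem time_le {M D : ℕ} {e : Expr} (h : e.depth ≤ D) : e.time M ≤ e.cst * (M + 1) ^ D :=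
  Nat.mul_le_mul_left _ (Nat.pow_le_pow_right (Nat.succ_pos M) h)

/-- Structural induction. `cst` adds up the constant costs, and each nesting of loops with at most
`M` rounds contributes one factor `M + 1`, counted by `depth`. The agreement below `k` lets the
value in register `k` survive the evaluation of a second operand, which works from `k + 1` on. -/
theorem compile_spec {M : ℕ} (e : Expr) {k : ℕ} (hk : e.bound ≤ k) {s : State}
    (hb : e.Bdd I M s) :
    Runs I (e.compile k) s (e.time M) fun s' => s'.reg k = e.eval I s ∧ Agree k s' s := by
  induction e generalizing k s with
  | var x =>
    exact (Runs.copy ⟨by simp [eval], Agree.rfl'.setReg_left _ le_rfl⟩).mono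
      (by simp [time, cst, depth]) fun _ h => h
  | lit c =>
    exact (Runs.const ⟨by simp [eval], Agree.rfl'.setReg_left _ le_rfl⟩).mono
      (by simp [time, cst, depth]) fun _ h => h
  | add a b iha ihb | sub a b iha ihb | geq a b iha ihb =>
    simp only [bound, max_le_iff] at hk
    refine Runs.mono (Runs.seq <| (iha hk.1 hb.1).mono le_rfl fun s₁ h₁ => Runs.seq <|
      (ihb (k := k + 1) (s := s₁) (by omega) (hb.2.congr hk.2 h₁.2.symm)).mono le_rfl
        fun s₂ h₂ => ?_) (T := a.time M + (b.time M + 1)) ?_ fun _ h => h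
    · first | apply Runs.add | apply Runs.sub | apply Runs.askPoset
      refine ⟨?_, ((h₂.2.mono (Nat.le_succ k)).trans h₁.2).setReg_left _ le_rfl⟩
      simp only [State.reg_setReg, if_true, h₂.1, h₂.2.1 k (Nat.lt_succ_self k), h₁.1, eval,
        eval_congr hk.2 h₁.2]
    · have h1 := time_le (M := M) (e := a) (le_max_left a.depth b.depth)
      have h2 := time_le (M := M) (e := b) (le_max_right a.depth b.depth)
      have h3 : 1 ≤ (M + 1) ^ max a.depth b.depth := Nat.one_le_pow _ _ (Nat.succ_pos M)
      have : (a.cst + b.cst + 1) * (M + 1) ^ max a.depth b.depth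
        = a.cst * (M + 1) ^ max a.depth b.depth + b.cst * (M + 1) ^ max a.depth b.depth
          + (M + 1) ^ max a.depth b.depth := by ring
      simp only [time, cst, depth] at *
      omega
  | mul a b iha ihb =>
    simp only [bound, max_le_iff] at hk
    refine Runs.mono (Runs.seq <| (iha hk.1 hb.1).mono le_rfl fun s₁ h₁ => Runs.seq <|
      (ihb (k := k + 1) (s := s₁) (by omega) (hb.2.1.congr hk.2 h₁.2.symm)).mono le_rfl
        fun s₂ h₂ => ?_) (T := a.time M + (b.time M + (1 + (1 + ((M * (2 + 1) + 1) + 1)))))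
        ?_ fun _ h => h
    · have hv : s₂.reg (k + 1) = b.eval I s := by rw [h₂.1, eval_congr hk.2 h₁.2]
      have hu : s₂.reg k = a.eval I s := by rw [h₂.2.1 k (Nat.lt_succ_self k), h₁.1]
      have ha : Agree k s₂ s := (h₂.2.mono (Nat.le_succ k)).trans h₁.2
      refine Runs.seq <| Runs.const <| Runs.seq <| Runs.const <| Runs.seq ?_
      refine (Runs.loop (T := 2) (b := b.eval I s)
        -- Multiplication is repeated addition: register `k + 2` accumulates while the second factor
        -- counts down.
        (fun i s' => s'.reg (k + 1) = b.eval I s - i ∧ s'.reg (k + 2) = a.eval I s * i ∧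
          s'.reg (k + 3) = 1 ∧ s'.reg k = a.eval I s ∧ Agree k s' s)
        (fun i s' h => h.1) ?_ ?_ (fun s' h => h)).mono ?_ ?_
      · rintro i s' hi ⟨h1, h2, h3, h4, h5⟩
        refine (Runs.seq <| Runs.add <| Runs.sub ?_).mono le_rfl fun _ h => h
        refine ⟨?_, ?_, ?_, ?_, ?_⟩
        · simp [h1, h3]; omega
        · simp [h2, h4]; ring
        · simp [h3]
        · simp [h4]
        · exact (h5.setReg_left _ (by omega)).setReg_left _ (by omega)
      · refine ⟨?_, ?_, ?_, ?_, ?_⟩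
        · simp [hv]
        · simp
        · simp
        · simp [hu]
        · exact (ha.setReg_left _ (by omega)).setReg_left _ (by omega)
      · have := Nat.mul_le_mul_right 3 hb.2.2
        omega
      · rintro s' ⟨h1, h2, h3, h4, h5⟩
        exact Runs.copy ⟨by simp [h2, eval], h5.setReg_left _ le_rfl⟩
    · have h1 := time_le (M := M) (e := a)
        ((le_max_left a.depth b.depth).trans (le_max_right 1 _))
      have h2 := time_le (M := M) (e := b)
        ((le_max_right a.depth b.depth).trans (le_max_right 1 _))
      have h3 : M + 1 ≤ (M + 1) ^ max 1 (max a.depth b.depth) :=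
        (pow_one (M + 1)).symm.le.trans <| Nat.pow_le_pow_right (Nat.succ_pos M) (le_max_left _ _)
      simp only [time, cst, depth] at *
      generalize (M + 1) ^ max 1 (max a.depth b.depth) = P at *
      have : (a.cst + b.cst + 4) * P = a.cst * P + b.cst * P + 4 * P := by ring
      omega
  | load f a iha =>
    simp only [bound, max_le_iff] at hk
    refine Runs.mono (Runs.seq <| (iha hk.2 hb).mono le_rfl fun s₁ h₁ => Runs.load
      ⟨?_, h₁.2.setReg_left _ le_rfl⟩) (T := a.time M + 1) ?_ fun _ h => h
    · have h3 : 1 ≤ (M + 1) ^ a.depth := Nat.one_le_pow _ _ (Nat.succ_pos M)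
      simp only [time, cst, depth, Nat.add_mul] at *
      omega
    · simp [eval, h₁.1, h₁.2.2 f hk.1]
  | cond c a b ihc iha ihb =>
    simp only [bound, max_le_iff] at hk
    refine Runs.mono (Runs.seq <| (ihc hk.1 hb.1).mono le_rfl fun s₁ h₁ =>
      Runs.ite (T := a.time M + b.time M) (fun hc => ?_) (fun hc => ?_)) ?_ fun _ h => h
    · refine (iha hk.2.1 (hb.2.1.congr hk.2.1 h₁.2.symm)).mono (by omega) fun s₂ h₂ =>
        ⟨?_, h₂.2.trans h₁.2⟩
      rw [h₂.1, eval_congr hk.2.1 h₁.2, eval, if_pos (by rwa [← h₁.1])]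
    · refine (ihb hk.2.2 (hb.2.2.congr hk.2.2 h₁.2.symm)).mono (by omega) fun s₂ h₂ =>
        ⟨?_, h₂.2.trans h₁.2⟩
      rw [h₂.1, eval_congr hk.2.2 h₁.2, eval, if_neg (by rw [← h₁.1, hc]; simp)]
    · have h1 := time_le (M := M) (e := c) (le_max_left c.depth (max a.depth b.depth))
      have h2 := time_le (M := M) (e := a)
        ((le_max_left a.depth b.depth).trans (le_max_right c.depth _))
      have h4 := time_le (M := M) (e := b)
        ((le_max_right a.depth b.depth).trans (le_max_right c.depth _))
      have h3 : 1 ≤ (M + 1) ^ max c.depth (max a.depth b.depth) :=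
        Nat.one_le_pow _ _ (Nat.succ_pos M)
      simp only [time, cst, depth] at *
      generalize (M + 1) ^ max c.depth (max a.depth b.depth) = P at *
      have : (c.cst + a.cst + b.cst + 1) * P = c.cst * P + a.cst * P + b.cst * P + P := by ring
      omega
  | sum x b e ihb ihe =>
    simp only [bound, max_le_iff] at hk
    obtain ⟨hx, hkb, hke⟩ := hk
    obtain ⟨hbb, hbM, hbe⟩ := hb
    refine Runs.mono (Runs.seq <| (ihb hkb hbb).mono le_rfl fun s₁ h₁ => ?_)
      (T := b.time M + (1 + (1 + (1 + (1 + ((M * (e.time M + (1 + (1 + 1)) + 1) + 1)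
        + (1 + 1))))))) ?_ fun _ h => h
    · obtain ⟨hv, ha⟩ := h₁
      refine Runs.seq <| Runs.copy <| Runs.seq <| Runs.const <| Runs.seq <| Runs.const <|
        Runs.seq <| Runs.const <| Runs.seq ?_
      refine (Runs.loop (T := e.time M + (1 + (1 + 1))) (b := b.eval I s)
        (fun i s' => s'.reg k = b.eval I s - i ∧ s'.reg (k + 1) = s.reg x ∧
          s'.reg (k + 2) = ∑ j ∈ range i, e.eval I (s.setReg x j) ∧
          s'.reg (k + 3) = 1 ∧ Agree k s' (s.setReg x i))
        (fun i s' h => h.1) ?_ ?_ (fun s' h => h)).mono ?_ ?_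
      · rintro i s' hi ⟨h1, h2, h3, h4, h5⟩
        refine Runs.seq <| (ihe (k := k + 4) (by omega)
          ((hbe i hi).congr hke h5.symm)).mono le_rfl ?_
        rintro s₂ ⟨g1, g2⟩
        have hr := g2.1
        refine Runs.seq <| Runs.add <| Runs.seq <| Runs.add <| Runs.sub ?_
        refine ⟨?_, ?_, ?_, ?_, ?_⟩
        · have e1 := hr k (by omega)
          have e2 := hr (k + 3) (by omega)
          simp [show k ≠ x by omega, show k + 3 ≠ x by omega, e1, e2, h1, h4]
          omega
        · simp [show k + 1 ≠ x by omega, hr (k + 1) (by omega), h2]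
        · simp [show k + 2 ≠ x by omega, hr (k + 2) (by omega), h3, sum_range_succ, g1,
            eval_congr hke h5]
        · simp [show k + 3 ≠ x by omega, hr (k + 3) (by omega), h4]
        · refine Agree.setReg_left ?_ _ le_rfl
          have hxi : s₂.reg x = i := by
            rw [hr x (by omega), h5.1 x (by omega)]; simp
          refine ⟨fun y hy => ?_, fun f hf => ?_⟩
          · have := h5.1 y hy
            have g := hr y (by omega)
            by_cases hyx : y = x
            · subst hyx
              simp [show y ≠ k + 2 by omega, hxi, hr (k + 3) (by omega), h4]
            · simp [hyx, show y ≠ k + 2 by omega, g] at this ⊢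
              exact this
          · exact (g2.2 f (by omega)).trans (h5.2 f hf)
      · refine ⟨?_, ?_, ?_, ?_, ?_⟩
        · simp [show k ≠ x by omega, hv]
        · simp [show k + 1 ≠ x by omega, ha.1 x (by omega)]
        · simp [show k + 2 ≠ x by omega]
        · simp [show k + 3 ≠ x by omega]
        · refine Agree.setReg ?_ x 0
          exact ((ha.setReg_left _ (by omega)).setReg_left _ (by omega)).setReg_left _ (by omega)
      · exact Nat.add_le_add_right (Nat.mul_le_mul_right _ hbM) 1
      · rintro s' ⟨h1, h2, h3, h4, h5⟩
        -- The bound variable `x` regains the value saved in register `k + 1`, so that it is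
        -- unchanged outside the sum.
        refine Runs.seq <| Runs.copy <| Runs.copy ⟨?_, ?_⟩
        · simp [show k + 2 ≠ x by omega, h3, eval]
        · refine Agree.setReg_left ?_ _ le_rfl
          refine ⟨fun y hy => ?_, fun f hf => h5.2 f hf⟩
          have := h5.1 y hy
          by_cases hyx : y = x
          · subst hyx; simp [h2]
          · simpa [hyx] using this
    · have h1 := time_le (M := M) (e := b) (le_max_left b.depth (e.depth + 1))
      have h2 : (M + 1) ^ (e.depth + 1) ≤ (M + 1) ^ max b.depth (e.depth + 1) :=
        Nat.pow_le_pow_right (Nat.succ_pos M) (le_max_right _ _)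
      have h3 : M + 1 ≤ (M + 1) ^ max b.depth (e.depth + 1) :=
        (pow_one (M + 1)).symm.le.trans <| (Nat.pow_le_pow_right (Nat.succ_pos M) (by omega)).trans h2
      simp only [time, cst, depth] at *
      have h4 : M * (e.cst * (M + 1) ^ e.depth) ≤ e.cst * (M + 1) ^ max b.depth (e.depth + 1) :=
        calc _ ≤ (M + 1) * (e.cst * (M + 1) ^ e.depth) := Nat.mul_le_mul_right _ (Nat.le_succ M)
          _ = e.cst * (M + 1) ^ (e.depth + 1) := by ring
          _ ≤ _ := Nat.mul_le_mul_left _ h2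
      generalize (M + 1) ^ max b.depth (e.depth + 1) = P at *
      have e1 : (b.cst + e.cst + 7) * P = b.cst * P + e.cst * P + 7 * P := by ring
      have e2 : M * (e.cst * (M + 1) ^ e.depth + (1 + (1 + 1)) + 1)
        = M * (e.cst * (M + 1) ^ e.depth) + 4 * M := by ring
      omega
  | pref a x f g iha ihf ihg =>
    simp only [bound, max_le_iff] at hk
    obtain ⟨⟨h1k, hx⟩, hka, hkf, hkg⟩ := hk
    obtain ⟨hba, hd, hdM, hbfg⟩ := hb
    refine Runs.mono (Runs.seq <| (iha hka hba).mono le_rfl fun s₁ h₁ => ?_)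
      (T := a.time M + (1 + (1 + (1 + (1 + ((d * (f.time M + (1 + (g.time M + (1 + (1 + 1))))
        + 1) + 1) + (1 + 2 * d))))))) ?_ fun _ h => h
    · obtain ⟨hv, ha⟩ := h₁
      refine Runs.seq <| Runs.copy <| Runs.seq <| Runs.const <| Runs.seq <| Runs.copy <|
        Runs.seq <| Runs.const <| Runs.seq ?_
      refine (Runs.loop (T := f.time M + (1 + (g.time M + (1 + (1 + 1))))) (b := d)
        (fun i s' => s'.reg (k + 3) = d - i ∧ s'.reg (k + 1) = s.reg x ∧
          s'.reg (k + 2) = 1 ∧ s'.reg k = a.eval I s ∧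
          (∀ j < i, s'.arr k j = f.eval I (s.setReg x j)) ∧
          (∀ j < i, s'.arr (k + 1) j = g.eval I (s.setReg x j)) ∧ Agree k s' (s.setReg x i))
        (fun i s' h => h.1) ?_ ?_ (fun s' h => h)).mono le_rfl ?_
      · rintro i s' hi ⟨h1, h2, h3, h4, h5, h6, h7⟩
        refine Runs.seq <| (ihf (k := k + 4) (by omega)
          ((hbfg i hi).1.congr hkf h7.symm)).mono le_rfl ?_
        rintro s₂ ⟨g1, g2⟩
        refine Runs.seq <| Runs.store <| Runs.seq ?_
        have hxi : s₂.reg x = i := by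
          rw [g2.1 x (by omega), h7.1 x (by omega)]; simp
        have ha₂ : Agree k (s₂.setArr k (s₂.reg x) (s₂.reg (k + 4))) (s.setReg x i) :=
          ((g2.mono (by omega)).trans h7).setArr_left _ _ le_rfl
        refine (ihg (k := k + 4) (by omega)
          ((hbfg i hi).2.congr hkg ha₂.symm)).mono le_rfl ?_
        rintro s₃ ⟨g3, g4⟩
        have hxi' : s₃.reg x = i := by
          rw [g4.1 x (by omega)]; simpa using hxi
        have ha₃ : Agree k s₃ (s.setReg x i) := (g4.mono (by omega)).trans ha₂
        have hr : ∀ y < k + 4, s₃.reg y = s'.reg y := fun y hy => by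
          rw [g4.1 y hy]; simpa using g2.1 y hy
        refine Runs.seq <| Runs.store <| Runs.seq <| Runs.add <| Runs.sub ?_
        refine ⟨?_, ?_, ?_, ?_, ?_, ?_, ?_⟩
        · have e1 := hr (k + 2) (by omega)
          have e2 := hr (k + 3) (by omega)
          simp [show k + 2 ≠ x by omega, show k + 3 ≠ x by omega, e1, e2, h1, h3]
          omega
        · simp [show k + 1 ≠ x by omega, hr (k + 1) (by omega), h2]
        · simp [show k + 2 ≠ x by omega, hr (k + 2) (by omega), h3]
        · simp [show k ≠ x by omega, hr k (by omega), h4]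
        · intro j hj
          simp only [State.arr_setReg, State.arr_setArr, show k ≠ k + 1 by omega, if_false,
            g4.2 k (by omega), if_true, hxi, g1, Function.update_apply, g2.2 k (by omega)]
          split_ifs with hji
          · rw [hji, eval_congr hkf h7]
          · exact h5 j (by omega)
        · intro j hj
          simp only [State.arr_setReg, State.arr_setArr, show k + 1 ≠ k by omega, if_false,
            g4.2 (k + 1) (by omega), if_true, hxi', g3, Function.update_apply,
            g2.2 (k + 1) (by omega)]
          split_ifs with hji
          · rw [hji, eval_congr hkg ha₂]
          · exact h6 j (by omega)
        · refine Agree.setReg_left ?_ _ (by omega)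
          refine ⟨fun y hy => ?_, fun F hF => ?_⟩
          · have := ha₃.1 y hy
            by_cases hyx : y = x
            · subst hyx
              simp [hxi', hr (k + 2) (by omega), h3]
            · simp [hyx] at this ⊢
              exact this
          · simp only [State.arr_setReg, State.arr_setArr, show F ≠ k + 1 by omega, if_false]
            exact ha₃.2 F hF
      · refine ⟨?_, ?_, ?_, ?_, by simp, by simp, ?_⟩
        -- The bound variable may be register `1` itself: `d` is copied to the counter before `x` is
        -- reset.
        · by_cases hx1 : x = 1
          · subst hx1
            have := ha.1 1 (by omega)
            simp [show k ≠ 0 by omega, this, hd]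
          · have := ha.1 1 (by omega)
            simp [show k + 3 ≠ x by omega, show k ≠ 0 by omega, this, hd]
        · simp [show k + 1 ≠ x by omega, ha.1 x (by omega)]
        · simp [show k + 2 ≠ x by omega]
        · simp [show k ≠ x by omega, hv]
        · refine Agree.setReg ?_ x 0
          exact ((ha.setReg_left _ (by omega)).setReg_left _ (by omega)).setReg_left _ (by omega)
      · rintro s' ⟨h1, h2, h3, h4, h5, h6, h7⟩
        refine Runs.seq <| Runs.copy <| Runs.askPref ⟨?_, ?_⟩
        · simp only [State.reg_setReg, if_true, show k ≠ x by omega, if_false, h4,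
            State.arr_setReg, eval]
          exact I.prefAnswer_congr _ h5 h6
        · refine Agree.setReg_left ?_ _ le_rfl
          refine ⟨fun y hy => ?_, fun f hf => h7.2 f hf⟩
          have := h7.1 y hy
          by_cases hyx : y = x
          · subst hyx; simp [h2]
          · simpa [hyx] using this
    · set D := max f.depth g.depth with hD
      have h1 := time_le (M := M) (e := a) (le_max_left a.depth (D + 1))
      have h2 : (M + 1) ^ (D + 1) ≤ (M + 1) ^ max a.depth (D + 1) :=
        Nat.pow_le_pow_right (Nat.succ_pos M) (le_max_right _ _)
      have h3 : M + 1 ≤ (M + 1) ^ max a.depth (D + 1) :=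
        (pow_one (M + 1)).symm.le.trans <| (Nat.pow_le_pow_right (Nat.succ_pos M) (by omega)).trans h2
      have h5 := time_le (M := M) (e := f) (le_max_left f.depth g.depth)
      have h6 := time_le (M := M) (e := g) (le_max_right f.depth g.depth)
      rw [← hD] at h5 h6
      have h7 : d * (f.time M + g.time M)
          ≤ (f.cst + g.cst) * (M + 1) ^ max a.depth (D + 1) :=
        calc _ ≤ (M + 1) * (f.cst * (M + 1) ^ D + g.cst * (M + 1) ^ D) :=
              Nat.mul_le_mul (by omega) (Nat.add_le_add h5 h6)
          _ = (f.cst + g.cst) * (M + 1) ^ (D + 1) := by ring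
          _ ≤ _ := Nat.mul_le_mul_left _ h2
      have e0 : time M (pref a x f g)
        = (a.cst + f.cst + g.cst + 7) * (M + 1) ^ max a.depth (D + 1) := rfl
      rw [e0]
      generalize (M + 1) ^ max a.depth (D + 1) = P at *
      have e1 : (a.cst + f.cst + g.cst + 7) * P = a.cst * P + (f.cst + g.cst) * P + 7 * P := by
        ring
      have e2 : d * (f.time M + (1 + (g.time M + (1 + (1 + 1)))) + 1)
        = d * (f.time M + g.time M) + 5 * d := by ring
      omega

end Expr

end MDSR

/-! ### Exchange arguments and stable matchings of large groups -/

namespace MDSR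

open Finset

/-- Among the elements of a finite set there are `k` ones with the smallest values of an injective
function. -/
theorem exists_subset_card_eq_lt {α : Type*} {f : α → ℕ} (hf : Function.Injective f) (Y : Finset α)
    {k : ℕ} (hk : k ≤ #Y) :
    ∃ X ⊆ Y, #X = k ∧ ∀ x ∈ X, ∀ y ∈ Y, y ∉ X → f x < f y := by
  classical
  induction k with
  | zero => exact ⟨∅, empty_subset _, rfl, by simp⟩
  | succ k ih =>
    obtain ⟨X, hXY, hX, hlt⟩ := ih (by omega)
    have hne : (Y \ X).Nonempty := by
      rw [← card_pos, card_sdiff_of_subset hXY]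
      omega
    obtain ⟨z, hz, hmin⟩ := exists_min_image (Y \ X) f hne
    rw [mem_sdiff] at hz
    refine ⟨insert z X, insert_subset hz.1 hXY, by rw [card_insert_of_notMem hz.2, hX], ?_⟩
    intro x hx y hy hyX
    rw [mem_insert, not_or] at hyX
    rcases mem_insert.1 hx with rfl | hx
    · exact lt_of_le_of_ne (hmin y (mem_sdiff.2 ⟨hy, hyX.2⟩)) fun h => hyX.1 (hf h).symm
    · exact hlt x hx y hy hyX.2

namespace Instance

variable {n d : ℕ} (I : Instance n d)

/-! ### Preferences -/

theorem Prefers.asymm {I : Instance n d} {a : Fin n} {t t' : Finset (Fin n)}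
    (h : I.Prefers a t t') : ¬ I.Prefers a t' t := by
  obtain ⟨h₁, h₂, h⟩ := h
  rintro ⟨_, _, h'⟩
  have := I.pref_strict a
  exact asymm_of (I.pref a) h h'

theorem Prefers.irrefl {I : Instance n d} {a : Fin n} {t : Finset (Fin n)} : ¬ I.Prefers a t t :=
  fun h => h.asymm h

theorem Prefers.trans {I : Instance n d} {a : Fin n} {t t' t'' : Finset (Fin n)}
    (h : I.Prefers a t t') (h' : I.Prefers a t' t'') : I.Prefers a t t'' := by
  obtain ⟨h₁, h₂, h⟩ := h
  obtain ⟨_, h₃, h'⟩ := h'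
  have := I.pref_strict a
  exact ⟨h₁, h₃, trans_of (I.pref a) h h'⟩

/-- The two sets have equal size, so the injection is a bijection, and derivedness leaves only
equality or strict preference. -/
theorem prefers_of_injOn {a : Fin n} {t t' : Finset (Fin n)} (ht : a ∉ t ∧ #t + 1 = d)
    (ht' : a ∉ t' ∧ #t' + 1 = d) (hne : t ≠ t') (g : Fin n → Fin n) (hg : ∀ x ∈ t, g x ∈ t')
    (hinj : Set.InjOn g t) (hge : ∀ x ∈ t, I.geq x (g x)) : I.Prefers a t t' := by
  have hbij : Function.Bijective (fun x : {x // x ∈ t} => (⟨g x.1, hg x.1 x.2⟩ : {x // x ∈ t'})) :=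
    by
    rw [Fintype.bijective_iff_injective_and_card]
    refine ⟨fun x y h => Subtype.ext (hinj x.2 y.2 (by simpa using h)), ?_⟩
    simp only [Fintype.card_coe]
    omega
  rcases I.derived a ⟨t, ht⟩ ⟨t', ht'⟩ ⟨Equiv.ofBijective _ hbij, fun x => hge x.1 x.2⟩ with h | h
  · exact absurd (congrArg Subtype.val h) hne
  · exact ⟨ht, ht', h⟩

/-- Exchanging the elements of `X \ T` for worse ones makes a group worse. -/
theorem prefers_of_exchange {a : Fin n} {X T : Finset (Fin n)} (hX : #X = d) (hT : #T = d)
    (haX : a ∈ X) (haT : a ∈ T) (hne : X ≠ T) (g : Fin n → Fin n)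
    (hg : ∀ x ∈ X \ T, g x ∈ T \ X) (hinj : Set.InjOn g (X \ T : Finset (Fin n)))
    (hge : ∀ x ∈ X \ T, I.geq x (g x)) : I.Prefers a (X.erase a) (T.erase a) := by
  have hd : 0 < d := hX ▸ card_pos.2 ⟨a, haX⟩
  refine I.prefers_of_injOn ⟨notMem_erase _ _, by rw [card_erase_of_mem haX]; omega⟩
    ⟨notMem_erase _ _, by rw [card_erase_of_mem haT]; omega⟩ ?_
    -- The map is extended by the identity on `X ∩ T`; no collision arises because `g` takes values
    -- outside `X`.
    (fun x => if x ∈ T then x else g x) ?_ ?_ ?_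
  · intro h
    exact hne (by rw [← insert_erase haX, ← insert_erase haT, h])
  · intro x hx
    rw [mem_erase] at hx
    split_ifs with h
    · exact mem_erase.2 ⟨hx.1, h⟩
    · have := mem_sdiff.1 (hg x (mem_sdiff.2 ⟨hx.2, h⟩))
      exact mem_erase.2 ⟨fun h' => this.2 (h' ▸ haX), this.1⟩
  · intro x hx y hy h
    have hx := (mem_erase.1 (mem_coe.1 hx)).2
    have hy := (mem_erase.1 (mem_coe.1 hy)).2
    dsimp only at h
    split_ifs at h with h₁ h₂ h₂
    · exact h
    · exact absurd (h ▸ hx) (mem_sdiff.1 (hg y (mem_sdiff.2 ⟨hy, h₂⟩))).2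
    · exact absurd (h ▸ hy) (mem_sdiff.1 (hg x (mem_sdiff.2 ⟨hx, h₁⟩))).2
    · exact hinj (mem_coe.2 (mem_sdiff.2 ⟨hx, h₁⟩)) (mem_coe.2 (mem_sdiff.2 ⟨hy, h₂⟩)) h
  · intro x hx
    split_ifs with h
    · exact I.geq_refl x
    · exact hge x (mem_sdiff.2 ⟨(mem_erase.1 hx).2, h⟩)

theorem card_sdiff_eq {X T : Finset (Fin n)} (hX : #X = d) (hT : #T = d) : #(X \ T) = #(T \ X) :=
  card_sdiff_comm (hX.trans hT.symm)

/-- Under complete domination any bijection between the two differences serves as the exchange. -/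
theorem prefers_of_dominates {a : Fin n} {X T : Finset (Fin n)} (hX : #X = d) (hT : #T = d)
    (haX : a ∈ X) (haT : a ∈ T) (hne : X ≠ T)
    (hge : ∀ x ∈ X, x ∉ T → ∀ y ∈ T, y ∉ X → I.geq x y) :
    I.Prefers a (X.erase a) (T.erase a) := by
  let e := Finset.equivOfCardEq (card_sdiff_eq hX hT)
  refine I.prefers_of_exchange hX hT haX haT hne
    (fun x => if h : x ∈ X \ T then (e ⟨x, h⟩).1 else x) ?_ ?_ ?_
  · intro x hx
    simp only [hx, dite_true]
    exact (e ⟨x, hx⟩).2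
  · intro x hx y hy h
    have hx := mem_coe.1 hx
    have hy := mem_coe.1 hy
    simp only [hx, hy, dite_true] at h
    exact congrArg Subtype.val (e.injective (Subtype.ext h))
  · intro x hx
    have h2 := mem_sdiff.1 (e ⟨x, hx⟩).2
    simp only [hx, dite_true]
    rw [mem_sdiff] at hx
    exact hge x hx.1 hx.2 _ h2.1 h2.2

theorem card_le_kappa (a : Fin n) {S : Finset (Fin n)} (h : ∀ b ∈ S, I.Incomparable a b) :
    #S ≤ I.kappa := by
  have h1 : #S ≤ {b : Fin n | I.Incomparable a b}.ncard := by
    rw [← Set.ncard_coe_finset]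
    exact Set.ncard_le_ncard (fun b hb => h b (mem_coe.1 hb)) (Set.toFinite _)
  exact h1.trans (le_sup (f := fun a : Fin n => {b : Fin n | I.Incomparable a b}.ncard)
    (mem_univ a))

theorem Incomparable.symm {I : Instance n d} {a b : Fin n} (h : I.Incomparable a b) :
    I.Incomparable b a := ⟨h.2, h.1⟩

/-! ### A linear extension of the master poset -/

open scoped Classical in
/-- The number of agents that are at least as good as `a`. -/
noncomputable def rank (a : Fin n) : ℕ := #{b | I.geq b a}

/-- The key by which agents are sorted: by rank, with ties broken by index. -/
noncomputable def key (a : Fin n) : ℕ := I.rank a * n + a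

/-- The position of an agent in the linear extension. -/
noncomputable def pos (a : Fin n) : ℕ := #{b | I.key b < I.key a}

theorem rank_lt {a b : Fin n} (h : I.geq a b) (hne : a ≠ b) : I.rank a < I.rank b := by
  classical
  refine card_lt_card ⟨fun c hc => ?_, fun hc => ?_⟩
  · simp only [mem_filter, mem_univ, true_and] at hc ⊢
    exact I.geq_trans _ _ _ hc h
  · have := hc (show b ∈ _ by simp [I.geq_refl])
    simp only [mem_filter, mem_univ, true_and] at this
    exact hne (I.geq_antisymm _ _ h this)

theorem key_lt {a b : Fin n} (h : I.geq a b) (hne : a ≠ b) : I.key a < I.key b := by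
  have h1 := Nat.mul_le_mul_right n (Nat.succ_le_of_lt (I.rank_lt h hne))
  have := a.2
  rw [Nat.succ_mul] at h1
  unfold key
  omega

theorem key_injective : Function.Injective I.key := by
  intro a b h
  have h1 : I.key a % n = a := by simp [key, Nat.mod_eq_of_lt a.2]
  have h2 : I.key b % n = b := by simp [key, Nat.mod_eq_of_lt b.2]
  exact Fin.ext (by rw [← h1, ← h2, h])

theorem pos_lt_pos_iff {a b : Fin n} : I.pos a < I.pos b ↔ I.key a < I.key b := by
  have mono : ∀ {a b}, I.key a ≤ I.key b → I.pos a ≤ I.pos b := fun h =>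
    card_le_card fun c hc => by
      simp only [mem_filter, mem_univ, true_and] at hc ⊢
      omega
  refine ⟨fun h => ?_, fun h => ?_⟩
  · by_contra h'
    exact absurd (mono (not_lt.1 h')) (by omega)
  · refine card_lt_card ⟨fun c hc => ?_, fun hc => ?_⟩
    · simp only [mem_filter, mem_univ, true_and] at hc ⊢
      omega
    · have := hc (show a ∈ _ by simpa using h)
      simp at this

theorem pos_injective : Function.Injective I.pos := by
  intro a b h
  have h1 := I.pos_lt_pos_iff (a := a) (b := b)
  have h2 := I.pos_lt_pos_iff (a := b) (b := a)
  exact I.key_injective (by omega)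

theorem pos_lt_of_geq {a b : Fin n} (h : I.geq a b) (hne : a ≠ b) : I.pos a < I.pos b :=
  I.pos_lt_pos_iff.2 (I.key_lt h hne)

theorem pos_lt (a : Fin n) : I.pos a < n := by
  have : #{b | I.key b < I.key a} < #(univ : Finset (Fin n)) :=
    card_lt_card ⟨subset_univ _, fun h => by simpa using h (mem_univ a)⟩
  simpa [pos] using this

theorem exists_pos_eq {p : ℕ} (hp : p < n) : ∃ a, I.pos a = p := by
  have hinj : Function.Injective (fun a : Fin n => (⟨I.pos a, I.pos_lt a⟩ : Fin n)) :=
    fun a b h => I.pos_injective (by simpa using h)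
  obtain ⟨a, ha⟩ := Finite.surjective_of_injective hinj ⟨p, hp⟩
  exact ⟨a, congrArg Fin.val ha⟩

theorem geq_of_not_incomparable {a b : Fin n} (h : ¬ I.Incomparable a b) (hlt : I.pos a < I.pos b) :
    I.geq a b := by
  by_contra hab
  have hba : I.geq b a := by
    by_contra hba
    exact h ⟨hab, hba⟩
  have := I.pos_lt_of_geq hba (by rintro rfl; omega)
  omega

/-! ### Existence for large groups -/

/-- `F` is closed under better elements of `R`. -/
def IsUpper (R F : Finset (Fin n)) : Prop := ∀ x ∈ F, ∀ y ∈ R, I.geq y x → y ∈ F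

/-- An initial segment of `R` in the linear extension is closed upwards. -/
theorem exists_isUpper (R : Finset (Fin n)) {k : ℕ} (hk : k ≤ #R) :
    ∃ F ⊆ R, #F = k ∧ I.IsUpper R F := by
  obtain ⟨F, hFR, hF, hlt⟩ := exists_subset_card_eq_lt I.pos_injective R hk
  refine ⟨F, hFR, hF, fun x hx y hy hyx => ?_⟩
  by_contra hyF
  have h1 := hlt x hx y hy hyF
  have h2 := I.pos_lt_of_geq hyx (by rintro rfl; exact hyF hx)
  omega

/-- If a group differs from an upper set in sufficiently many members, then everybody prefers the
upper set. -/
theorem prefers_of_isUpper {R F t : Finset (Fin n)} (hup : I.IsUpper R F) (htR : t ⊆ R)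
    (hF : #F = d) (ht : #t = d) {a : Fin n} (haF : a ∈ F) (hat : a ∈ t) (hne : F ≠ t)
    (hκ : 2 * I.kappa ≤ #(F \ t)) : I.Prefers a (F.erase a) (t.erase a) := by
  classical
  have hinc : ∀ x ∈ F, ∀ y ∈ t, y ∉ F → ¬ I.geq x y → I.Incomparable x y :=
    fun x hx y hy hyF h => ⟨h, fun h' => hyF (hup x hx y (htR hy) h')⟩
  have hcard := card_sdiff_eq hF ht
  let N : {x // x ∈ F \ t} → Finset (Fin n) := fun x => {y ∈ t \ F | I.geq x y}
  have hN : ∀ x, #(t \ F) ≤ #(N x) + I.kappa := fun x => by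
    rw [← card_filter_add_card_filter_not (s := t \ F) (fun y => I.geq x.1 y)]
    refine Nat.add_le_add_left (I.card_le_kappa x.1 fun y hy => ?_) _
    rw [mem_filter, mem_sdiff] at hy
    exact hinc _ (mem_sdiff.1 x.2).1 y hy.1.1 hy.1.2 hy.2
  -- Hall's condition. If `#s ≤ κ`, a single neighbourhood suffices, as it has at least `#(t \ F) -
  -- κ ≥ κ` elements. If `#s > κ`, the neighbourhoods cover `t \ F`, since a missed element would be
  -- incomparable to all of `s`.
  have hall : ∀ s : Finset {x // x ∈ F \ t}, #s ≤ #(s.biUnion N) := by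
    intro s
    rcases s.eq_empty_or_nonempty with rfl | ⟨x, hx⟩
    · simp
    by_cases hs : #s ≤ I.kappa
    · have := card_le_card (subset_biUnion_of_mem N hx)
      have := hN x
      omega
    · have hsub : t \ F ⊆ s.biUnion N := by
        intro y hy
        by_contra hyN
        refine hs ?_
        rw [← card_image_of_injective s Subtype.val_injective]
        refine I.card_le_kappa y fun z hz => ?_
        obtain ⟨x, hx, rfl⟩ := mem_image.1 hz
        have hy' := mem_sdiff.1 hy
        refine (hinc x.1 (mem_sdiff.1 x.2).1 y hy'.1 hy'.2 fun hge => hyN ?_).symm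
        exact mem_biUnion.2 ⟨x, hx, mem_filter.2 ⟨hy, hge⟩⟩
      have h1 := card_le_card hsub
      have h2 : #s ≤ #(F \ t) := (card_le_univ s).trans_eq (Fintype.card_coe _)
      omega
  obtain ⟨f, hf, hfN⟩ := (all_card_le_biUnion_card_iff_exists_injective N).1 hall
  refine I.prefers_of_exchange hF ht haF hat hne
    (fun x => if h : x ∈ F \ t then f ⟨x, h⟩ else x) ?_ ?_ ?_
  · intro x hx
    simp only [hx, dite_true]
    exact (mem_filter.1 (hfN ⟨x, hx⟩)).1
  · intro x hx y hy h
    have hx := mem_coe.1 hx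
    have hy := mem_coe.1 hy
    simp only [hx, hy, dite_true] at h
    exact congrArg Subtype.val (hf h)
  · intro x hx
    simp only [hx, dite_true]
    exact (mem_filter.1 (hfN ⟨x, hx⟩)).2

open scoped Classical in
/-- The elements of `R` that are strictly better than `x`. -/
noncomputable def above (R : Finset (Fin n)) (x : Fin n) : Finset (Fin n) :=
  {y ∈ R | I.geq y x ∧ y ≠ x}

theorem mem_above {R : Finset (Fin n)} {x y : Fin n} :
    y ∈ I.above R x ↔ y ∈ R ∧ I.geq y x ∧ y ≠ x := by
  simp [above]

theorem IsUpper.card_above_lt {I : Instance n d} {R F : Finset (Fin n)} (h : I.IsUpper R F)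
    {x : Fin n} (hx : x ∈ F) : #(I.above R x) < #F := by
  refine card_lt_card ⟨fun y hy => ?_, fun hsub => ?_⟩
  · rw [mem_above] at hy
    exact h x hx y hy.1 hy.2.1
  · exact (I.mem_above.1 (hsub hx)).2.2 rfl

/-- A set without elements below `x` is small. -/
theorem card_le_of_not_geq {R S : Finset (Fin n)} (hSR : S ⊆ R) {x : Fin n}
    (h : ∀ y ∈ S, ¬ I.geq x y) : #S ≤ #(I.above R x) + I.kappa := by
  classical
  rw [← card_filter_add_card_filter_not (s := S) (fun y => I.geq y x)]
  refine Nat.add_le_add (card_le_card fun y hy => ?_) (I.card_le_kappa x fun y hy => ?_)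
  · rw [mem_filter] at hy
    exact I.mem_above.2 ⟨hSR hy.1, hy.2, fun h' => h y hy.1 (h' ▸ I.geq_refl y)⟩
  · rw [mem_filter] at hy
    exact ⟨h y hy.1, hy.2⟩

/-- If `x` were missing, no member of `F` would lie below `x`, so `F` would consist of elements
above `x` and at most `κ` incomparable ones. -/
theorem IsUpper.mem_of_card_above {I : Instance n d} {R F : Finset (Fin n)} (h : I.IsUpper R F)
    (hFR : F ⊆ R) {x : Fin n} (hxR : x ∈ R) (hx : #(I.above R x) + I.kappa < #F) : x ∈ F := by
  by_contra hxF
  have := I.card_le_of_not_geq hFR (x := x) fun y hy hxy => hxF (h y hy x hxR hxy)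
  omega

/-- For the last such element in the linear extension, all the others are above it (fewer than `d`)
or incomparable to it (at most `κ`). -/
theorem card_filter_card_above_lt_le (R : Finset (Fin n)) :
    #{x ∈ R | #(I.above R x) < d} ≤ d + I.kappa := by
  set U := {x ∈ R | #(I.above R x) < d} with hU
  rcases U.eq_empty_or_nonempty with hne | hne
  · simp [hne]
  obtain ⟨x, hx, hmax⟩ := exists_max_image U I.pos hne
  have hsub : U.erase x ⊆ R := (erase_subset _ _).trans (filter_subset _ _)
  have h1 := I.card_le_of_not_geq hsub (x := x) fun y hy hxy => by
    rw [mem_erase] at hy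
    have := hmax y hy.2
    have := I.pos_lt_of_geq hxy (Ne.symm hy.1)
    omega
  rw [card_erase_of_mem hx] at h1
  have h2 := (mem_filter.1 hx).2
  omega

/-- The favourite group of an agent within `R`. -/
theorem exists_favourite {R : Finset (Fin n)} (hd : 0 < d) (hR : d ≤ #R) {h : Fin n} (hh : h ∈ R) :
    ∃ F ⊆ R, #F = d ∧ h ∈ F ∧
      ∀ t ⊆ R, #t = d → h ∈ t → t ≠ F → I.Prefers h (F.erase h) (t.erase h) := by
  classical
  have := I.pref_strict h
  let S : Finset (PartnerSet n d h) := {t | t.1 ⊆ R}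
  have hSne : ∃ t, t ∈ S := by
    obtain ⟨t, ht, htc⟩ := exists_subset_card_eq (s := R.erase h) (n := d - 1)
      (by rw [card_erase_of_mem hh]; omega)
    refine ⟨⟨t, fun h' => notMem_erase _ _ (ht h'), by omega⟩, ?_⟩
    simpa [S] using ht.trans (erase_subset _ _)
  -- Minimal for `pref h` means most preferred.
  have wf : WellFounded (I.pref h) := Finite.wellFounded_of_trans_of_irrefl _
  obtain ⟨t₀, ht₀, hmin⟩ := wf.has_min {t | t ∈ S} hSne
  have ht₀R : t₀.1 ⊆ R := by simpa [S] using ht₀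
  refine ⟨insert h t₀.1, insert_subset hh ht₀R, ?_, mem_insert_self _ _, ?_⟩
  · rw [card_insert_of_notMem t₀.2.1, t₀.2.2]
  · intro t htR ht hht hne
    have hte : h ∉ t.erase h ∧ #(t.erase h) + 1 = d :=
      ⟨notMem_erase _ _, by rw [card_erase_of_mem hht]; omega⟩
    rw [erase_insert t₀.2.1]
    refine ⟨t₀.2, hte, ?_⟩
    have hmem : (⟨t.erase h, hte⟩ : PartnerSet n d h) ∈ {t | t ∈ S} := by
      simpa [S] using (erase_subset _ _).trans htR
    rcases trichotomous_of (I.pref h) t₀ ⟨t.erase h, hte⟩ with h' | h' | h'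
    · exact h'
    · refine absurd ?_ hne
      rw [h']
      exact (insert_erase hht).symm
    · exact absurd h' (hmin _ hmem)

/-- Replacing a member other than `h` by a better agent outside `F` would improve the favourite
group of `h`. The agent `h` itself cannot be exchanged; there the bound on the number of agents
above `h` is needed. -/
theorem isUpper_favourite {R F : Finset (Fin n)} {h : Fin n} (hFR : F ⊆ R)
    (hF : #F = d) (hhF : h ∈ F) (hsmall : #(I.above R h) + I.kappa + 2 ≤ d)
    (hfav : ∀ t ⊆ R, #t = d → h ∈ t → t ≠ F → I.Prefers h (F.erase h) (t.erase h)) :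
    I.IsUpper R F := by
  have swap : ∀ x ∈ F, x ≠ h → ∀ y ∈ R, I.geq y x → y ∈ F := by
    intro x hx hxh y hy hyx
    by_contra hyF
    let t := insert y (F.erase x)
    have hyt : y ∉ F.erase x := fun h' => hyF (mem_of_mem_erase h')
    have htc : #t = d := by
      rw [card_insert_of_notMem hyt, card_erase_of_mem hx]
      have := card_pos.2 ⟨x, hx⟩
      omega
    have hht : h ∈ t := mem_insert_of_mem (mem_erase.2 ⟨hxh.symm, hhF⟩)
    have hne : t ≠ F := fun h' => hyF (h' ▸ mem_insert_self _ _)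
    refine (hfav t (insert_subset hy ((erase_subset _ _).trans hFR)) htc hht hne).asymm
      (I.prefers_of_dominates htc hF hht hhF hne ?_)
    intro u hu huF v hv hvt
    have hu' : u = y := by
      rcases mem_insert.1 hu with h' | h'
      · exact h'
      · exact absurd (mem_of_mem_erase h') huF
    have hv' : v = x := by
      by_contra hvx
      exact hvt (mem_insert_of_mem (mem_erase.2 ⟨hvx, hv⟩))
    rw [hu', hv']
    exact hyx
  intro x hx y hy hyx
  by_cases hxh : x = h
  · subst hxh
    by_contra hyF
    have hyx' : y ≠ x := fun h' => hyF (h' ▸ hx)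
    -- A member of `F` below `y`, other than `h`, would force `y` into `F` by the exchange. So the
    -- `d - 1` other members lie above `y` or are incomparable to it, while `y` has fewer agents
    -- above it than `h`.
    have h1 := I.card_le_of_not_geq ((erase_subset x F).trans hFR) (x := y) fun z hz hyz => by
      rw [mem_erase] at hz
      exact hyF (swap z hz.2 hz.1 y hy hyz)
    have h2 : #(I.above R y) < #(I.above R x) := by
      refine card_lt_card ⟨fun z hz => ?_, fun hsub => ?_⟩
      · rw [mem_above] at hz ⊢
        refine ⟨hz.1, I.geq_trans _ _ _ hz.2.1 hyx, ?_⟩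
        rintro rfl
        exact hyx' (I.geq_antisymm _ _ hyx hz.2.1)
      · exact (I.mem_above.1 (hsub (I.mem_above.2 ⟨hy, hyx, hyx'⟩))).2.2 rfl
    rw [card_erase_of_mem hx] at h1
    omega
  · exact swap x hx hxh y hy hyx

/-- If the groups are large, some upper set is the favourite of many of its members. -/
theorem exists_popular {R : Finset (Fin n)} (hd : 0 < d) (hR : d ≤ #R)
    (hκ : 4 * I.kappa * 2 ^ (4 * I.kappa) ≤ d) :
    ∃ F ⊆ R, #F = d ∧ I.IsUpper R F ∧ ∃ H ⊆ F, 2 * I.kappa ≤ #H ∧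
      ∀ h ∈ H, ∀ t ⊆ R, #t = d → h ∈ t → t ≠ F → I.Prefers h (F.erase h) (t.erase h) := by
  classical
  by_cases hκ0 : I.kappa = 0
  · obtain ⟨F, hFR, hF, hup⟩ := I.exists_isUpper R hR
    exact ⟨F, hFR, hF, hup, ∅, empty_subset _, by simp [hκ0], by simp⟩
  -- What the pigeonhole principle needs: `2 ^ (2 * κ)` possible favourites, each to be kept below
  -- `2 * κ` supporters, against `d - 1 - κ` voters.
  have hbig : 2 ^ (2 * I.kappa) * (2 * I.kappa) + I.kappa + 1 ≤ d := by
    refine le_trans ?_ hκ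
    have h1 : 2 ^ (2 * I.kappa) ≤ 2 ^ (4 * I.kappa) := Nat.pow_le_pow_right (by omega) (by omega)
    have h2 : 1 ≤ 2 ^ (4 * I.kappa) := Nat.one_le_two_pow
    generalize 2 ^ (2 * I.kappa) = a at *
    generalize 2 ^ (4 * I.kappa) = b at *
    generalize I.kappa = k at *
    have h3 : a * (2 * k) ≤ b * (2 * k) := Nat.mul_le_mul_right _ h1
    have h4 : 1 * (2 * k) ≤ b * (2 * k) := Nat.mul_le_mul_right _ h2
    have h5 : 4 * k * b = b * (2 * k) + b * (2 * k) := by ring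
    omega
  choose! Fav hFavR hFavc hFavh hFav using fun h (hh : h ∈ R) => I.exists_favourite hd hR hh
  -- The voters: agents with so few agents above them that their favourite groups are upper sets.
  let P : Finset (Fin n) := {h ∈ R | #(I.above R h) + I.kappa + 2 ≤ d}
  have hP : d - 1 - I.kappa ≤ #P := by
    obtain ⟨U, hUR, hU, hup⟩ := I.exists_isUpper R (k := d - 1 - I.kappa) (by omega)
    rw [← hU]
    refine card_le_card fun x hx => mem_filter.2 ⟨hUR hx, ?_⟩
    have := hup.card_above_lt hx
    omega
  -- Every upper `d`-set in `R` contains `L` and is contained in `U`, so it is determined by its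
  -- trace on `U \ L`.
  let L : Finset (Fin n) := {x ∈ R | #(I.above R x) + I.kappa < d}
  let U : Finset (Fin n) := {x ∈ R | #(I.above R x) < d}
  have hLU : L ⊆ U := fun x hx => by
    rw [mem_filter] at hx ⊢
    exact ⟨hx.1, by omega⟩
  have hL : d - I.kappa ≤ #L := by
    obtain ⟨V, hVR, hV, hup⟩ := I.exists_isUpper R (k := d - I.kappa) (by omega)
    rw [← hV]
    refine card_le_card fun x hx => mem_filter.2 ⟨hVR hx, ?_⟩
    have := hup.card_above_lt hx
    omega
  have hUL : #(U \ L) ≤ 2 * I.kappa := by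
    have : #U ≤ d + I.kappa := I.card_filter_card_above_lt_le R
    rw [card_sdiff_of_subset hLU]
    omega
  have hup : ∀ h ∈ P, I.IsUpper R (Fav h) := fun h hh => by
    obtain ⟨hhR, hh⟩ := mem_filter.1 hh
    exact I.isUpper_favourite (hFavR h hhR) (hFavc h hhR) (hFavh h hhR) hh (hFav h hhR)
  have hdet : ∀ h ∈ P, Fav h = L ∪ Fav h ∩ (U \ L) := fun h hh => by
    have hhR := (mem_filter.1 hh).1
    ext x
    simp only [mem_union, mem_inter, mem_sdiff]
    constructor
    · intro hx
      have : x ∈ U := mem_filter.2 ⟨hFavR h hhR hx, hFavc h hhR ▸ (hup h hh).card_above_lt hx⟩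
      tauto
    · rintro (hx | hx)
      · obtain ⟨hxR, hx⟩ := mem_filter.1 hx
        exact (hup h hh).mem_of_card_above (hFavR h hhR) hxR (by rwa [hFavc h hhR])
      · exact hx.1
  obtain ⟨A, -, hA⟩ := exists_le_card_fiber_of_mul_le_card_of_maps_to
    (s := P) (t := (U \ L).powerset) (f := fun h => Fav h ∩ (U \ L)) (n := 2 * I.kappa)
    (fun h _ => mem_powerset.2 inter_subset_right) ⟨∅, empty_mem_powerset _⟩ (by
      rw [card_powerset]
      have := Nat.mul_le_mul_right (2 * I.kappa)
        (Nat.pow_le_pow_right (show 0 < 2 by omega) hUL)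
      omega)
  obtain ⟨h₀, hh₀⟩ := card_pos.1 (lt_of_lt_of_le (by omega) hA)
  have hfib : ∀ h ∈ P.filter (fun h => Fav h ∩ (U \ L) = A), h ∈ R ∧ Fav h = L ∪ A :=
    fun h hh => by
      obtain ⟨hh, hA⟩ := mem_filter.1 hh
      exact ⟨(mem_filter.1 hh).1, by rw [hdet h hh, hA]⟩
  have h₀R := (hfib h₀ hh₀).1
  refine ⟨L ∪ A, (hfib h₀ hh₀).2 ▸ hFavR h₀ h₀R, (hfib h₀ hh₀).2 ▸ hFavc h₀ h₀R,
    (hfib h₀ hh₀).2 ▸ hup h₀ (mem_filter.1 hh₀).1, _, ?_, hA, ?_⟩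
  · intro h hh
    exact (hfib h hh).2 ▸ hFavh h (hfib h hh).1
  · intro h hh t htR ht hht hne
    rw [← (hfib h hh).2] at hne ⊢
    exact hFav h (hfib h hh).1 t htR ht hht hne

theorem hasStableMatching_of_large (hd : 0 < d) (hκ : 4 * I.kappa * 2 ^ (4 * I.kappa) ≤ d) :
    I.HasStableMatching := by
  -- Strong induction on the number of remaining agents, with groups and blocking sets confined to
  -- `R`.
  suffices H : ∀ (m : ℕ) (R : Finset (Fin n)), #R = m →
      ∃ M, I.IsMatching M ∧ (∀ s ∈ M, s ⊆ R) ∧ ∀ t ⊆ R, ¬ I.IsBlocking M t by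
    obtain ⟨M, hM, -, hs⟩ := H _ univ rfl
    exact ⟨M, hM, fun t => hs t (subset_univ t)⟩
  intro m
  induction m using Nat.strong_induction_on with
  | _ m ih =>
    intro R hRm
    by_cases hR : d ≤ #R
    · obtain ⟨F, hFR, hF, hup, H, hHF, hH, hfav⟩ := I.exists_popular hd hR hκ
      have hcard : #(R \ F) < m := by
        rw [card_sdiff_of_subset hFR]
        omega
      obtain ⟨M, hM, hMR, hst⟩ := ih _ hcard (R \ F) rfl
      have hdis : ∀ s ∈ M, Disjoint s F := fun s hs =>
        disjoint_left.2 fun x hx => (mem_sdiff.1 (hMR s hs hx)).2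
      refine ⟨insert F M, ⟨?_, ?_⟩, ?_, ?_⟩
      · intro t ht
        rcases mem_insert.1 ht with rfl | ht
        · exact hF
        · exact hM.1 t ht
      · intro s hs t ht hne
        rcases mem_insert.1 hs with rfl | hs' <;> rcases mem_insert.1 ht with rfl | ht'
        · exact absurd rfl hne
        · exact (hdis t ht').symm
        · exact hdis s hs'
        · exact hM.2 s hs' t ht' hne
      · intro s hs
        rcases mem_insert.1 hs with rfl | hs
        · exact hFR
        · exact (hMR s hs).trans sdiff_subset
      · intro t htR hbl
        have hF' : ∀ a ∈ t, a ∈ F → I.Prefers a (t.erase a) (F.erase a) := by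
          intro a hat haF
          rcases hbl.2 a hat with h | ⟨s, hs, has, h⟩
          · exact absurd haF (h F (mem_insert_self _ _))
          · rcases mem_insert.1 hs with rfl | hs
            · exact h
            · exact absurd haF (disjoint_left.1 (hdis s hs) has)
        by_cases hdj : Disjoint t F
        · refine hst t (fun x hx => mem_sdiff.2 ⟨htR hx, disjoint_left.1 hdj hx⟩) ⟨hbl.1, ?_⟩
          intro a hat
          rcases hbl.2 a hat with h | ⟨s, hs, has, h⟩
          · exact Or.inl fun s hs => h s (mem_insert_of_mem hs)
          · rcases mem_insert.1 hs with rfl | hs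
            · exact absurd has (disjoint_left.1 hdj hat)
            · exact Or.inr ⟨s, hs, has, h⟩
        · obtain ⟨a, hat, haF⟩ := not_disjoint_iff.1 hdj
          have hne : F ≠ t := by
            rintro rfl
            exact (hF' a hat haF).irrefl
          -- Members of `H` in `t` would prefer `t` to their favourite `F`; hence `H ⊆ F \ t`, which
          -- is large enough for `prefers_of_isUpper` to contradict the deviation of `a`.
          refine (hF' a hat haF).asymm
            (I.prefers_of_isUpper hup htR hF hbl.1 haF hat hne (hH.trans (card_le_card ?_)))
          intro h hh
          refine mem_sdiff.2 ⟨hHF hh, fun hht => ?_⟩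
          exact (hF' h hht (hHF hh)).asymm (hfav h hh t htR hbl.1 hht hne.symm)
    · refine ⟨∅, ⟨by simp, by simp⟩, by simp, fun t ht hbl => ?_⟩
      have := card_le_card ht
      have := hbl.1
      omega

/-- With everybody in a singleton group, a deviation would require preferring a set to itself. -/
theorem hasStableMatching_of_eq_one (hd : d = 1) : I.HasStableMatching := by
  subst hd
  refine ⟨univ.image fun a => {a}, ⟨by simp, ?_⟩, ?_⟩
  · simp only [mem_image, mem_univ, true_and]
    rintro _ ⟨a, rfl⟩ _ ⟨b, rfl⟩ hne
    exact disjoint_singleton.2 fun h => hne (by rw [h])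
  · rintro t ⟨ht, hb⟩
    obtain ⟨a, rfl⟩ := card_eq_one.1 ht
    rcases hb a (mem_singleton_self a) with h | ⟨s, hs, has, h⟩
    · exact h {a} (mem_image_of_mem _ (mem_univ a)) (mem_singleton_self a)
    · obtain ⟨b, -, rfl⟩ := mem_image.1 hs
      rw [mem_singleton.1 has] at h
      exact h.irrefl

end Instance

end MDSR

/-! ### Locality of stable matchings and of blocking groups -/

namespace MDSR

open Finset

/-- Greedy independent sets: a symmetric relation in which everything is related to at most `Δ`
elements admits large independent sets. -/
theorem exists_independent {α : Type*} (r : α → α → Prop) (hr : ∀ x y, r x y → r y x) {Δ m : ℕ}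
    (S : Finset α) (hΔ : ∀ x ∈ S, ∀ T ⊆ S, (∀ y ∈ T, r x y) → #T ≤ Δ) (hm : m * (Δ + 1) ≤ #S) :
    ∃ F ⊆ S, #F = m ∧ ∀ x ∈ F, ∀ y ∈ F, x ≠ y → ¬ r x y := by
  classical
  induction m generalizing S with
  | zero => exact ⟨∅, empty_subset _, rfl, by simp⟩
  | succ m ih =>
    rw [Nat.succ_mul] at hm
    obtain ⟨x, hx⟩ := card_pos.1 (show 0 < #S by omega)
    -- Choosing `x` and discarding its relatives removes at most `Δ + 1` elements.
    let S' := {y ∈ S.erase x | ¬ r x y}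
    have hS' : S' ⊆ S := (filter_subset _ _).trans (erase_subset _ _)
    have hcard : m * (Δ + 1) ≤ #S' := by
      have h1 := card_filter_add_card_filter_not (s := S.erase x) (fun y => r x y)
      have h2 := hΔ x hx {y ∈ S.erase x | r x y} ((filter_subset _ _).trans (erase_subset _ _))
        fun y hy => (mem_filter.1 hy).2
      rw [card_erase_of_mem hx] at h1
      change _ ≤ #{y ∈ S.erase x | ¬ r x y}
      omega
    obtain ⟨F, hF, hFm, hind⟩ :=
      ih S' (fun z hz T hT => hΔ z (hS' hz) T (hT.trans hS')) hcard
    have hxF : x ∉ F := fun h => notMem_erase x S (mem_filter.1 (hF h)).1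
    refine ⟨insert x F, insert_subset hx (hF.trans hS'), by rw [card_insert_of_notMem hxF, hFm],
      ?_⟩
    intro y hy z hz hne
    rcases mem_insert.1 hy with rfl | hy' <;> rcases mem_insert.1 hz with rfl | hz'
    · exact absurd rfl hne
    · exact (mem_filter.1 (hF hz')).2
    · exact fun h => (mem_filter.1 (hF hy')).2 (hr _ _ h)
    · exact hind y hy' z hz' hne

/-- A finite set of numbers without large gaps has small extent. -/
theorem le_add_of_gaps {α : Type*} (f : α → ℕ) (t : Finset α) {g : ℕ}
    (hg : ∀ x ∈ t, ∀ y ∈ t, f x < f y → (∀ z ∈ t, f z ≤ f x ∨ f y ≤ f z) → f y ≤ f x + g)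
    {x y : α} (hx : x ∈ t) (hy : y ∈ t) : f y ≤ f x + (#t - 1) * g := by
  classical
  -- Every value in between belongs to a gap of `t` and is thus within `g` of the left end of that
  -- gap. The left end is never `y`, which saves one summand.
  have hsub : Ico (f x) (f y) ⊆ (t.erase y).biUnion fun z => Ico (f z) (f z + g) := by
    intro v hv
    rw [mem_Ico] at hv
    obtain ⟨z, hz, hzmax⟩ := exists_max_image {z ∈ t | f z ≤ v} f ⟨x, mem_filter.2 ⟨hx, hv.1⟩⟩
    obtain ⟨w, hw, hwmin⟩ := exists_min_image {w ∈ t | v < f w} f ⟨y, mem_filter.2 ⟨hy, hv.2⟩⟩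
    rw [mem_filter] at hz hw
    have h := hg z hz.1 w hw.1 (by omega) fun u hu => by
      by_cases huv : f u ≤ v
      · exact Or.inl (hzmax u (mem_filter.2 ⟨hu, huv⟩))
      · exact Or.inr (hwmin u (mem_filter.2 ⟨hu, by omega⟩))
    refine mem_biUnion.2 ⟨z, mem_erase.2 ⟨?_, hz.1⟩, mem_Ico.2 ⟨hz.2, by omega⟩⟩
    rintro rfl
    omega
  have h1 := card_le_card hsub
  have h2 := card_biUnion_le_card_mul (t.erase y) (fun z => Ico (f z) (f z + g)) g (by simp)
  rw [card_erase_of_mem hy] at h2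
  rw [Nat.card_Ico] at h1
  omega

namespace Instance

variable {n d : ℕ} (I : Instance n d)

/-- The members of `M` with agents both before and after position `p`. -/
noncomputable def crossing (M : Finset (Finset (Fin n))) (p : ℕ) : Finset (Finset (Fin n)) :=
  {s ∈ M | (∃ a ∈ s, I.pos a < p) ∧ ∃ b ∈ s, p ≤ I.pos b}

open scoped Classical in
/-- The agents incomparable to some member of `s`. -/
noncomputable def incNbhd (s : Finset (Fin n)) : Finset (Fin n) :=
  s.biUnion fun a => {b | I.Incomparable a b}

theorem mem_incNbhd {s : Finset (Fin n)} {b : Fin n} :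
    b ∈ I.incNbhd s ↔ ∃ a ∈ s, I.Incomparable a b := by
  simp [incNbhd]

theorem card_incNbhd_le (s : Finset (Fin n)) : #(I.incNbhd s) ≤ #s * I.kappa := by
  classical
  exact card_biUnion_le_card_mul _ _ _ fun a _ => I.card_le_kappa a (by simp)

/-- Disjoint groups that each meet `Z` are at most as many as the elements of `Z`. -/
theorem card_le_of_forall_meets {M : Finset (Finset (Fin n))} (hM : I.IsMatching M)
    {T : Finset (Finset (Fin n))} (hT : T ⊆ M) {Z : Finset (Fin n)}
    (h : ∀ s ∈ T, ∃ b ∈ s, b ∈ Z) : #T ≤ #Z := by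
  refine card_le_card_of_forall_subsingleton (fun s b => b ∈ s)
    (fun s hs => (h s hs).imp fun b hb => ⟨hb.2, hb.1⟩) fun b _ s hs s' hs' => ?_
  by_contra hne
  exact disjoint_left.1 (hM.2 s (hT hs.1) s' (hT hs'.1) hne) hs.2 hs'.2

theorem isBlocking_of_dominates {M : Finset (Finset (Fin n))} (hM : I.IsMatching M)
    {X : Finset (Fin n)} (hX : #X = d)
    (h : ∀ a ∈ X, (∀ s ∈ M, a ∉ s) ∨ ∃ s ∈ M, a ∈ s ∧ X ≠ s ∧
      ∀ x ∈ X, x ∉ s → ∀ y ∈ s, y ∉ X → I.geq x y) : I.IsBlocking M X := by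
  refine ⟨hX, fun a ha => (h a ha).imp_right ?_⟩
  rintro ⟨s, hs, has, hne, hdom⟩
  exact ⟨s, hs, has, I.prefers_of_dominates hX (hM.1 s hs) ha has hne hdom⟩

/-- If many groups cross a position, then some agents before that position block. -/
theorem exists_blocking_of_crossing {M : Finset (Finset (Fin n))} (hM : I.IsMatching M) {p : ℕ}
    (hc : d * (d * I.kappa + 1) ≤ #(I.crossing M p)) :
    ∃ X, I.IsBlocking M X ∧ ∀ a ∈ X, I.pos a < p ∧ ∃ s ∈ I.crossing M p, a ∈ s := by
  classical
  have hcM : I.crossing M p ⊆ M := filter_subset _ _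
  -- There are `d` crossing groups with no incomparabilities between distinct ones: at most `d * κ`
  -- agents are incomparable to a member of a given group, and by disjointness they meet at most
  -- that many groups.
  obtain ⟨F, hFc, hFd, hind⟩ := exists_independent
    (fun s t : Finset (Fin n) => ∃ a ∈ s, ∃ b ∈ t, I.Incomparable a b)
    (fun s t ⟨a, ha, b, hb, h⟩ => ⟨b, hb, a, ha, h.symm⟩) (Δ := d * I.kappa) (m := d)
    (I.crossing M p) (fun s hs T hT h => by
      refine (I.card_le_of_forall_meets hM (hT.trans hcM) (Z := I.incNbhd s) ?_).trans
        ((I.card_incNbhd_le s).trans_eq (by rw [hM.1 s (hcM hs)]))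
      intro t ht
      obtain ⟨a, ha, b, hb, hab⟩ := h t ht
      exact ⟨b, hb, I.mem_incNbhd.2 ⟨a, ha, hab⟩⟩) hc
  let Y : Finset (Fin n) := F.biUnion fun s => {a ∈ s | I.pos a < p}
  have hY : d ≤ #Y := by
    rw [← hFd, card_biUnion]
    · rw [card_eq_sum_ones]
      refine sum_le_sum fun s hs => card_pos.2 ?_
      obtain ⟨a, ha, hap⟩ := (mem_filter.1 (hFc hs)).2.1
      exact ⟨a, mem_filter.2 ⟨ha, hap⟩⟩
    · intro s hs t ht hne
      exact disjoint_filter_filter (hM.2 s (hcM (hFc hs)) t (hcM (hFc ht)) hne)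
  -- The `d` foremost agents among the parts before `p`. For a member of `s`, each newcomer comes
  -- from another chosen group, hence is comparable to the old partners, and it precedes every
  -- partner that was left out.
  obtain ⟨X, hXY, hX, hlt⟩ := exists_subset_card_eq_lt I.pos_injective Y hY
  have hmem : ∀ a ∈ X, ∃ s ∈ F, a ∈ s ∧ I.pos a < p := fun a ha => by
    obtain ⟨s, hs, has⟩ := mem_biUnion.1 (hXY ha)
    exact ⟨s, hs, (mem_filter.1 has).1, (mem_filter.1 has).2⟩
  refine ⟨X, I.isBlocking_of_dominates hM hX fun a ha => Or.inr ?_, fun a ha => ?_⟩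
  · obtain ⟨s, hs, has, -⟩ := hmem a ha
    refine ⟨s, hcM (hFc hs), has, ?_, ?_⟩
    · rintro rfl
      obtain ⟨b, hb, hbp⟩ := (mem_filter.1 (hFc hs)).2.2
      obtain ⟨-, -, -, h⟩ := hmem b hb
      omega
    · intro u hu hus v hv hvX
      obtain ⟨s', hs', hus', hup⟩ := hmem u hu
      have hne : s' ≠ s := fun h => hus (h ▸ hus')
      refine I.geq_of_not_incomparable (fun h => hind s' hs' s hs hne ⟨u, hus', v, hv, h⟩) ?_
      by_cases hvp : I.pos v < p
      · exact hlt u hu v (mem_biUnion.2 ⟨s, hs, mem_filter.2 ⟨hv, hvp⟩⟩) hvX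
      · omega
  · obtain ⟨s, hs, has, hap⟩ := hmem a ha
    exact ⟨hap, s, hFc hs, has⟩

/-- A group that belongs to `M` or blocks `M`. -/
def IsWeaklyBlocking (M : Finset (Finset (Fin n))) (t : Finset (Fin n)) : Prop :=
  #t = d ∧ ∀ a ∈ t, (∀ s ∈ M, a ∉ s) ∨
    ∃ s ∈ M, a ∈ s ∧ (t = s ∨ I.Prefers a (t.erase a) (s.erase a))

theorem card_filter_pos {p p' : ℕ} (hp' : p' ≤ n) :
    #{a : Fin n | p ≤ I.pos a ∧ I.pos a < p'} = p' - p := by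
  rw [← Nat.card_Ico, ← card_image_of_injective _ I.pos_injective]
  congr 1
  ext v
  simp only [mem_image, mem_filter, mem_univ, true_and, mem_Ico]
  constructor
  · rintro ⟨a, ha, rfl⟩
    exact ha
  · intro hv
    obtain ⟨a, rfl⟩ := I.exists_pos_eq (hv.2.trans_le hp')
    exact ⟨a, hv, rfl⟩

/-- A group with a large gap gives rise to a better group that blocks. -/
theorem exists_blocking_of_gap {M : Finset (Finset (Fin n))} (hM : I.IsMatching M)
    {t : Finset (Fin n)} (hw : I.IsWeaklyBlocking M t) {p p' D : ℕ}
    (ht : ∀ a ∈ t, I.pos a < p ∨ p' ≤ I.pos a) (h₁ : ∃ a ∈ t, I.pos a < p)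
    (h₂ : ∃ a ∈ t, p' ≤ I.pos a) (hc : #(I.crossing M p) ≤ D) (hc' : #(I.crossing M p') ≤ D)
    (hgap : (D + D + d * I.kappa) * d + d * I.kappa + d ≤ p' - p) :
    ∃ X, I.IsBlocking M X ∧ ∑ a ∈ X, I.pos a < ∑ a ∈ t, I.pos a := by
  classical
  have hcM : ∀ p, I.crossing M p ⊆ M := fun p => filter_subset _ _
  obtain ⟨b₁, hb₁, hb₁p⟩ := h₁
  obtain ⟨b₂, hb₂, hb₂p⟩ := h₂
  have hd : 0 < d := hw.1 ▸ card_pos.2 ⟨b₁, hb₁⟩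
  let t₁ : Finset (Fin n) := {a ∈ t | I.pos a < p}
  let t₂ : Finset (Fin n) := {a ∈ t | ¬ I.pos a < p}
  have ht₁₂ : #t₁ + #t₂ = d := by rw [card_filter_add_card_filter_not, hw.1]
  have ht₂ : ∀ a ∈ t₂, p' ≤ I.pos a := fun a ha => by
    obtain ⟨ha, hap⟩ := mem_filter.1 ha
    exact (ht a ha).resolve_left hap
  have ht₂pos : 0 < #t₂ := card_pos.2 ⟨b₂, mem_filter.2 ⟨hb₂, by omega⟩⟩
  let C : Finset (Fin n) := {a | p ≤ I.pos a ∧ I.pos a < p'}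
  have hC : #C = p' - p := I.card_filter_pos (hb₂p.trans (I.pos_lt b₂).le)
  let Z := I.incNbhd t
  have hZ : #Z ≤ d * I.kappa := (I.card_incNbhd_le t).trans_eq (by rw [hw.1])
  let Mz : Finset (Finset (Fin n)) := {s ∈ M | ∃ b ∈ s, b ∈ Z}
  have hMz : #Mz ≤ d * I.kappa :=
    (I.card_le_of_forall_meets hM (filter_subset _ _) fun s hs => (mem_filter.1 hs).2).trans hZ
  let N := I.crossing M p ∪ I.crossing M p' ∪ Mz
  have hNM : N ⊆ M := union_subset (union_subset (hcM p) (hcM p')) (filter_subset _ _)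
  have hN : #N ≤ D + D + d * I.kappa :=
    (card_union_le _ _).trans (Nat.add_le_add ((card_union_le _ _).trans (Nat.add_le_add hc hc'))
      hMz)
  -- Agents to avoid in the gap: those incomparable to a member of `t`, and those whose group
  -- crosses an end of the gap or contains such an agent. At least `d` agents remain.
  let Bad := N.biUnion id ∪ Z
  have hBad : #Bad ≤ (D + D + d * I.kappa) * d + d * I.kappa := by
    refine (card_union_le _ _).trans (Nat.add_le_add ?_ hZ)
    exact (card_biUnion_le_card_mul _ _ d fun s hs => (hM.1 s (hNM hs)).le).trans
      (Nat.mul_le_mul_right d hN)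
  have hgood : d ≤ #(C \ Bad) := by
    have := le_card_sdiff Bad C
    omega
  -- The replacements for `t₂`. If some good agent is matched, its whole group lies in the gap and
  -- is comparable to `t`, and `E` is taken from that one group; otherwise all good agents are
  -- unmatched.
  obtain ⟨E, hEC, hE, hEZ, hEM⟩ : ∃ E ⊆ C, #E = #t₂ ∧ Disjoint E Z ∧
      ((∀ a ∈ E, ∀ s ∈ M, a ∉ s) ∨ ∃ s ∈ M, E ⊆ s ∧ s ⊆ C ∧ Disjoint s Z) := by
    by_cases hex : ∃ c ∈ C \ Bad, ∃ s ∈ M, c ∈ s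
    · obtain ⟨c, hc, s, hs, hcs⟩ := hex
      obtain ⟨hcC, hcB⟩ := mem_sdiff.1 hc
      have hsN : s ∉ N := fun h => hcB (mem_union_left _ (mem_biUnion.2 ⟨s, h, hcs⟩))
      simp only [N, Mz, mem_union, not_or, crossing, mem_filter, not_and, not_exists] at hsN
      obtain ⟨⟨hs₁, hs₂⟩, hs₃⟩ := hsN
      obtain ⟨hcp, hcp'⟩ := (mem_filter.1 hcC).2
      have hsC : s ⊆ C := by
        intro x hx
        refine mem_filter.2 ⟨mem_univ _, ?_, ?_⟩
        · by_contra h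
          exact hs₁ hs ⟨x, hx, by omega⟩ c hcs hcp
        · by_contra h
          exact hs₂ hs ⟨c, hcs, hcp'⟩ x hx (by omega)
      have hsZ : Disjoint s Z := disjoint_left.2 (hs₃ hs)
      obtain ⟨E, hEs, hE⟩ := exists_subset_card_eq (s := s) (n := #t₂) (by rw [hM.1 s hs]; omega)
      exact ⟨E, hEs.trans hsC, hE, disjoint_of_subset_left hEs hsZ, Or.inr ⟨s, hs, hEs, hsC, hsZ⟩⟩
    · push Not at hex
      obtain ⟨E, hEs, hE⟩ := exists_subset_card_eq (s := C \ Bad) (n := #t₂) (by omega)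
      refine ⟨E, hEs.trans sdiff_subset, hE, disjoint_left.2 fun a ha haZ => ?_,
        Or.inl fun a ha => hex a (hEs ha)⟩
      exact (mem_sdiff.1 (hEs ha)).2 (mem_union_right _ haZ)
  have hCp : ∀ a ∈ C, p ≤ I.pos a ∧ I.pos a < p' := fun a ha => (mem_filter.1 ha).2
  have ht₁p : ∀ a ∈ t₁, a ∈ t ∧ I.pos a < p := fun a ha => mem_filter.1 ha
  have hdis : Disjoint t₁ E := disjoint_left.2 fun a ha haE => by
    have := (ht₁p a ha).2
    have := (hCp a (hEC haE)).1
    omega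
  have hX : #(t₁ ∪ E) = d := by rw [card_union_of_disjoint hdis, hE, ht₁₂]
  have hcomp : ∀ a ∈ t, ∀ c, c ∉ Z → ¬ I.Incomparable a c := fun a ha c hc h =>
    hc (I.mem_incNbhd.2 ⟨a, ha, h⟩)
  -- For members of `t₁`, the agents of `E` precede and are comparable to those of `t₂` that they
  -- replace. For members of `E`, the agents of `t₁` likewise dominate the rest of their group `s`.
  have hpref : ∀ a ∈ t₁, I.Prefers a ((t₁ ∪ E).erase a) (t.erase a) := by
    intro a ha
    refine I.prefers_of_dominates hX hw.1 (mem_union_left _ ha) (ht₁p a ha).1 ?_ ?_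
    · intro h
      obtain ⟨c, hcE⟩ := card_pos.1 (hE ▸ ht₂pos)
      have := hCp c (hEC hcE)
      have := ht c (h ▸ mem_union_right _ hcE)
      omega
    · intro u hu hut v hv hvX
      have huE : u ∈ E := (mem_union.1 hu).resolve_left fun h => hut (ht₁p u h).1
      have hvp : ¬ I.pos v < p := fun h => hvX (mem_union_left _ (mem_filter.2 ⟨hv, h⟩))
      have h1 := (hCp u (hEC huE)).2
      have h2 := (ht v hv).resolve_left hvp
      exact I.geq_of_not_incomparable
        (fun h => hcomp v hv u (disjoint_left.1 hEZ huE) h.symm) (by omega)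
  refine ⟨t₁ ∪ E, ⟨hX, fun a ha => ?_⟩, ?_⟩
  · rcases mem_union.1 ha with ha | ha
    · refine (hw.2 a (ht₁p a ha).1).imp_right ?_
      rintro ⟨s, hs, has, rfl | h⟩
      · exact ⟨t, hs, has, hpref a ha⟩
      · exact ⟨s, hs, has, (hpref a ha).trans h⟩
    · refine hEM.imp (fun h => h a ha) ?_
      rintro ⟨s, hs, hEs, hsC, hsZ⟩
      refine ⟨s, hs, hEs ha, I.prefers_of_dominates hX (hM.1 s hs) (mem_union_right _ ha) (hEs ha)
        ?_ ?_⟩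
      · intro h
        have := (hCp b₁ (hsC (h ▸ mem_union_left _ (mem_filter.2 ⟨hb₁, hb₁p⟩)))).1
        omega
      · intro u hu hus v hv hvX
        have hut := ht₁p u ((mem_union.1 hu).resolve_right fun h => hus (hEs h))
        have := hCp v (hsC hv)
        exact I.geq_of_not_incomparable (hcomp u hut.1 v (disjoint_left.1 hsZ hv)) (by omega)
  · rw [sum_union hdis, ← sum_filter_add_sum_filter_not t (fun a => I.pos a < p)]
    refine Nat.add_lt_add_left ?_ _
    calc ∑ a ∈ E, I.pos a < ∑ _a ∈ E, p' :=
          sum_lt_sum_of_nonempty (card_pos.1 (hE ▸ ht₂pos)) fun a ha => (hCp a (hEC ha)).2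
      _ = ∑ _a ∈ t₂, p' := by simp [hE]
      _ ≤ ∑ a ∈ t₂, I.pos a := sum_le_sum ht₂

/-- The length of the intervals that matter. -/
noncomputable def width : ℕ := 7 * (I.kappa * d ^ 4)

/-- A weakly blocking group of least weight is short if few groups cross each position. -/
theorem pos_lt_of_isWeaklyBlocking (hκ : 1 ≤ I.kappa) {M : Finset (Finset (Fin n))}
    (hM : I.IsMatching M) (hc : ∀ p, #(I.crossing M p) ≤ d * (d * I.kappa + 1))
    {t : Finset (Fin n)} (hw : I.IsWeaklyBlocking M t)
    (hmin : ∀ X, I.IsBlocking M X → ¬ ∑ a ∈ X, I.pos a < ∑ a ∈ t, I.pos a) :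
    ∀ a ∈ t, ∀ b ∈ t, I.pos b < I.pos a + I.width := by
  intro a ha b hb
  have hd : 0 < d := hw.1 ▸ card_pos.2 ⟨a, ha⟩
  -- A group has at most `d - 1` gaps between consecutive members, each at most `7 * κ * d ^ 3`.
  have h := le_add_of_gaps I.pos t (g := 7 * (I.kappa * d ^ 3)) ?_ ha hb
  · rw [hw.1] at h
    have h1 : (d - 1) * (7 * (I.kappa * d ^ 3)) < I.width := by
      have : I.width = d * (7 * (I.kappa * d ^ 3)) := by rw [width]; ring
      rw [this]
      exact Nat.mul_lt_mul_of_pos_right (by omega) (by positivity)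
    omega
  · intro x hx y hy hxy hbetween
    by_contra hlt
    obtain ⟨X, hX, hsum⟩ := I.exists_blocking_of_gap hM hw (p := I.pos x + 1) (p' := I.pos y)
      (D := d * (d * I.kappa + 1)) (fun z hz => (hbetween z hz).imp_left fun h => by omega)
      ⟨x, hx, by omega⟩ ⟨y, hy, le_rfl⟩ (hc _) (hc _) (by
        refine le_trans ?_ (show 7 * (I.kappa * d ^ 3) ≤ _ by omega)
        have e2 : d ^ 2 ≤ I.kappa * d ^ 3 := by
          calc d ^ 2 ≤ d ^ 3 := Nat.pow_le_pow_right hd (by omega)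
            _ ≤ _ := Nat.le_mul_of_pos_left _ hκ
        have e1 : d ≤ d ^ 2 := Nat.le_self_pow (by omega) d
        have e3 : I.kappa * d ^ 2 ≤ I.kappa * d ^ 3 :=
          Nat.mul_le_mul_left _ (Nat.pow_le_pow_right hd (by omega))
        have e4 : I.kappa * d ≤ I.kappa * d ^ 2 := Nat.mul_le_mul_left _ e1
        -- The coefficients `2 + 2 + 1 + 1 + 1` of terms that are each at most `κ * d ^ 3` explain
        -- the constant `7`.
        have e5 : (d * (d * I.kappa + 1) + d * (d * I.kappa + 1) + d * I.kappa) * d + d * I.kappa + d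
          = 2 * (I.kappa * d ^ 3) + 2 * d ^ 2 + I.kappa * d ^ 2 + I.kappa * d + d := by ring
        omega)
    exact hmin X hX hsum

theorem IsBlocking.isWeaklyBlocking {I : Instance n d} {M : Finset (Finset (Fin n))}
    {t : Finset (Fin n)} (h : I.IsBlocking M t) : I.IsWeaklyBlocking M t :=
  ⟨h.1, fun a ha => (h.2 a ha).imp_right fun ⟨s, hs, has, hp⟩ => ⟨s, hs, has, Or.inr hp⟩⟩

/-- The groups of a stable matching are short. -/
theorem pos_lt_of_stable (hκ : 1 ≤ I.kappa) {M : Finset (Finset (Fin n))}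
    (hM : I.IsMatching M) (hst : ∀ t, ¬ I.IsBlocking M t) :
    ∀ s ∈ M, ∀ a ∈ s, ∀ b ∈ s, I.pos b < I.pos a + I.width := by
  intro s hs
  -- Members of `M` are weakly blocking, and minimality is vacuous because nothing blocks.
  refine I.pos_lt_of_isWeaklyBlocking hκ hM (fun p => ?_)
    ⟨hM.1 s hs, fun a ha => Or.inr ⟨s, hs, ha, Or.inl rfl⟩⟩ fun X hX => absurd hX (hst X)
  by_contra h
  obtain ⟨X, hX, -⟩ := I.exists_blocking_of_crossing hM (not_le.1 h).le
  exact hst X hX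

/-- A matching with short groups is stable if no short group blocks it. -/
theorem stable_of_local (hκ : 1 ≤ I.kappa) {M : Finset (Finset (Fin n))}
    (hM : I.IsMatching M) (hshort : ∀ s ∈ M, ∀ a ∈ s, ∀ b ∈ s, I.pos b < I.pos a + I.width)
    (hloc : ∀ t, (∀ a ∈ t, ∀ b ∈ t, I.pos b < I.pos a + I.width) → ¬ I.IsBlocking M t) :
    ∀ t, ¬ I.IsBlocking M t := by
  classical
  intro t ht
  obtain ⟨t, ht, hmin⟩ := exists_min_image {t : Finset (Fin n) | I.IsBlocking M t}
    (fun t => ∑ a ∈ t, I.pos a) ⟨t, by simpa using ht⟩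
  have ht : I.IsBlocking M t := by simpa using ht
  refine hloc t (I.pos_lt_of_isWeaklyBlocking hκ hM (fun p => ?_) ht.isWeaklyBlocking
    fun X hX => not_lt.2 (hmin X (by simpa using hX))) ht
  by_contra h
  obtain ⟨X, hX, hXp⟩ := I.exists_blocking_of_crossing hM (not_le.1 h).le
  -- The agents of `X` lie before `p` and belong to short groups reaching beyond `p`, so `X` is
  -- short as well.
  refine hloc X (fun a ha b hb => ?_) hX
  obtain ⟨s, hs, has⟩ := (hXp a ha).2
  obtain ⟨hsM, -, c, hc, hcp⟩ := mem_filter.1 hs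
  have := hshort s hsM a has c hc
  have := (hXp b hb).1
  omega

end Instance

end MDSR

namespace MDSR

open Finset

/-! ### Codes of sequences -/

/-- The digit with index `v` of `k` in base `B`. -/
def dig (B k v : ℕ) : ℕ := k / B ^ v % B

theorem dig_lt {B : ℕ} (hB : 0 < B) (k v : ℕ) : dig B k v < B := Nat.mod_lt _ hB

theorem exists_dig_eq {B : ℕ} (W : ℕ) (g : ℕ → ℕ) (hg : ∀ v < W, g v < B) :
    ∃ k < B ^ W, ∀ v < W, dig B k v = g v := by
  induction W generalizing g with
  | zero => exact ⟨0, by simp, by simp⟩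
  | succ W ih =>
    obtain ⟨k, hk, hd⟩ := ih (fun v => g (v + 1)) fun v hv => hg (v + 1) (by omega)
    have h0 := hg 0 (by omega)
    refine ⟨g 0 + B * k, ?_, fun v hv => ?_⟩
    · calc g 0 + B * k < B + B * k := by omega
        _ = B * (k + 1) := by ring
        _ ≤ B * B ^ W := Nat.mul_le_mul_left _ hk
        _ = B ^ (W + 1) := by ring
    · cases v with
      | zero => simp [dig, Nat.mod_eq_of_lt h0]
      | succ v =>
        rw [← hd v (by omega), dig, dig, Nat.pow_succ', ← Nat.div_div_eq_div_mul,
          Nat.add_mul_div_left _ _ (by omega), Nat.div_eq_of_lt h0, Nat.zero_add]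

/-- Codes `k` of windows of length `W` that end a sequence of windows, each the shift of the
previous one, with properties `G 0`, ..., `G i`. -/
def Reach (B W : ℕ) (G : ℕ → ℕ → Prop) : ℕ → ℕ → Prop
  | 0, k => G 0 k
  | i + 1, k => (∃ k₀ < B ^ W, Reach B W G i k₀ ∧ ∀ v < W - 1, dig B k₀ (v + 1) = dig B k v) ∧
      G (i + 1) k

/-- Consecutive windows overlap in `W - 1` digits, so a chain of shifted codes glues to one
sequence, and conversely a sequence is read off window by window. This requires that `G i` depends
only on the first `W` values. -/
theorem exists_reach_iff {B W : ℕ} (hB : 0 < B) (G : ℕ → (ℕ → ℕ) → Prop)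
    (hG : ∀ i g g', (∀ v < W, g v = g' v) → G i g → G i g') (i : ℕ) :
    (∃ k < B ^ W, Reach B W (fun i k => G i (dig B k)) i k) ↔
      ∃ f : ℕ → ℕ, (∀ u, f u < B) ∧ ∀ i' ≤ i, G i' fun v => f (i' + v) := by
  constructor
  · suffices H : ∀ k, Reach B W (fun i k => G i (dig B k)) i k → ∃ f : ℕ → ℕ, (∀ u, f u < B) ∧
        (∀ v < W, f (i + v) = dig B k v) ∧ ∀ i' ≤ i, G i' fun v => f (i' + v) by
      rintro ⟨k, -, hk⟩
      obtain ⟨f, hf, -, h⟩ := H k hk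
      exact ⟨f, hf, h⟩
    induction i with
    | zero =>
      intro k hk
      refine ⟨dig B k, dig_lt hB k, fun v _ => by rw [Nat.zero_add], fun i' hi' => ?_⟩
      obtain rfl : i' = 0 := by omega
      exact hG _ _ _ (fun v _ => by rw [Nat.zero_add]) hk
    | succ i ih =>
      rintro k ⟨⟨k₀, -, hk₀, hshift⟩, hk⟩
      obtain ⟨f₀, hf₀, hdig, hgood⟩ := ih k₀ hk₀
      -- The old sequence is kept before the new window. By the shift condition the new one still
      -- agrees with it below `i + W`, hence on all earlier windows.
      let f : ℕ → ℕ := fun u => if u < i + 1 then f₀ u else dig B k (u - (i + 1))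
      have hfk : ∀ v, f (i + 1 + v) = dig B k v := fun v => by
        simp only [f]
        rw [if_neg (by omega), Nat.add_sub_cancel_left]
      have hff₀ : ∀ u < i + W, f u = f₀ u := fun u hu => by
        by_cases hui : u < i + 1
        · exact if_pos hui
        · obtain ⟨v, rfl⟩ := Nat.exists_eq_add_of_le (not_lt.1 hui)
          rw [hfk, ← hshift v (by omega), ← hdig (v + 1) (by omega)]
          congr 1
          ring
      refine ⟨f, fun u => ?_, fun v _ => hfk v, fun i' hi' => ?_⟩
      · simp only [f]
        split_ifs
        · exact hf₀ u
        · exact dig_lt hB _ _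
      · by_cases hii : i' ≤ i
        · exact hG _ _ _ (fun v hv => (hff₀ _ (by omega)).symm) (hgood i' hii)
        · obtain rfl : i' = i + 1 := by omega
          exact hG _ _ _ (fun v _ => (hfk v).symm) hk
  · rintro ⟨f, hf, hgood⟩
    suffices H : ∀ j ≤ i, ∀ k, (∀ v < W, dig B k v = f (j + v)) →
        Reach B W (fun i k => G i (dig B k)) j k by
      obtain ⟨k, hk, hd⟩ := exists_dig_eq W (fun v => f (i + v)) fun v _ => hf _
      exact ⟨k, hk, H i le_rfl k hd⟩
    intro j
    induction j with
    | zero => exact fun hj k hk => hG _ _ _ (fun v hv => (hk v hv).symm) (hgood 0 hj)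
    | succ j ih =>
      intro hj k hk
      obtain ⟨k₀, hk₀, hd⟩ := exists_dig_eq W (fun v => f (j + v)) fun v _ => hf _
      refine ⟨⟨k₀, hk₀, ih (by omega) k₀ hd, fun v hv => ?_⟩,
        hG _ _ _ (fun v hv => (hk v hv).symm) (hgood _ hj)⟩
      rw [hd _ (by omega), hk v (by omega)]
      congr 1
      ring

/-! ### Listing the elements of a set -/

open scoped Classical in
/-- The array listing the values `h v` at the `v < W` with `P v`, in increasing order of `v`. -/
noncomputable def listFn (W : ℕ) (P : ℕ → Prop) (h : ℕ → ℕ) (x : ℕ) : ℕ :=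
  ∑ v ∈ range W, if P v ∧ #{v' ∈ range v | P v'} = x then h v else 0

-- Only one index contributes to the entry `x`: the one with `P` that has exactly `x` predecessors
-- with `P`, namely `Nat.nth P x`.
open scoped Classical in
theorem image_listFn (W : ℕ) (P : ℕ → Prop) (h : ℕ → ℕ) :
    (range #{v ∈ range W | P v}).image (listFn W P h) = {v ∈ range W | P v}.image h := by
  have hcount : ∀ v, #{v' ∈ range v | P v'} = Nat.count P v := fun v =>
    (Nat.count_eq_card_filter_range P v).symm
  have hval : ∀ v < W, P v → listFn W P h (Nat.count P v) = h v := fun v hv hPv => by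
    rw [listFn, sum_eq_single v]
    · rw [if_pos ⟨hPv, hcount v⟩]
    · intro w _ hwv
      refine if_neg fun ⟨hPw, hw⟩ => hwv ?_
      rw [hcount] at hw
      exact Nat.count_injective hPw hPv hw
    · intro h'
      exact absurd (mem_range.2 hv) h'
  rw [hcount]
  ext y
  simp only [mem_image, mem_range, mem_filter]
  constructor
  · rintro ⟨x, hx, rfl⟩
    have hfin : ∀ hf : {v | P v}.Finite, x < #hf.toFinset := fun hf =>
      hx.trans_le (by
        rw [Nat.count_eq_card_filter_range]
        exact card_le_card fun v hv => hf.mem_toFinset.2 (mem_filter.1 hv).2)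
    have hP : P (Nat.nth P x) := Nat.nth_mem x hfin
    have hlt : Nat.nth P x < W := Nat.nth_lt_of_lt_count hx
    refine ⟨Nat.nth P x, ⟨hlt, hP⟩, ?_⟩
    rw [← hval _ hlt hP, Nat.count_nth hfin]
  · rintro ⟨v, ⟨hv, hPv⟩, rfl⟩
    exact ⟨Nat.count P v, Nat.count_strict_mono hPv hv, hval v hv hPv⟩

namespace Instance

variable {n d : ℕ} (I : Instance n d)

theorem prefAnswer_ne_zero_iff {a : Fin n} {f g : ℕ → ℕ} {t t' : Finset (Fin n)}
    (ht : I.Lists f t) (ht' : I.Lists g t') :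
    I.prefAnswer a f g ≠ 0 ↔ I.Prefers a t t' := by
  classical
  unfold prefAnswer
  rw [ne_eq, ite_eq_right_iff, Classical.not_imp]
  constructor
  · rintro ⟨⟨b, u, u', hb, hu, hu', h⟩, -⟩
    obtain rfl : b = a := Fin.ext hb
    obtain rfl : u = t := image_injective Fin.val_injective (hu.trans ht.symm)
    obtain rfl : u' = t' := image_injective Fin.val_injective (hu'.trans ht'.symm)
    exact h
  · intro h
    exact ⟨⟨a, t, t', rfl, ht, ht', h⟩, one_ne_zero⟩

/-! ### Matchings as labelings -/

/-- The index of an agent in the padded linear extension. -/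
noncomputable def idx (a : Fin n) : ℕ := I.width + I.pos a

theorem idx_injective : Function.Injective I.idx := fun a b h =>
  I.pos_injective (by unfold idx at h; omega)

/-- The agents that the labeling `f` puts together with `a`. -/
noncomputable def cls (f : ℕ → ℕ) (a : Fin n) : Finset (Fin n) :=
  {b | I.idx b + f (I.idx b) = I.idx a + f (I.idx a)}

theorem mem_cls {f : ℕ → ℕ} {a b : Fin n} :
    b ∈ I.cls f a ↔ I.idx b + f (I.idx b) = I.idx a + f (I.idx a) := by
  simp [cls]

/-- The matching described by the labeling `f`. -/
noncomputable def groups (f : ℕ → ℕ) : Finset (Finset (Fin n)) :=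
  {s ∈ univ.image (I.cls f) | #s = d}

theorem mem_groups_iff {f : ℕ → ℕ} {s : Finset (Fin n)} {a : Fin n} (ha : a ∈ s) :
    s ∈ I.groups f ↔ s = I.cls f a ∧ #s = d := by
  simp only [groups, mem_filter, mem_image, mem_univ, true_and]
  constructor
  · rintro ⟨⟨b, rfl⟩, h⟩
    refine ⟨?_, h⟩
    ext c
    rw [mem_cls] at ha
    rw [mem_cls, mem_cls, ha]
  · rintro ⟨h, h'⟩
    exact ⟨⟨a, h.symm⟩, h'⟩

theorem mem_cls_self (f : ℕ → ℕ) (a : Fin n) : a ∈ I.cls f a := I.mem_cls.2 rfl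

theorem isMatching_groups (f : ℕ → ℕ) : I.IsMatching (I.groups f) := by
  refine ⟨fun t ht => (mem_filter.1 ht).2, fun s hs t ht hne => disjoint_left.2 fun a has hat => ?_⟩
  rw [I.mem_groups_iff has] at hs
  rw [I.mem_groups_iff hat] at ht
  exact hne (hs.1.trans ht.1.symm)

theorem isBlocking_groups_iff {f : ℕ → ℕ} {t : Finset (Fin n)} :
    I.IsBlocking (I.groups f) t ↔ #t = d ∧ ∀ a ∈ t, #(I.cls f a) = d →
      I.Prefers a (t.erase a) ((I.cls f a).erase a) := by
  refine and_congr_right fun _ => forall₂_congr fun a _ => ?_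
  constructor
  · rintro (h | ⟨s, hs, has, h⟩) hc
    · exact absurd (I.mem_cls_self f a)
        (h _ ((I.mem_groups_iff (I.mem_cls_self f a)).2 ⟨rfl, hc⟩))
    · rwa [← ((I.mem_groups_iff has).1 hs).1]
  · intro h
    by_cases hc : #(I.cls f a) = d
    · exact Or.inr ⟨_, (I.mem_groups_iff (I.mem_cls_self f a)).2 ⟨rfl, hc⟩, I.mem_cls_self f a, h hc⟩
    · refine Or.inl fun s hs has => hc ?_
      rw [I.mem_groups_iff has] at hs
      rw [← hs.1, hs.2]

/-- No group within the interval of positions that starts at `i` blocks. -/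
def LocallyStable (f : ℕ → ℕ) (i : ℕ) : Prop :=
  ∀ t, (∀ a ∈ t, i ≤ I.pos a ∧ I.pos a < i + I.width) → ¬ I.IsBlocking (I.groups f) t

/-- The label is the distance to the last member of the group, and `0` for unmatched agents. Index
plus label then identifies the last member, hence the group, and shortness keeps labels below
`width`. -/
theorem exists_labeling {M : Finset (Finset (Fin n))} (hM : I.IsMatching M) (hB : 0 < I.width)
    (hshort : ∀ s ∈ M, ∀ a ∈ s, ∀ b ∈ s, I.pos b < I.pos a + I.width) :
    ∃ f : ℕ → ℕ, (∀ u, f u < I.width) ∧ ∀ s ∈ M, ∀ a ∈ s, I.cls f a = s := by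
  classical
  have htop : ∀ a, ∃ c, (∀ s ∈ M, a ∈ s → c ∈ s ∧ ∀ b ∈ s, I.pos b ≤ I.pos c) ∧
      ((∀ s ∈ M, a ∉ s) → c = a) := by
    intro a
    by_cases h : ∃ s ∈ M, a ∈ s
    · obtain ⟨s, hs, has⟩ := h
      obtain ⟨c, hc, hmax⟩ := exists_max_image s I.pos ⟨a, has⟩
      refine ⟨c, fun s' hs' has' => ?_, fun h => absurd has (h s hs)⟩
      obtain rfl : s' = s := by
        by_contra hne
        exact disjoint_left.1 (hM.2 s' hs' s hs hne) has' has
      exact ⟨hc, hmax⟩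
    · push Not at h
      exact ⟨a, fun s hs has => absurd has (h s hs), fun _ => rfl⟩
  choose top htopM htopU using htop
  let f : ℕ → ℕ := fun u => if h : ∃ a, I.idx a = u then I.pos (top h.choose) - I.pos h.choose
    else 0
  have hf : ∀ a, f (I.idx a) = I.pos (top a) - I.pos a := fun a => by
    have h : ∃ b, I.idx b = I.idx a := ⟨a, rfl⟩
    have hc : h.choose = a := I.idx_injective h.choose_spec
    simp only [f, h, dite_true]
    rw [hc]
  have hle : ∀ a, I.pos a ≤ I.pos (top a) ∧ I.pos (top a) < I.pos a + I.width := fun a => by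
    by_cases h : ∃ s ∈ M, a ∈ s
    · obtain ⟨s, hs, has⟩ := h
      obtain ⟨h1, h2⟩ := htopM a s hs has
      exact ⟨h2 a has, hshort s hs a has _ h1⟩
    · push Not at h
      rw [htopU a h]
      omega
  have hkey : ∀ a b, I.idx b + f (I.idx b) = I.idx a + f (I.idx a) ↔ top b = top a := fun a b => by
    rw [hf, hf]
    have h1 := (hle a).1
    have h2 := (hle b).1
    unfold idx
    constructor
    · intro h
      exact I.pos_injective (by omega)
    · intro h
      rw [h] at h2 ⊢
      omega
  refine ⟨f, fun u => ?_, fun s hs a has => ?_⟩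
  · by_cases h : ∃ a, I.idx a = u
    · obtain ⟨a, rfl⟩ := h
      rw [hf]
      have := hle a
      omega
    · simpa [f, h] using hB
  · ext b
    rw [mem_cls, hkey]
    obtain ⟨hc, hmax⟩ := htopM a s hs has
    constructor
    · intro h
      by_cases hb : ∃ s' ∈ M, b ∈ s'
      · obtain ⟨s', hs', hbs'⟩ := hb
        obtain rfl : s' = s := by
          by_contra hne
          exact disjoint_left.1 (hM.2 s' hs' s hs hne) (htopM b s' hs' hbs').1 (h ▸ hc)
        exact hbs'
      · push Not at hb
        rw [← htopU b hb, h]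
        exact hc
    · intro hbs
      obtain ⟨hc', hmax'⟩ := htopM b s hs hbs
      exact I.pos_injective (le_antisymm (hmax _ hc') (hmax' _ hc))

theorem width_pos (hκ : 1 ≤ I.kappa) (hd : 0 < d) : 0 < I.width := by
  unfold width
  positivity

/-- Stable matchings have short groups and so come from labelings. Conversely, labels below `width`
describe short groups, for which excluding short blocking sets suffices. -/
theorem hasStableMatching_iff (hκ : 1 ≤ I.kappa) (hd : 0 < d) :
    I.HasStableMatching ↔
      ∃ f : ℕ → ℕ, (∀ u, f u < I.width) ∧ ∀ i < n, I.LocallyStable f i := by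
  constructor
  · rintro ⟨M, hM, hst⟩
    obtain ⟨f, hf, hcls⟩ :=
      I.exists_labeling hM (I.width_pos hκ hd) (I.pos_lt_of_stable hκ hM hst)
    refine ⟨f, hf, fun i _ t _ hbl => hst t ?_⟩
    rw [isBlocking_groups_iff] at hbl
    refine ⟨hbl.1, fun a ha => ?_⟩
    by_cases h : ∃ s ∈ M, a ∈ s
    · obtain ⟨s, hs, has⟩ := h
      have := hcls s hs a has
      exact Or.inr ⟨s, hs, has, this ▸ hbl.2 a ha (by rw [this, hM.1 s hs])⟩
    · push Not at h
      exact Or.inl h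
  · rintro ⟨f, hf, hst⟩
    refine ⟨I.groups f, I.isMatching_groups f, I.stable_of_local hκ (I.isMatching_groups f) ?_ ?_⟩
    · intro s hs a ha b hb
      rw [((I.mem_groups_iff ha).1 hs).1, mem_cls] at hb
      have := hf (I.idx a)
      unfold idx at *
      omega
    · intro t ht hbl
      -- A short set lies in the interval that starts at its first member.
      obtain ⟨a, ha, hmin⟩ := exists_min_image t I.pos (card_pos.1 (hbl.1 ▸ hd))
      exact hst (I.pos a) (I.pos_lt a) t (fun b hb => ⟨hmin b hb, ht a ha b hb⟩) hbl

/-! ### Windows -/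

/-- The elements of the window starting at index `i` that belong to the set described by `μ`. -/
def WinMem (i : ℕ) (μ : ℕ → ℕ) (v : ℕ) : Prop :=
  I.width ≤ v ∧ v < I.width + I.width ∧ i + v < I.width + n ∧ μ v ≠ 0

/-- The elements of the window starting at index `i` with the same group as `u` in the labeling
`g`. -/
def WinCls (i : ℕ) (g : ℕ → ℕ) (u v : ℕ) : Prop :=
  I.width ≤ i + v ∧ i + v < I.width + n ∧ v + g v = u + g u

open scoped Classical in
/-- The set described by `μ` blocks the labeling `g` of the window starting at index `i`. -/
def WinBlocks (ord : ℕ → ℕ) (i : ℕ) (g μ : ℕ → ℕ) : Prop :=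
  #{v ∈ range (3 * I.width) | I.WinMem i μ v} = d ∧
    ∀ u < 3 * I.width, I.WinMem i μ u →
      #{v ∈ range (3 * I.width) | I.WinCls i g u v} = d →
      I.prefAnswer (ord (i + u))
        (listFn (3 * I.width) (fun v => I.WinMem i μ v ∧ v ≠ u) fun v => ord (i + v))
        (listFn (3 * I.width) (fun v => I.WinCls i g u v ∧ v ≠ u) fun v => ord (i + v)) ≠ 0

/-- The set `A` of agents lies in the window starting at index `i` and is described there by
`P`. -/
def Represents (i : ℕ) (P : ℕ → Prop) (A : Finset (Fin n)) : Prop :=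
  (∀ v < 3 * I.width, P v ↔ ∃ a ∈ A, I.idx a = i + v) ∧
    ∀ a ∈ A, i ≤ I.idx a ∧ I.idx a < i + 3 * I.width

variable {I}

open scoped Classical in
theorem Represents.card_eq {i : ℕ} {P : ℕ → Prop} {A : Finset (Fin n)} (h : I.Represents i P A) :
    #{v ∈ range (3 * I.width) | P v} = #A := by
  symm
  refine card_bij (fun a _ => I.idx a - i) (fun a ha => ?_) (fun a ha b hb hab => ?_)
    fun v hv => ?_
  · have h1 := h.2 a ha
    rw [mem_filter, mem_range]
    exact ⟨by omega, (h.1 _ (by omega)).2 ⟨a, ha, by omega⟩⟩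
  · have h1 := h.2 a ha
    have h2 := h.2 b hb
    exact I.idx_injective (by omega)
  · rw [mem_filter, mem_range] at hv
    obtain ⟨a, ha, hav⟩ := (h.1 v hv.1).1 hv.2
    exact ⟨a, ha, by omega⟩

theorem Represents.erase {i : ℕ} {P : ℕ → Prop} {A : Finset (Fin n)} (h : I.Represents i P A)
    {a : Fin n} {u : ℕ} (hu : I.idx a = i + u) :
    I.Represents i (fun v => P v ∧ v ≠ u) (A.erase a) := by
  refine ⟨fun v hv => ?_, fun b hb => h.2 b (mem_of_mem_erase hb)⟩
  dsimp only
  rw [h.1 v hv]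
  constructor
  · rintro ⟨⟨b, hb, hbv⟩, hvu⟩
    refine ⟨b, mem_erase.2 ⟨?_, hb⟩, hbv⟩
    rintro rfl
    omega
  · rintro ⟨b, hb, hbv⟩
    rw [mem_erase] at hb
    refine ⟨⟨b, hb.2, hbv⟩, ?_⟩
    rintro rfl
    exact hb.1 (I.idx_injective (hbv.trans hu.symm))

theorem Represents.lists {i : ℕ} {P : ℕ → Prop} {A : Finset (Fin n)} (h : I.Represents i P A)
    {ord : ℕ → ℕ} (hord : ∀ a, ord (I.idx a) = a) (hA : #A = d - 1) :
    I.Lists (listFn (3 * I.width) P fun v => ord (i + v)) A := by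
  classical
  unfold Lists
  rw [← hA, ← h.card_eq, image_listFn]
  ext y
  simp only [mem_image, mem_filter, mem_range]
  constructor
  · rintro ⟨a, ha, rfl⟩
    have h1 := h.2 a ha
    refine ⟨I.idx a - i, ⟨by omega, (h.1 _ (by omega)).2 ⟨a, ha, by omega⟩⟩, ?_⟩
    rw [Nat.add_sub_cancel' h1.1, hord]
  · rintro ⟨v, ⟨hv, hPv⟩, rfl⟩
    obtain ⟨a, ha, hav⟩ := (h.1 v hv).1 hPv
    exact ⟨a, ha, by rw [← hav, hord]⟩

theorem exists_idx_eq {u : ℕ} (h : I.width ≤ u) (h' : u < I.width + n) : ∃ a, I.idx a = u := by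
  obtain ⟨a, ha⟩ := I.exists_pos_eq (p := u - I.width) (by omega)
  exact ⟨a, by unfold idx; omega⟩

theorem idx_lt (a : Fin n) : I.idx a < I.width + n := by
  have := I.pos_lt a
  unfold idx
  omega

/-- Labels are below `width`, so members of one class differ by less than `width`. A class with a
member in the middle third of the window therefore lies in the window. The padding by `width` makes
the middle third of window `i` begin at position `i`. -/
theorem represents_cls {f g : ℕ → ℕ} (hf : ∀ u, f u < I.width) {i : ℕ}
    (hg : ∀ v < 3 * I.width, g v = f (i + v)) {a : Fin n} {u : ℕ} (hu : I.idx a = i + u)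
    (h₁ : I.width ≤ u) (h₂ : u < I.width + I.width) :
    I.Represents i (I.WinCls i g u) (I.cls f a) := by
  have hgu := hg u (by omega)
  have hfa : f (I.idx a) = g u := by rw [hu, hgu]
  refine ⟨fun v hv => ?_, fun b hb => ?_⟩
  · constructor
    · rintro ⟨h3, h4, h5⟩
      obtain ⟨b, hb⟩ := exists_idx_eq (I := I) h3 h4
      refine ⟨b, I.mem_cls.2 ?_, hb⟩
      rw [hfa, hb, ← hg v hv, hu]
      omega
    · rintro ⟨b, hb, hbv⟩
      rw [mem_cls, hfa, hbv, ← hg v hv, hu] at hb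
      have := idx_lt (I := I) b
      exact ⟨by rw [← hbv]; exact Nat.le_add_right _ _, by omega, by omega⟩
  · rw [mem_cls] at hb
    have h3 := hf (I.idx a)
    have h4 := hf (I.idx b)
    omega

/-- Sets to be tested live in the middle third, so they and the present groups of their members are
visible in the window, and both lists passed to the preference query are faithful. -/
theorem winBlocks_iff_isBlocking {ord : ℕ → ℕ} (hord : ∀ a, ord (I.idx a) = a) {f g μ : ℕ → ℕ}
    (hf : ∀ u, f u < I.width) {i : ℕ} (hg : ∀ v < 3 * I.width, g v = f (i + v))
    {t : Finset (Fin n)} (ht : I.Represents i (I.WinMem i μ) t) :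
    I.WinBlocks ord i g μ ↔ I.IsBlocking (I.groups f) t := by
  classical
  rw [isBlocking_groups_iff, WinBlocks, ht.card_eq]
  refine and_congr_right fun htd => ?_
  have key : ∀ a u, a ∈ t → I.idx a = i + u → u < 3 * I.width → I.WinMem i μ u →
      ((#{v ∈ range (3 * I.width) | I.WinCls i g u v} = d →
        I.prefAnswer (ord (i + u))
        (listFn (3 * I.width) (fun v => I.WinMem i μ v ∧ v ≠ u) fun v => ord (i + v))
        (listFn (3 * I.width) (fun v => I.WinCls i g u v ∧ v ≠ u) fun v => ord (i + v)) ≠ 0) ↔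
      (#(I.cls f a) = d → I.Prefers a (t.erase a) ((I.cls f a).erase a))) := by
    intro a u ha hau hu hmem
    have hcls := represents_cls hf hg hau hmem.1 hmem.2.1
    rw [hcls.card_eq]
    refine forall_congr' fun hc => ?_
    rw [← hau, hord]
    exact I.prefAnswer_ne_zero_iff
      ((ht.erase hau).lists hord (by rw [card_erase_of_mem ha, htd]))
      ((hcls.erase hau).lists hord (by rw [card_erase_of_mem (I.mem_cls_self f a), hc]))
  constructor
  · intro h a ha
    have h1 := ht.2 a ha
    have h2 : I.WinMem i μ (I.idx a - i) := (ht.1 _ (by omega)).2 ⟨a, ha, by omega⟩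
    exact (key a (I.idx a - i) ha (by omega) (by omega) h2).1 (h _ (by omega) h2)
  · intro h u hu hmem
    obtain ⟨a, ha, hau⟩ := (ht.1 u hu).1 hmem
    exact (key a u ha hau hu hmem).2 (h a ha)

/-- Only arguments below `3 * width` matter, also inside `listFn`; this is why finitely many codes
suffice. -/
theorem WinBlocks.congr {ord : ℕ → ℕ} {i : ℕ} {g g' μ μ' : ℕ → ℕ}
    (hg : ∀ v < 3 * I.width, g v = g' v) (hμ : ∀ v < 3 * I.width, μ v = μ' v)
    (h : I.WinBlocks ord i g μ) : I.WinBlocks ord i g' μ' := by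
  classical
  have hm : ∀ v < 3 * I.width, (I.WinMem i μ v ↔ I.WinMem i μ' v) := fun v hv => by
    simp only [WinMem, hμ v hv]
  have hc : ∀ u < 3 * I.width, ∀ v < 3 * I.width, (I.WinCls i g u v ↔ I.WinCls i g' u v) :=
    fun u hu v hv => by simp only [WinCls, hg u hu, hg v hv]
  have hl : ∀ {P P' : ℕ → Prop} (o : ℕ → ℕ), (∀ v < 3 * I.width, (P v ↔ P' v)) →
      listFn (3 * I.width) P o = listFn (3 * I.width) P' o := by
    intro P P' o hP
    funext x
    refine sum_congr rfl fun v hv => ?_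
    rw [mem_range] at hv
    have : #{v' ∈ range v | P v'} = #{v' ∈ range v | P' v'} := by
      congr 1
      exact filter_congr fun w hw => hP w ((mem_range.1 hw).trans hv)
    simp only [hP v hv, this]
  refine ⟨?_, fun u hu hmem hcard => ?_⟩
  · refine Eq.trans ?_ h.1
    congr 1
    exact filter_congr fun v hv => (hm v (mem_range.1 hv)).symm
  · have := h.2 u hu ((hm u hu).2 hmem) (by
      refine Eq.trans ?_ hcard
      congr 1
      exact filter_congr fun v hv => hc u hu v (mem_range.1 hv))
    rwa [hl _ fun v hv => and_congr_left' (hm v hv),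
      hl _ fun v hv => and_congr_left' (hc u hu v hv)] at this

theorem locallyStable_iff {ord : ℕ → ℕ} (hord : ∀ a, ord (I.idx a) = a) {f g : ℕ → ℕ}
    (hf : ∀ u, f u < I.width) {i : ℕ} (hg : ∀ v < 3 * I.width, g v = f (i + v))
    (hB : 1 < I.width) :
    I.LocallyStable f i ↔
      ¬ ∃ m < I.width ^ (3 * I.width), I.WinBlocks ord i g (dig I.width m) := by
  classical
  constructor
  · rintro h ⟨m, -, hm⟩
    let t : Finset (Fin n) := {a | ∃ v, I.WinMem i (dig I.width m) v ∧ I.idx a = i + v}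
    have ht : ∀ a, a ∈ t ↔ ∃ v, I.WinMem i (dig I.width m) v ∧ I.idx a = i + v := by simp [t]
    refine h t (fun a ha => ?_) ((winBlocks_iff_isBlocking hord hf hg ⟨fun v hv => ?_,
      fun a ha => ?_⟩).1 hm)
    · obtain ⟨v, hv, hav⟩ := (ht a).1 ha
      have := hv.1
      have := hv.2.1
      unfold idx at hav
      omega
    · constructor
      · intro hmem
        obtain ⟨a, ha⟩ := exists_idx_eq (I := I) (hmem.1.trans (Nat.le_add_left v i)) hmem.2.2.1
        exact ⟨a, (ht a).2 ⟨v, hmem, ha⟩, ha⟩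
      · rintro ⟨a, ha, hav⟩
        obtain ⟨w, hw, haw⟩ := (ht a).1 ha
        obtain rfl : v = w := by omega
        exact hw
    · obtain ⟨v, hv, hav⟩ := (ht a).1 ha
      have := hv.1
      have := hv.2.1
      omega
  · intro h t ht hbl
    -- Sets use the same codes as labelings, with nonzero digits marking members; the digit `1`
    -- exists because `1 < width`.
    let μ : ℕ → ℕ := fun v => if ∃ a ∈ t, I.idx a = i + v then 1 else 0
    obtain ⟨m, hm, hdig⟩ := exists_dig_eq (B := I.width) (3 * I.width) μ fun v _ => by
      simp only [μ]
      split_ifs <;> omega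
    refine h ⟨m, hm, WinBlocks.congr (g := g) (μ := μ) (fun _ _ => rfl)
      (fun v hv => (hdig v hv).symm) ?_⟩
    refine (winBlocks_iff_isBlocking hord hf hg ⟨fun v hv => ?_, fun a ha => ?_⟩).2 hbl
    · constructor
      · rintro ⟨-, -, -, h⟩
        by_contra hne
        simp [μ, hne] at h
      · rintro ⟨a, ha, hav⟩
        have h1 := ht a ha
        have h2 := idx_lt (I := I) a
        refine ⟨?_, ?_, by omega, ?_⟩
        · unfold idx at hav; omega
        · unfold idx at hav; omega
        · have : ∃ a ∈ t, I.idx a = i + v := ⟨a, ha, hav⟩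
          simp [μ, this]
    · have := ht a ha
      unfold idx
      omega

/-- The labelings of windows without a blocking set, by their codes. -/
def WinGood (I : Instance n d) (ord : ℕ → ℕ) (i k : ℕ) : Prop :=
  ¬ ∃ m < I.width ^ (3 * I.width), I.WinBlocks ord i (dig I.width k) (dig I.width m)

/-- The dynamic program decides whether there is a stable matching. -/
theorem hasStableMatching_iff_reach (hκ : 1 ≤ I.kappa) (hd : 0 < d) (hn : 0 < n) {ord : ℕ → ℕ}
    (hord : ∀ a, ord (I.idx a) = a) :
    I.HasStableMatching ↔ ∃ k < I.width ^ (3 * I.width),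
      Reach I.width (3 * I.width) (I.WinGood ord) (n - 1) k := by
  -- The factor `7` in the width guarantees a base of at least two.
  have hB : 1 < I.width := by
    have : 0 < I.kappa * d ^ 4 := by positivity
    unfold width
    omega
  rw [I.hasStableMatching_iff hκ hd]
  refine Iff.trans ?_ (exists_reach_iff (by omega) (fun i g =>
    ¬ ∃ m < I.width ^ (3 * I.width), I.WinBlocks ord i g (dig I.width m)) ?_ (n - 1)).symm
  · refine exists_congr fun f => and_congr_right fun hf => ?_
    constructor
    · intro h i hi
      exact (locallyStable_iff hord hf (fun _ _ => rfl) hB).1 (h i (by omega))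
    · intro h i hi
      exact (locallyStable_iff hord hf (fun _ _ => rfl) hB).2 (h i (by omega))
  · rintro i g g' hgg h ⟨m, hm, hb⟩
    exact h ⟨m, hm, hb.congr (fun v hv => (hgg v hv).symm) fun _ _ => rfl⟩

end Instance

end MDSR

namespace MDSR

open Finset

/-! ### Boolean expressions -/

/-- The number `v` is the truth value of `P`. -/
def Decides (v : ℕ) (P : Prop) : Prop := (P → v = 1) ∧ (¬ P → v = 0)

namespace Decides

variable {v w : ℕ} {P Q : Prop}

theorem ne_zero_iff (h : Decides v P) : v ≠ 0 ↔ P := by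
  by_cases hP : P
  · simp [h.1 hP, hP]
  · simp [h.2 hP, hP]

theorem congr (h : Decides v P) (hPQ : P ↔ Q) : Decides v Q :=
  ⟨fun hQ => h.1 (hPQ.2 hQ), fun hQ => h.2 fun hP => hQ (hPQ.1 hP)⟩

theorem eq_ite [Decidable P] (h : Decides v P) : v = if P then 1 else 0 := by
  split_ifs with hP
  · exact h.1 hP
  · exact h.2 hP

theorem _root_.MDSR.decides_of_pos (h : v = 1) (hP : P) : Decides v P :=
  ⟨fun _ => h, fun h' => absurd hP h'⟩

end Decides

namespace Expr

/-- Whether `a ≤ b`. -/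
def le (a b : Expr) : Expr := sub (lit 1) (sub a b)

/-- Whether `a < b`. -/
def lt (a b : Expr) : Expr := le (add a (lit 1)) b

/-- Conjunction. -/
def and (a b : Expr) : Expr := cond a b (lit 0)

/-- Negation. -/
def not (a : Expr) : Expr := cond a (lit 0) (lit 1)

/-- Whether `a = b`. -/
def eq (a b : Expr) : Expr := and (le a b) (le b a)

/-- Whether `a` is nonzero. -/
def pos (a : Expr) : Expr := cond a (lit 1) (lit 0)

/-- Whether `e` holds for some value of the register `x` smaller than `b`. -/
def ex (x : ℕ) (b e : Expr) : Expr := pos (sum x b e)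

/-- Whether `e` holds for all values of the register `x` smaller than `b`. -/
def all (x : ℕ) (b e : Expr) : Expr := not (sum x b (not e))

variable {n d : ℕ} {I : Instance n d} {s : State} {a b e : Expr} {P Q : Prop}

theorem decides_le : Decides ((le a b).eval I s) (a.eval I s ≤ b.eval I s) := by
  simp only [le, eval, Decides]
  omega

theorem decides_lt : Decides ((lt a b).eval I s) (a.eval I s < b.eval I s) :=
  decides_le.congr (by simp only [eval]; omega)

theorem eval_cond_of_ne_zero {c : Expr} (h : c.eval I s ≠ 0) :
    (cond c a b).eval I s = a.eval I s := if_pos h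

theorem eval_cond_of_eq_zero {c : Expr} (h : c.eval I s = 0) :
    (cond c a b).eval I s = b.eval I s := if_neg (not_not.2 h)

theorem decides_and (ha : Decides (a.eval I s) P) (hb : P → Decides (b.eval I s) Q) :
    Decides ((and a b).eval I s) (P ∧ Q) := by
  by_cases hP : P
  · rw [and, eval_cond_of_ne_zero (ha.ne_zero_iff.2 hP)]
    exact (hb hP).congr (by simp [hP])
  · rw [and, eval_cond_of_eq_zero (ha.2 hP)]
    exact ⟨fun h => absurd h.1 hP, fun _ => rfl⟩

theorem decides_not_eq_zero : Decides ((not a).eval I s) (a.eval I s = 0) := by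
  by_cases h : a.eval I s = 0
  · rw [not, eval_cond_of_eq_zero h]
    exact decides_of_pos rfl h
  · rw [not, eval_cond_of_ne_zero h]
    exact ⟨fun h' => absurd h' h, fun _ => rfl⟩

theorem decides_not (ha : Decides (a.eval I s) P) : Decides ((not a).eval I s) (¬ P) :=
  decides_not_eq_zero.congr (by rw [← ha.ne_zero_iff, not_not])

theorem decides_eq : Decides ((eq a b).eval I s) (a.eval I s = b.eval I s) :=
  (decides_and decides_le fun _ => decides_le).congr le_antisymm_iff.symm

theorem decides_pos : Decides ((pos a).eval I s) (a.eval I s ≠ 0) := by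
  by_cases h : a.eval I s = 0
  · rw [pos, eval_cond_of_eq_zero h]
    exact ⟨fun h' => absurd h h', fun _ => rfl⟩
  · rw [pos, eval_cond_of_ne_zero h]
    exact decides_of_pos rfl h

theorem decides_cond (ha : Decides (a.eval I s) P) (hb : P → Decides (b.eval I s) Q) :
    Decides ((cond a b (lit 1)).eval I s) (P → Q) := by
  by_cases hP : P
  · rw [eval_cond_of_ne_zero (ha.ne_zero_iff.2 hP)]
    exact (hb hP).congr (by simp [hP])
  · rw [eval_cond_of_eq_zero (ha.2 hP)]
    exact decides_of_pos rfl fun h => absurd h hP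

theorem decides_ex {x : ℕ} {R : ℕ → Prop}
    (h : ∀ i < b.eval I s, Decides (e.eval I (s.setReg x i)) (R i)) :
    Decides ((ex x b e).eval I s) (∃ i < b.eval I s, R i) := by
  refine decides_pos.congr ?_
  simp only [eval, ne_eq, sum_eq_zero_iff, mem_range]
  push Not
  exact exists_congr fun i => and_congr_right fun hi => (h i hi).ne_zero_iff

theorem decides_all {x : ℕ} {R : ℕ → Prop}
    (h : ∀ i < b.eval I s, Decides (e.eval I (s.setReg x i)) (R i)) :
    Decides ((all x b e).eval I s) (∀ i < b.eval I s, R i) := by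
  refine decides_not_eq_zero.congr ?_
  simp only [eval, sum_eq_zero_iff, mem_range]
  refine forall₂_congr fun i hi => ?_
  have := (decides_not (h i hi)).ne_zero_iff
  tauto

open scoped Classical in
theorem eval_sum_of_decides {x : ℕ} {R : ℕ → Prop}
    (h : ∀ i < b.eval I s, Decides (e.eval I (s.setReg x i)) (R i)) :
    (sum x b e).eval I s = #{i ∈ range (b.eval I s) | R i} := by
  rw [card_filter, eval]
  exact sum_congr rfl fun i hi => (h i (mem_range.1 hi)).eq_ite

end Expr

/-! ### Statements -/

/-- The number of registers and arrays that are not used as scratch space. -/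
abbrev userBound : ℕ := 32

/-- Assign the value of `e` to register `x`. -/
def assign (x : ℕ) (e : Expr) : Program := .seq (e.compile userBound) (.copy x userBound)

/-- Assign the value of `e` to the cell with index `a` of array `f`. -/
def storeAt (f : ℕ) (a e : Expr) : Program :=
  .seq (a.compile userBound) (.seq (e.compile (userBound + 1))
    (.store f userBound (userBound + 1)))

/-- Run `p` if `e` is nonzero, and `q` otherwise. -/
def branch (e : Expr) (p q : Program) : Program := .seq (e.compile userBound) (.ite userBound p q)

/-- Run `p` for all values of the register `x` smaller than `e`, with register `c` as counter. -/
def forLoop (x c : ℕ) (e : Expr) (p : Program) : Program :=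
  .seq (assign c e) (.seq (.const x 0) (.loop c (.seq p
    (.seq (assign x (.add (.var x) (.lit 1))) (assign c (.sub (.var c) (.lit 1)))))))

/-- The states `s` and `s'` agree below `userBound` except possibly on the registers in `l`. -/
def AgreeOff (l : List ℕ) (s s' : State) : Prop :=
  (∀ x < userBound, x ∉ l → s'.reg x = s.reg x) ∧ ∀ f < userBound, s'.arr f = s.arr f

namespace Runs

variable {n d : ℕ} {I : Instance n d} {s : State} {T M M' : ℕ} {Q : State → Prop}

theorem assign {x : ℕ} {e : Expr} (he : e.bound ≤ userBound) (hb : e.Bdd I M s)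
    (hQ : ∀ s', s'.reg x = e.eval I s → AgreeOff [x] s s' → Q s') :
    Runs I (assign x e) s (e.time M + 1) Q := by
  refine Runs.seq ((e.compile_spec he hb).mono le_rfl fun s₁ h₁ => Runs.copy (hQ _ ?_ ?_))
  · simp [h₁.1]
  · refine ⟨fun y hy hyx => ?_, fun f hf => h₁.2.2 f hf⟩
    have : y ≠ x := by simpa using hyx
    simp [this, h₁.2.1 y hy]

theorem storeAt {f : ℕ} {a e : Expr} (ha : a.bound ≤ userBound) (he : e.bound ≤ userBound)
    (hba : a.Bdd I M s) (hbe : e.Bdd I M' s)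
    (hQ : ∀ s', (∀ i, s'.arr f i = if i = a.eval I s then e.eval I s else s.arr f i) →
      (∀ x < userBound, s'.reg x = s.reg x) → (∀ g < userBound, g ≠ f → s'.arr g = s.arr g) →
      Q s') (hf : f < userBound) :
    Runs I (storeAt f a e) s (a.time M + (e.time M' + 1)) Q := by
  refine Runs.seq ((a.compile_spec ha hba).mono le_rfl fun s₁ h₁ => Runs.seq
    ((e.compile_spec (k := userBound + 1) (by omega) (hbe.congr he h₁.2.symm)).mono le_rfl
      fun s₂ h₂ => Runs.store (hQ _ ?_ ?_ ?_)))
  · intro i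
    have e1 : s₂.reg userBound = a.eval I s := by rw [h₂.2.1 _ (Nat.lt_succ_self _), h₁.1]
    have e2 : s₂.reg (userBound + 1) = e.eval I s := by rw [h₂.1, Expr.eval_congr he h₁.2]
    have e3 : s₂.arr f = s.arr f := by rw [h₂.2.2 _ (by omega), h₁.2.2 _ hf]
    rw [State.arr_setArr, if_pos rfl, Function.update_apply, e1, e2, e3]
  · intro x hx
    rw [State.reg_setArr, h₂.2.1 _ (by omega), h₁.2.1 _ hx]
  · intro g hg hgf
    rw [State.arr_setArr, if_neg hgf, h₂.2.2 _ (by omega), h₁.2.2 _ hg]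

theorem branch {e : Expr} {p q : Program} (he : e.bound ≤ userBound) (hb : e.Bdd I M s)
    (hp : ∀ s', e.eval I s ≠ 0 → AgreeOff [] s s' → Runs I p s' T Q)
    (hq : ∀ s', e.eval I s = 0 → AgreeOff [] s s' → Runs I q s' T Q) :
    Runs I (branch e p q) s (e.time M + (T + 1)) Q := by
  refine Runs.seq ((e.compile_spec he hb).mono le_rfl fun s₁ h₁ => Runs.ite (fun h => ?_)
    (fun h => ?_))
  · exact hp s₁ (h₁.1 ▸ h) ⟨fun y hy _ => h₁.2.1 y hy, fun f hf => h₁.2.2 f hf⟩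
  · exact hq s₁ (h₁.1 ▸ h) ⟨fun y hy _ => h₁.2.1 y hy, fun f hf => h₁.2.2 f hf⟩

/-- The invariant must ignore `x` and `c`, which the loop itself updates. Each update costs four
steps and the loop test one, hence the summand `9`. -/
theorem forLoop {x c b : ℕ} {e : Expr} {p : Program} (Inv : ℕ → State → Prop) (hxc : x ≠ c)
    (hx : x < userBound) (hc : c < userBound)
    (he : e.bound ≤ userBound) (hb : e.Bdd I M s) (heb : e.eval I s = b)
    (hInv : ∀ i s s', AgreeOff [x, c] s s' → Inv i s → Inv i s') (h₀ : Inv 0 s)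
    (step : ∀ i s, i < b → Inv i s → s.reg x = i → s.reg c = b - i →
      Runs I p s T fun s' => s'.reg x = i ∧ s'.reg c = b - i ∧ Inv (i + 1) s')
    (hQ : ∀ s', Inv b s' → Q s') :
    Runs I (forLoop x c e p) s (e.time M + b * (T + 9) + 3) Q := by
  refine Runs.mono (T := (e.time M + 1) + (1 + (b * ((T + (4 + 4)) + 1) + 1)))
    (Runs.seq <| Runs.assign he hb fun s₁ h₁ h₂ => Runs.seq <| Runs.const <|
      Runs.loop (fun i s' => s'.reg x = i ∧ s'.reg c = b - i ∧ Inv i s') (fun i s' h => h.2.1)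
        (fun i s' hi h => ?_) ⟨?_, ?_, ?_⟩ fun s' h => hQ s' h.2.2) ?_ fun _ h => h
  · refine Runs.seq <| (step i s' hi h.2.2 h.1 h.2.1).mono le_rfl fun s₃ h₃ => ?_
    refine Runs.seq <| (Runs.assign (M := 0) (by simp [Expr.bound]; omega)
      (by simp [Expr.Bdd]) fun s₄ h₄ h₄' => ?_).mono
      (by simp [Expr.time, Expr.cst, Expr.depth]) fun _ h => h
    refine (Runs.assign (M := 0) (by simp [Expr.bound]; omega)
      (by simp [Expr.Bdd]) fun s₅ h₅ h₅' => ?_).mono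
      (by simp [Expr.time, Expr.cst, Expr.depth]) fun _ h => h
    refine ⟨?_, ?_, hInv _ s₃ _ ⟨fun y hy hyl => ?_, fun f hf => ?_⟩ h₃.2.2⟩
    · rw [h₅'.1 x hx (by simpa using hxc), h₄]
      simp [Expr.eval, h₃.1]
    · rw [h₅]
      simp only [Expr.eval]
      rw [h₄'.1 c hc (by simpa using hxc.symm), h₃.2.1]
      omega
    · simp only [List.mem_cons, List.not_mem_nil, or_false, not_or] at hyl
      rw [h₅'.1 y hy (by simpa using hyl.2), h₄'.1 y hy (by simpa using hyl.1)]
    · rw [h₅'.2 f hf, h₄'.2 f hf]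
  · simp
  · simp [hxc.symm, h₁, heb]
  · refine hInv _ s _ ⟨fun y hy hyl => ?_, fun f hf => h₂.2 f hf⟩ h₀
    simp only [List.mem_cons, List.not_mem_nil, or_false, not_or] at hyl
    rw [State.reg_setReg, if_neg hyl.1]
    exact h₂.1 y hy (by simpa using hyl.2)
  · have : T + (4 + 4) + 1 = T + 9 := by ring
    rw [this]
    omega

end Runs

end MDSR

namespace MDSR

open Finset

/-! ### The window test

The registers `0`, ..., `6` hold `n`, `d`, the parameter, the threshold, the width, the window
length and the number of codes; `7` and `8` hold the current window and its code. The array `1` holds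
the padded linear extension, the array `2` the digits of the codes, the array `3` the table of the
dynamic program. -/

namespace Expr

/-- The digit with index `v` of the code in register `k`. -/
def digE (k : ℕ) (v : Expr) : Expr := load 2 (add (mul (var k) (var 5)) v)

/-- Whether register `v` belongs to the set with code in register `11`. -/
def memE (v : ℕ) : Expr :=
  and (le (var 4) (var v)) (and (lt (var v) (add (var 4) (var 4)))
    (and (lt (add (var 7) (var v)) (add (var 4) (var 0))) (pos (digE 11 (var v)))))

/-- Whether register `v` belongs to the group of register `12`. -/
def clsE (v : ℕ) : Expr :=
  and (le (var 4) (add (var 7) (var v))) (and (lt (add (var 7) (var v)) (add (var 4) (var 0)))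
    (eq (add (var v) (digE 8 (var v))) (add (var 12) (digE 8 (var 12)))))

/-- Restrict a property to indices different from register `12`. -/
def neE (E : ℕ → Expr) (v : ℕ) : Expr := and (E v) (not (eq (var v) (var 12)))

/-- The entry with index in register `15` of the list of agents in the window with property `E`. -/
def listE (E : ℕ → Expr) : Expr :=
  sum 13 (var 5) (cond (and (E 13) (eq (sum 14 (var 13) (E 14)) (var 15)))
    (load 1 (add (var 7) (var 13))) (lit 0))

/-- Whether the agent with index in register `12` wants to deviate. -/
def wantsE : Expr :=
  cond (eq (sum 13 (var 5) (clsE 13)) (var 1))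
    (pref (load 1 (add (var 7) (var 12))) 15 (listE (neE memE)) (listE (neE clsE))) (lit 1)

/-- Whether the set with code in register `11` blocks. -/
def blocksE : Expr :=
  and (eq (sum 13 (var 5) (memE 13)) (var 1)) (all 12 (var 5) (cond (memE 12) wantsE (lit 1)))

/-- Whether the window in register `8` is a shift of the window in register `16`. -/
def shiftE : Expr :=
  all 13 (sub (var 5) (lit 1)) (eq (digE 16 (add (var 13) (lit 1))) (digE 8 (var 13)))

/-- Whether the window in register `8` extends a window found earlier. -/
def prevE : Expr :=
  cond (var 7) (ex 16 (var 6)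
    (and (load 3 (add (mul (sub (var 7) (lit 1)) (var 6)) (var 16))) shiftE)) (lit 1)

/-- The table entry for the window in register `7` and the code in register `8`. -/
def stepE : Expr := and prevE (not (ex 11 (var 6) blocksE))

theorem eval_add {n d : ℕ} {I : Instance n d} {s : State} (a b : Expr) :
    (add a b).eval I s = a.eval I s + b.eval I s := rfl

end Expr

variable {n d : ℕ}

/-- The size parameters of the dynamic program are in memory. -/
structure WidthCtx (I : Instance n d) (s : State) : Prop where
  reg_n : s.reg 0 = n
  reg_d : s.reg 1 = d
  reg_B : s.reg 4 = I.width
  reg_W : s.reg 5 = 3 * I.width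
  reg_N : s.reg 6 = I.width ^ (3 * I.width)

/-- The size parameters and the digits of all codes are in memory. -/
structure DPCtx (I : Instance n d) (s : State) : Prop extends WidthCtx I s where
  arr_dig : ∀ k < I.width ^ (3 * I.width), ∀ v < 3 * I.width,
    s.arr 2 (k * (3 * I.width) + v) = dig I.width k v

theorem WidthCtx.congr {I : Instance n d} {s s' : State} (h : WidthCtx I s)
    (hs : ∀ y < 7, s'.reg y = s.reg y) : WidthCtx I s' :=
  ⟨(hs 0 (by omega)).trans h.reg_n, (hs 1 (by omega)).trans h.reg_d,
    (hs 4 (by omega)).trans h.reg_B, (hs 5 (by omega)).trans h.reg_W,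
    (hs 6 (by omega)).trans h.reg_N⟩

namespace DPCtx

variable {I : Instance n d} {s : State}

theorem setReg (h : DPCtx I s) (x v : ℕ) (hx : 7 ≤ x) : DPCtx I (s.setReg x v) :=
  ⟨h.toWidthCtx.congr fun y hy => by rw [State.reg_setReg, if_neg (by omega)], h.arr_dig⟩

open MDSR.Expr

theorem eval_digE (h : DPCtx I s) {k : ℕ} {v : Expr} (hk : s.reg k < I.width ^ (3 * I.width))
    (hv : v.eval I s < 3 * I.width) : (digE k v).eval I s = dig I.width (s.reg k) (v.eval I s) := by
  simp only [digE, eval, h.reg_W]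
  exact h.arr_dig _ hk _ hv

theorem decides_memE (h : DPCtx I s) {v : ℕ} (hm : s.reg 11 < I.width ^ (3 * I.width))
    (hv : s.reg v < 3 * I.width) :
    Decides ((memE v).eval I s) (I.WinMem (s.reg 7) (dig I.width (s.reg 11)) (s.reg v)) := by
  have hd := h.eval_digE (k := 11) (v := var v) hm hv
  refine (decides_and decides_le fun _ => decides_and decides_lt fun _ => decides_and decides_lt
    fun _ => decides_pos).congr ?_
  rw [hd]
  simp only [eval, h.reg_B, h.reg_n, Instance.WinMem]

theorem decides_clsE (h : DPCtx I s) {v : ℕ} (hk : s.reg 8 < I.width ^ (3 * I.width))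
    (hu : s.reg 12 < 3 * I.width) (hv : s.reg v < 3 * I.width) :
    Decides ((clsE v).eval I s)
      (I.WinCls (s.reg 7) (dig I.width (s.reg 8)) (s.reg 12) (s.reg v)) := by
  have hd := h.eval_digE (k := 8) (v := var v) hk hv
  have hd' := h.eval_digE (k := 8) (v := var 12) hk hu
  refine (decides_and decides_le fun _ => decides_and decides_lt fun _ => decides_eq).congr ?_
  simp only [eval_add, hd, hd']
  simp only [eval, h.reg_B, h.reg_n, Instance.WinCls]

/-- The inner sum over register `14` counts the preceding elements while register `13` is fixed;
hence the hypothesis on nested assignments. -/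
theorem eval_listE (h : DPCtx I s) {E : ℕ → Expr} {P : ℕ → Prop}
    (h₁ : ∀ v < 3 * I.width, Decides ((E 13).eval I (s.setReg 13 v)) (P v))
    (h₂ : ∀ v < 3 * I.width, ∀ v' < v,
      Decides ((E 14).eval I ((s.setReg 13 v).setReg 14 v')) (P v')) :
    (listE E).eval I s
      = listFn (3 * I.width) P (fun v => s.arr 1 (s.reg 7 + v)) (s.reg 15) := by
  classical
  have e1 : (listE E).eval I s = ∑ v ∈ range (3 * I.width),
      (cond (and (E 13) (eq (sum 14 (var 13) (E 14)) (var 15)))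
        (load 1 (add (var 7) (var 13))) (lit 0)).eval I (s.setReg 13 v) := by
    simp only [listE, eval, h.reg_W]
  rw [e1]
  refine sum_congr rfl fun v hv => ?_
  rw [mem_range] at hv
  have hsum : (sum 14 (var 13) (E 14)).eval I (s.setReg 13 v) = #{v' ∈ range v | P v'} := by
    rw [eval_sum_of_decides (R := P) (fun v' hv' => h₂ v hv v' (by simpa [eval] using hv'))]
    congr 1
  have hdec : Decides ((and (E 13) (eq (sum 14 (var 13) (E 14)) (var 15))).eval I (s.setReg 13 v))
      (P v ∧ #{v' ∈ range v | P v'} = s.reg 15) :=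
    decides_and (h₁ v hv) fun _ => decides_eq.congr (by rw [hsum]; simp [eval])
  split_ifs with hc
  · rw [eval_cond_of_ne_zero (hdec.ne_zero_iff.2 hc)]
    simp [eval]
  · rw [eval_cond_of_eq_zero (hdec.2 hc)]
    rfl

theorem decides_neE {E : ℕ → Expr} {v : ℕ} {P : Prop} (h : Decides ((E v).eval I s) P) :
    Decides ((neE E v).eval I s) (P ∧ s.reg v ≠ s.reg 12) :=
  decides_and h fun _ => decides_not decides_eq

theorem decides_wantsE (h : DPCtx I s) (hm : s.reg 11 < I.width ^ (3 * I.width))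
    (hk : s.reg 8 < I.width ^ (3 * I.width)) (hu : s.reg 12 < 3 * I.width) :
    open scoped Classical in
    Decides (wantsE.eval I s)
      (#{v ∈ range (3 * I.width) | I.WinCls (s.reg 7) (dig I.width (s.reg 8)) (s.reg 12) v} = d →
        I.prefAnswer (s.arr 1 (s.reg 7 + s.reg 12))
          (listFn (3 * I.width) (fun v => I.WinMem (s.reg 7) (dig I.width (s.reg 11)) v ∧
            v ≠ s.reg 12) fun v => s.arr 1 (s.reg 7 + v))
          (listFn (3 * I.width) (fun v => I.WinCls (s.reg 7) (dig I.width (s.reg 8)) (s.reg 12) v ∧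
            v ≠ s.reg 12) fun v => s.arr 1 (s.reg 7 + v)) ≠ 0) := by
  classical
  refine decides_cond (decides_eq.congr ?_) fun _ => ?_
  · rw [eval_sum_of_decides
      (R := fun v => I.WinCls (s.reg 7) (dig I.width (s.reg 8)) (s.reg 12) v) fun v hv => ?_]
    · simp only [eval, h.reg_W, h.reg_d]
    · have hv' : v < 3 * I.width := by simpa [eval, h.reg_W] using hv
      simpa using (h.setReg 13 v (by omega)).decides_clsE (v := 13) (by simpa using hk)
        (by simpa using hu) (by simpa using hv')
  · have e1 : ∀ x, (listE (neE memE)).eval I (s.setReg 15 x) = listFn (3 * I.width)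
        (fun v => I.WinMem (s.reg 7) (dig I.width (s.reg 11)) v ∧ v ≠ s.reg 12)
        (fun v => s.arr 1 (s.reg 7 + v)) x := fun x => by
      have h' := h.setReg 15 x (by omega)
      rw [h'.eval_listE (P := fun v => I.WinMem (s.reg 7) (dig I.width (s.reg 11)) v ∧
        v ≠ s.reg 12)]
      · simp
      · intro v hv
        simpa using decides_neE ((h'.setReg 13 v (by omega)).decides_memE (v := 13)
          (by simpa using hm) (by simpa using hv))
      · intro v hv v' hv'
        simpa using decides_neE (((h'.setReg 13 v (by omega)).setReg 14 v' (by omega)).decides_memE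
          (v := 14) (by simpa using hm) (by simpa using hv'.trans hv))
    have e2 : ∀ x, (listE (neE clsE)).eval I (s.setReg 15 x) = listFn (3 * I.width)
        (fun v => I.WinCls (s.reg 7) (dig I.width (s.reg 8)) (s.reg 12) v ∧ v ≠ s.reg 12)
        (fun v => s.arr 1 (s.reg 7 + v)) x := fun x => by
      have h' := h.setReg 15 x (by omega)
      rw [h'.eval_listE (P := fun v => I.WinCls (s.reg 7) (dig I.width (s.reg 8)) (s.reg 12) v ∧
        v ≠ s.reg 12)]
      · simp
      · intro v hv
        simpa using decides_neE ((h'.setReg 13 v (by omega)).decides_clsE (v := 13)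
          (by simpa using hk) (by simpa using hu) (by simpa using hv))
      · intro v hv v' hv'
        simpa using decides_neE (((h'.setReg 13 v (by omega)).setReg 14 v' (by omega)).decides_clsE
          (v := 14) (by simpa using hk) (by simpa using hu) (by simpa using hv'.trans hv))
    simp only [eval, e1, e2, Instance.prefAnswer]
    split_ifs with hc
    · exact decides_of_pos rfl one_ne_zero
    · exact ⟨fun h => absurd rfl h, fun _ => rfl⟩

theorem decides_blocksE (h : DPCtx I s) (hm : s.reg 11 < I.width ^ (3 * I.width))
    (hk : s.reg 8 < I.width ^ (3 * I.width)) :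
    Decides (blocksE.eval I s)
      (I.WinBlocks (s.arr 1) (s.reg 7) (dig I.width (s.reg 8)) (dig I.width (s.reg 11))) := by
  classical
  refine decides_and (decides_eq.congr ?_) fun _ => (decides_all (R := fun u =>
    I.WinMem (s.reg 7) (dig I.width (s.reg 11)) u →
      #{v ∈ range (3 * I.width) | I.WinCls (s.reg 7) (dig I.width (s.reg 8)) u v} = d →
        I.prefAnswer (s.arr 1 (s.reg 7 + u))
          (listFn (3 * I.width) (fun v => I.WinMem (s.reg 7) (dig I.width (s.reg 11)) v ∧
            v ≠ u) fun v => s.arr 1 (s.reg 7 + v))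
          (listFn (3 * I.width) (fun v => I.WinCls (s.reg 7) (dig I.width (s.reg 8)) u v ∧
            v ≠ u) fun v => s.arr 1 (s.reg 7 + v)) ≠ 0) fun u hu => ?_).congr ?_
  · rw [eval_sum_of_decides
      (R := fun v => I.WinMem (s.reg 7) (dig I.width (s.reg 11)) v) fun v hv => ?_]
    · simp only [eval, h.reg_W, h.reg_d]
    · have hv' : v < 3 * I.width := by simpa [eval, h.reg_W] using hv
      simpa using (h.setReg 13 v (by omega)).decides_memE (v := 13) (by simpa using hm)
        (by simpa using hv')
  · have hu' : u < 3 * I.width := by simpa [eval, h.reg_W] using hu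
    have h' := h.setReg 12 u (by omega)
    refine decides_cond ?_ fun _ => ?_
    · simpa using h'.decides_memE (v := 12) (by simpa using hm) (by simpa using hu')
    · simpa using h'.decides_wantsE (by simpa using hm) (by simpa using hk) (by simpa using hu')
  · simp only [eval, h.reg_W]

theorem decides_shiftE (h : DPCtx I s) (hk : s.reg 8 < I.width ^ (3 * I.width))
    (hk₀ : s.reg 16 < I.width ^ (3 * I.width)) :
    Decides (shiftE.eval I s)
      (∀ v < 3 * I.width - 1, dig I.width (s.reg 16) (v + 1) = dig I.width (s.reg 8) v) := by
  refine (decides_all (R := fun v => dig I.width (s.reg 16) (v + 1) = dig I.width (s.reg 8) v)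
    fun v hv => ?_).congr (by simp only [eval, h.reg_W])
  have hv' : v < 3 * I.width - 1 := by simpa [eval, h.reg_W] using hv
  have h' := h.setReg 13 v (by omega)
  refine decides_eq.congr ?_
  rw [h'.eval_digE (by simpa using hk₀) (by simp [eval]; omega),
    h'.eval_digE (by simpa using hk) (by simp [eval]; omega)]
  simp [eval]

/-- This is the recursion of `Reach`: row `0` has no predecessor and `prevE` defaults to true, while
later rows consult the preceding row of the table. -/
theorem decides_stepE (h : DPCtx I s) (hk : s.reg 8 < I.width ^ (3 * I.width))
    (hprev : ∀ i, s.reg 7 = i + 1 → ∀ k < I.width ^ (3 * I.width),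
      Decides (s.arr 3 (i * I.width ^ (3 * I.width) + k))
        (Reach I.width (3 * I.width) (I.WinGood (s.arr 1)) i k)) :
    Decides (stepE.eval I s)
      (Reach I.width (3 * I.width) (I.WinGood (s.arr 1)) (s.reg 7) (s.reg 8)) := by
  have hgood : Decides ((not (ex 11 (var 6) blocksE)).eval I s)
      (I.WinGood (s.arr 1) (s.reg 7) (s.reg 8)) := by
    refine decides_not ((decides_ex (R := fun m => I.WinBlocks (s.arr 1) (s.reg 7)
      (dig I.width (s.reg 8)) (dig I.width m)) fun m hm => ?_).congr (by
        simp only [eval, h.reg_N]))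
    have hm' : m < I.width ^ (3 * I.width) := by simpa [eval, h.reg_N] using hm
    simpa using (h.setReg 11 m (by omega)).decides_blocksE (by simpa using hm')
      (by simpa using hk)
  rcases Nat.eq_zero_or_eq_succ_pred (s.reg 7) with h0 | h1
  · have hp : Decides (prevE.eval I s) True := by
      rw [prevE, eval_cond_of_eq_zero (by simpa [eval] using h0)]
      exact decides_of_pos rfl trivial
    refine (decides_and hp fun _ => hgood).congr ?_
    rw [h0, true_and]
    rfl
  · set i := (s.reg 7).pred with hi
    have hp : Decides (prevE.eval I s) (∃ k₀ < I.width ^ (3 * I.width),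
        Reach I.width (3 * I.width) (I.WinGood (s.arr 1)) i k₀ ∧
        ∀ v < 3 * I.width - 1, dig I.width k₀ (v + 1) = dig I.width (s.reg 8) v) := by
      rw [prevE, eval_cond_of_ne_zero (by simp only [eval]; omega)]
      refine (decides_ex (R := fun k₀ =>
        Reach I.width (3 * I.width) (I.WinGood (s.arr 1)) i k₀ ∧
        ∀ v < 3 * I.width - 1, dig I.width k₀ (v + 1) = dig I.width (s.reg 8) v)
        fun k₀ hk₀ => ?_).congr (by simp only [eval, h.reg_N])
      have hk₀' : k₀ < I.width ^ (3 * I.width) := by simpa [eval, h.reg_N] using hk₀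
      refine decides_and ?_ fun _ => ?_
      · have := hprev i h1 k₀ hk₀'
        simpa [eval, h1, h.reg_N] using this
      · simpa using (h.setReg 16 k₀ (by omega)).decides_shiftE (by simpa using hk)
          (by simpa using hk₀')
    refine (decides_and hp fun _ => hgood).congr ?_
    rw [h1]
    rfl

/-- The loops run over codes, over window indices, over indices below a given one, or over the `d`
cells of a query; the factors in multiplications are `3 * width` and the number of codes. -/
theorem bdd_stepE (h : DPCtx I s) {M : ℕ} (hd : d ≤ M) (hW : 3 * I.width ≤ M)
    (hN : I.width ^ (3 * I.width) ≤ M) : stepE.Bdd I M s := by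
  have hle : ∀ v < 3 * I.width, v ≤ M := fun v hv => hv.le.trans hW
  simp +contextual [stepE, prevE, shiftE, blocksE, wantsE, listE, neE, clsE, memE, digE, Expr.le, Expr.lt,
    Expr.and, Expr.not, Expr.eq, Expr.pos, ex, all, Bdd, eval, h.reg_W, h.reg_N, h.reg_d, hd, hW, hN, hle]
  omega

end DPCtx

end MDSR

namespace MDSR

open Finset

variable {n d : ℕ}

/-! ### Sorting the agents and computing the parameter -/

theorem Instance.decides_posetAnswer (I : Instance n d) (a b : Fin n) :
    Decides (I.posetAnswer a b) (I.geq a b) := by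
  classical
  have : (∃ a' b' : Fin n, a'.val = a.val ∧ b'.val = b.val ∧ I.geq a' b') ↔ I.geq a b := by
    constructor
    · rintro ⟨a', b', ha, hb, h⟩
      rwa [Fin.ext ha, Fin.ext hb] at h
    · exact fun h => ⟨a, b, rfl, rfl, h⟩
  unfold Instance.posetAnswer
  by_cases h : I.geq a b
  · exact decides_of_pos (if_pos (this.2 h)) h
  · exact ⟨fun h' => absurd h' h, fun _ => if_neg fun h' => h (this.1 h')⟩

open scoped Classical in
/-- A bounded sum over all agents counts agents. -/
theorem Expr.eval_sum_agents {I : Instance n d} {s : State} {x : ℕ} {b e : Expr}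
    {R : Fin n → Prop} (hb : b.eval I s = n)
    (h : ∀ a : Fin n, Decides (e.eval I (s.setReg x a)) (R a)) :
    (Expr.sum x b e).eval I s = #{a | R a} := by
  rw [card_filter, Expr.eval, hb, Finset.sum_range]
  exact sum_congr rfl fun a _ => (h a).eq_ite

namespace Expr

/-- The key of the agent in register `7`. -/
def keyE : Expr := add (mul (sum 13 (var 0) (geq (var 13) (var 7))) (var 0)) (var 7)

/-- The number of agents incomparable to the one in register `7`. -/
def incE : Expr :=
  sum 13 (var 0) (and (not (geq (var 7) (var 13))) (not (geq (var 13) (var 7))))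

/-- Four times the parameter. -/
def fourE : Expr := add (add (var 2) (var 2)) (add (var 2) (var 2))

/-- The index in the padded linear extension of the agent in register `7`. -/
def idxE : Expr := add (var 4) (sum 13 (var 0) (lt (load 0 (var 13)) (load 0 (var 7))))

end Expr

open MDSR.Expr

/-- Compute the keys of all agents. -/
def keyProg : Program := forLoop 7 9 (.var 0) (storeAt 0 (.var 7) keyE)

/-- Compute the parameter. -/
def kappaProg : Program :=
  .seq (assign 2 (.lit 0))
    (forLoop 7 9 (.var 0) (assign 2 (.add (.var 2) (.sub incE (.var 2)))))

/-- Compute the threshold for the group size. -/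
def thresholdProg : Program :=
  .seq (assign 3 fourE) (forLoop 7 9 fourE (assign 3 (.add (.var 3) (.var 3))))

/-- Compute the keys, the parameter and the threshold. -/
def setupProg : Program := .seq keyProg (.seq kappaProg thresholdProg)

/-- The keys are in memory. -/
structure KeyCtx (I : Instance n d) (s : State) : Prop where
  reg_n : s.reg 0 = n
  reg_d : s.reg 1 = d
  arr_key : ∀ a : Fin n, s.arr 0 a = I.key a

/-- The keys and the parameter are in memory. -/
structure PreCtx (I : Instance n d) (s : State) : Prop extends KeyCtx I s where
  reg_kappa : s.reg 2 = I.kappa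

theorem KeyCtx.congr {I : Instance n d} {s s' : State} (h : KeyCtx I s)
    (h₀ : s'.reg 0 = s.reg 0) (h₁ : s'.reg 1 = s.reg 1) (ha : s'.arr 0 = s.arr 0) :
    KeyCtx I s' :=
  ⟨h₀.trans h.reg_n, h₁.trans h.reg_d, fun a => ha ▸ h.arr_key a⟩

theorem PreCtx.congr {I : Instance n d} {s s' : State} (h : PreCtx I s)
    (h₀ : s'.reg 0 = s.reg 0) (h₁ : s'.reg 1 = s.reg 1) (h₂ : s'.reg 2 = s.reg 2)
    (ha : s'.arr 0 = s.arr 0) : PreCtx I s' :=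
  ⟨h.toKeyCtx.congr h₀ h₁ ha, h₂.trans h.reg_kappa⟩

theorem Instance.kappa_le (I : Instance n d) : I.kappa ≤ n :=
  Finset.sup_le fun a _ => by
    simpa using Set.ncard_le_card {b : Fin n | I.Incomparable a b}

/-- A rank costs `n` poset queries and the product with `n` costs `n` additions, so each key takes
linear time. -/
theorem exists_run_keyProg : ∃ C, ∀ {n d : ℕ} (I : Instance n d) (s : State), 0 < n →
    s.reg 0 = n → s.reg 1 = d → Runs I keyProg s (C * n ^ 2) (KeyCtx I) := by
  refine ⟨2 * keyE.cst + 15, fun {n d} I s hn h0 h1 => ?_⟩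
  have ht : keyE.time n ≤ keyE.cst * (n + 1) ^ 1 := time_le (by decide)
  refine Runs.mono (Runs.forLoop (M := 0) (b := n) (T := 1 + (keyE.time n + 1))
    (fun i s => s.reg 0 = n ∧ s.reg 1 = d ∧ ∀ a : Fin n, a < i → s.arr 0 a = I.key a)
    (by decide) (by decide) (by decide) (by decide) trivial h0 ?_ ⟨h0, h1, by simp⟩ ?_
    (fun s' h => ⟨h.1, h.2.1, fun a => h.2.2 a a.2⟩)) ?_ fun _ h => h
  · rintro i s s' hs ⟨h0, h1, h2⟩
    exact ⟨(hs.1 0 (by decide) (by decide)).trans h0, (hs.1 1 (by decide) (by decide)).trans h1,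
      fun a ha => hs.2 0 (by decide) ▸ h2 a ha⟩
  · rintro i s hi ⟨h0, h1, h2⟩ hx hc
    have hev : keyE.eval I s = I.key ⟨i, hi⟩ := by
      have : (Expr.sum 13 (var 0) (geq (var 13) (var 7))).eval I s = I.rank ⟨i, hi⟩ :=
        eval_sum_agents h0 fun a => by
          simpa [eval, hx] using I.decides_posetAnswer a ⟨i, hi⟩
      simp only [keyE, eval_add]
      rw [show ∀ a b : Expr, (mul a b).eval I s = a.eval I s * b.eval I s from fun _ _ => rfl, this]
      simp [eval, h0, hx, Instance.key]
    refine Runs.storeAt (M := 0) (M' := n) (by decide) (by decide) trivial ?_ ?_ (by decide)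
    · simp [keyE, Bdd, eval, h0]
    · intro s' ha hr hr'
      refine ⟨(hr 7 (by decide)).trans hx, (hr 9 (by decide)).trans hc,
        (hr 0 (by decide)).trans h0, (hr 1 (by decide)).trans h1, fun a hai => ?_⟩
      rw [ha, hev]
      simp only [eval, hx]
      split_ifs with hai'
      · congr 1
        exact Fin.ext hai'.symm
      · exact h2 a (by omega)
  · have h5 : n * (1 + (keyE.time n + 1) + 9) ≤ n * ((2 * keyE.cst + 11) * n) := by
      refine Nat.mul_le_mul_left _ ?_
      nlinarith
    have h6 : (var 0).time 0 = 1 := rfl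
    rw [h6]
    nlinarith

theorem exists_run_kappaProg : ∃ C, ∀ {n d : ℕ} (I : Instance n d) (s : State), 0 < n →
    KeyCtx I s → Runs I kappaProg s (C * n ^ 2) (PreCtx I) := by
  classical
  let e : Expr := .add (.var 2) (.sub incE (.var 2))
  refine ⟨2 * e.cst + 16, fun {n d} I s hn hs => ?_⟩
  have ht : e.time n ≤ e.cst * (n + 1) ^ 1 := time_le (by decide)
  refine Runs.mono (Runs.seq <| Runs.assign (M := 0) (by decide) trivial fun s₁ h₁ h₁' =>
    Runs.forLoop (M := 0) (b := n) (T := e.time n + 1)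
    (fun i s => KeyCtx I s ∧ s.reg 2 = ({a : Fin n | a.val < i} : Finset (Fin n)).sup
      fun a => {b : Fin n | I.Incomparable a b}.ncard)
    (by decide) (by decide) (by decide) (by decide) trivial ?_ ?_ ⟨?_, ?_⟩ ?_ ?_) ?_ fun _ h => h
  · exact (h₁'.1 0 (by decide) (by decide)).trans hs.reg_n
  · rintro i s s' hs ⟨h1, h2⟩
    exact ⟨h1.congr (hs.1 0 (by decide) (by decide)) (hs.1 1 (by decide) (by decide))
      (hs.2 0 (by decide)), (hs.1 2 (by decide) (by decide)).trans h2⟩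
  · exact hs.congr (h₁'.1 0 (by decide) (by decide)) (h₁'.1 1 (by decide) (by decide))
      (h₁'.2 0 (by decide))
  · simp [h₁, eval]
  · rintro i s hi ⟨h1, h2⟩ hx hc
    have hinc : incE.eval I s = {b : Fin n | I.Incomparable ⟨i, hi⟩ b}.ncard := by
      have := eval_sum_agents (I := I) (s := s) (x := 13) (b := var 0)
        (e := and (not (geq (var 7) (var 13))) (not (geq (var 13) (var 7))))
        (R := fun b => I.Incomparable ⟨i, hi⟩ b) h1.reg_n fun a =>
          decides_and (decides_not (by
            simpa [eval, hx] using I.decides_posetAnswer ⟨i, hi⟩ a)) fun _ => decides_not (by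
            simpa [eval, hx] using I.decides_posetAnswer a ⟨i, hi⟩)
      rw [incE, this, Set.ncard_eq_toFinset_card']
      congr 1
      ext b
      simp
    refine Runs.assign (by decide) ?_ ?_
    · simp [incE, Expr.and, Expr.not, Bdd, eval, h1.reg_n]
    · intro s' hr hr'
      refine ⟨(hr'.1 7 (by decide) (by decide)).trans hx, (hr'.1 9 (by decide) (by decide)).trans hc,
        h1.congr (hr'.1 0 (by decide) (by decide)) (hr'.1 1 (by decide) (by decide))
          (hr'.2 0 (by decide)), ?_⟩
      have hset : ({a : Fin n | a.val < i + 1} : Finset (Fin n))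
          = insert ⟨i, hi⟩ ({a : Fin n | a.val < i} : Finset (Fin n)) := by
        ext a
        simp only [mem_filter, mem_univ, true_and, mem_insert, Fin.ext_iff]
        omega
      rw [hr, hset, sup_insert, ← hinc, ← h2]
      -- With truncated subtraction, `x + (y - x)` is the maximum of `x` and `y`.
      change s.reg 2 + (incE.eval I s - s.reg 2) = max (incE.eval I s) (s.reg 2)
      omega
  · rintro s' ⟨h1, h2⟩
    refine ⟨h1, h2.trans ?_⟩
    rw [Instance.kappa]
    congr 1
    ext a
    simp
  · have h5 : n * (e.time n + 1 + 9) ≤ n * ((2 * e.cst + 10) * n) := by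
      refine Nat.mul_le_mul_left _ ?_
      nlinarith
    have h6 : (var 0).time 0 = 1 := rfl
    have h7 : (lit 0).time 0 = 1 := rfl
    rw [h6, h7]
    nlinarith

/-- The value `4 * κ` is doubled `4 * κ` times at unit cost, and `κ ≤ n` keeps this linear in `n`.
-/
theorem exists_run_thresholdProg : ∃ C, ∀ {n d : ℕ} (I : Instance n d) (s : State), 0 < n →
    PreCtx I s → Runs I thresholdProg s (C * n ^ 2) fun s' =>
      PreCtx I s' ∧ s'.reg 3 = 4 * I.kappa * 2 ^ (4 * I.kappa) := by
  refine ⟨2 * fourE.cst + 4 * ((add (var 3) (var 3)).cst + 10) + 4, fun {n d} I s hn hs => ?_⟩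
  have hfour : ∀ s : State, s.reg 2 = I.kappa → fourE.eval I s = 4 * I.kappa := fun s h => by
    simp only [fourE, eval, h]
    omega
  refine Runs.mono (Runs.seq <| Runs.assign (M := 0) (by decide) (by simp [fourE, Bdd])
    fun s₁ h₁ h₁' => Runs.forLoop (M := 0) (b := 4 * I.kappa) (T := (add (var 3) (var 3)).time 0 + 1)
    (fun i s => PreCtx I s ∧ s.reg 3 = 4 * I.kappa * 2 ^ i)
    (by decide) (by decide) (by decide) (by decide) (by simp [fourE, Bdd]) ?_ ?_ ⟨?_, ?_⟩ ?_
    fun s' h => h) ?_ fun _ h => h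
  · exact hfour _ ((h₁'.1 2 (by decide) (by decide)).trans hs.reg_kappa)
  · rintro i s s' hs ⟨h1, h2⟩
    exact ⟨h1.congr (hs.1 0 (by decide) (by decide)) (hs.1 1 (by decide) (by decide))
      (hs.1 2 (by decide) (by decide)) (hs.2 0 (by decide)),
      (hs.1 3 (by decide) (by decide)).trans h2⟩
  · exact hs.congr (h₁'.1 0 (by decide) (by decide)) (h₁'.1 1 (by decide) (by decide))
      (h₁'.1 2 (by decide) (by decide)) (h₁'.2 0 (by decide))
  · rw [h₁, hfour _ hs.reg_kappa, pow_zero, mul_one]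
  · rintro i s hi ⟨h1, h2⟩ hx hc
    refine Runs.assign (by decide) (by simp [Bdd]) ?_
    intro s' hr hr'
    refine ⟨(hr'.1 7 (by decide) (by decide)).trans hx, (hr'.1 9 (by decide) (by decide)).trans hc,
      h1.congr (hr'.1 0 (by decide) (by decide)) (hr'.1 1 (by decide) (by decide))
        (hr'.1 2 (by decide) (by decide)) (hr'.2 0 (by decide)), ?_⟩
    rw [hr]
    simp only [eval, h2]
    ring
  · have hκ := I.kappa_le
    have e1 : ∀ e : Expr, e.time 0 = e.cst := fun e => by simp [time]
    rw [e1, e1]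
    have e2 : 4 * I.kappa * ((add (var 3) (var 3)).cst + 1 + 9)
        ≤ 4 * n * ((add (var 3) (var 3)).cst + 10) :=
      Nat.mul_le_mul (by omega) (by omega)
    generalize (add (var 3) (var 3)).cst = D at *
    generalize fourE.cst = F at *
    have e3 : n ≤ n ^ 2 := Nat.le_self_pow (by omega) n
    have e4 : 4 * n * (D + 10) ≤ 4 * (D + 10) * n ^ 2 := by
      rw [mul_right_comm]
      exact Nat.mul_le_mul_left _ e3
    have e5 : (2 * F + 4) * 1 ≤ (2 * F + 4) * n ^ 2 := Nat.mul_le_mul_left _ (by omega)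
    have e6 : (2 * F + 4 * (D + 10) + 4) * n ^ 2
      = (2 * F + 4) * n ^ 2 + 4 * (D + 10) * n ^ 2 := by ring
    omega

theorem exists_run_setupProg : ∃ C, ∀ {n d : ℕ} (I : Instance n d), 0 < n →
    Runs I setupProg (State.init n d) (C * n ^ 2) fun s' =>
      PreCtx I s' ∧ s'.reg 3 = 4 * I.kappa * 2 ^ (4 * I.kappa) := by
  obtain ⟨C₁, h₁⟩ := exists_run_keyProg
  obtain ⟨C₂, h₂⟩ := exists_run_kappaProg
  obtain ⟨C₃, h₃⟩ := exists_run_thresholdProg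
  refine ⟨C₁ + C₂ + C₃, fun {n d} I hn => ?_⟩
  refine Runs.mono (Runs.seq <| (h₁ I _ hn (by simp [State.init]) (by simp [State.init])).mono le_rfl
    fun s₁ hs₁ => Runs.seq <| (h₂ I s₁ hn hs₁).mono le_rfl fun s₂ hs₂ => h₃ I s₂ hn hs₂) ?_
    fun _ h => h
  exact le_of_eq (by ring)

end MDSR

namespace MDSR

open Finset MDSR.Expr

variable {n d : ℕ}

/-! ### Polynomial bounds -/

/-- The function `T` is bounded by a power, for arguments at least `2`. -/
def PolyBdd (T : ℕ → ℕ) : Prop := ∃ c, ∀ X, 2 ≤ X → T X ≤ X ^ c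

namespace PolyBdd

theorem const (k : ℕ) : PolyBdd fun _ => k :=
  ⟨k, fun _ hX => Nat.lt_two_pow_self.le.trans (Nat.pow_le_pow_left hX k)⟩

theorem pow (k : ℕ) : PolyBdd fun X => X ^ k := ⟨k, fun _ _ => le_rfl⟩

theorem id : PolyBdd fun X => X := ⟨1, fun X _ => (pow_one X).ge⟩

theorem mul {S T : ℕ → ℕ} (hS : PolyBdd S) (hT : PolyBdd T) : PolyBdd fun X => S X * T X := by
  obtain ⟨a, ha⟩ := hS
  obtain ⟨b, hb⟩ := hT
  exact ⟨a + b, fun X hX => pow_add X a b ▸ Nat.mul_le_mul (ha X hX) (hb X hX)⟩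

theorem add {S T : ℕ → ℕ} (hS : PolyBdd S) (hT : PolyBdd T) : PolyBdd fun X => S X + T X := by
  obtain ⟨a, ha⟩ := hS
  obtain ⟨b, hb⟩ := hT
  refine ⟨a + b + 1, fun X hX => ?_⟩
  have h1 : X ^ a ≤ X ^ (a + b) := Nat.pow_le_pow_right (by omega) (by omega)
  have h2 : X ^ b ≤ X ^ (a + b) := Nat.pow_le_pow_right (by omega) (by omega)
  calc S X + T X ≤ X ^ (a + b) * 2 := by
        have := ha X hX
        have := hb X hX
        omega
    _ ≤ X ^ (a + b) * X := Nat.mul_le_mul_left _ hX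
    _ = X ^ (a + b + 1) := (pow_succ X (a + b)).symm

theorem time (e : Expr) : PolyBdd fun X => e.cst * X ^ e.depth := (const e.cst).mul (pow e.depth)

end PolyBdd

namespace Instance

variable (I : Instance n d)

theorem le_width (hκ : 1 ≤ I.kappa) (hd : 0 < d) : 7 ≤ I.width ∧ d ≤ I.width := by
  have h1 : d ≤ d ^ 4 := Nat.le_self_pow (by omega) d
  have h2 : d ^ 4 ≤ I.kappa * d ^ 4 := Nat.le_mul_of_pos_left _ hκ
  unfold width
  omega

/-- Makes the number of codes a common bound for all loops except those over agents, so that running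
times are polynomial in it. -/
theorem le_codes (hκ : 1 ≤ I.kappa) (hd : 0 < d) : 3 * I.width ≤ I.width ^ (3 * I.width) := by
  have h := (I.le_width hκ hd).1
  exact Nat.lt_two_pow_self.le.trans (Nat.pow_le_pow_left (by omega) _)

end Instance

/-! ### The dynamic program -/

namespace Expr

/-- The width. -/
def widthE : Expr := mul (mul (mul (mul (mul (var 2) (var 1)) (var 1)) (var 1)) (var 1)) (lit 7)

/-- The quotient of register `17` by the width. -/
def quotE : Expr := sum 13 (var 17) (le (mul (add (var 13) (lit 1)) (var 4)) (var 17))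

/-- Whether some code is reachable in the last window. -/
def finalE : Expr :=
  ex 16 (var 6) (load 3 (add (mul (sub (var 0) (lit 1)) (var 6)) (var 16)))

end Expr

/-- Compute the size parameters. -/
def widthProg : Program :=
  .seq (assign 4 widthE) (.seq (assign 5 (.add (.var 4) (.add (.var 4) (.var 4))))
    (.seq (assign 6 (.lit 1)) (forLoop 7 9 (.var 5) (assign 6 (.mul (.var 6) (.var 4))))))

/-- Compute the padded linear extension. -/
def ordProg : Program := forLoop 7 9 (.var 0) (storeAt 1 idxE (.var 7))

/-- Compute the digits of the code in register `8`. -/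
def digitRow : Program :=
  .seq (assign 17 (.var 8)) (forLoop 7 9 (.var 5) (.seq (assign 18 quotE)
    (.seq (storeAt 2 (.add (.mul (.var 8) (.var 5)) (.var 7))
      (.sub (.var 17) (.mul (.var 18) (.var 4)))) (assign 17 (.var 18)))))

/-- Compute the digits of all codes. -/
def digitProg : Program := forLoop 8 10 (.var 6) digitRow

/-- Compute the row of the table for the window in register `7`. -/
def tableRow : Program :=
  forLoop 8 10 (.var 6) (storeAt 3 (.add (.mul (.var 7) (.var 6)) (.var 8)) stepE)

/-- Compute the whole table. -/
def tableProg : Program := forLoop 7 9 (.var 0) tableRow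

/-- The dynamic program. -/
def dpProg : Program :=
  .seq widthProg (.seq ordProg (.seq digitProg (.seq tableProg (assign 0 finalE))))

theorem AgreeOff.low {l : List ℕ} {s s' : State} (h : AgreeOff l s s') (hl : ∀ x ∈ l, 7 ≤ x) :
    ∀ y < 7, s'.reg y = s.reg y := fun y hy =>
  h.1 y (hy.trans (by decide)) fun hyl => absurd (hl y hyl) (by omega)

theorem exists_run_widthProg : ∃ T, PolyBdd T ∧ ∀ {n d : ℕ} (I : Instance n d) (s : State),
    1 ≤ I.kappa → 0 < d → PreCtx I s →
    Runs I widthProg s (T (I.width ^ (3 * I.width) + 1)) fun s' => KeyCtx I s' ∧ WidthCtx I s' := by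
  let e : Expr := .mul (.var 6) (.var 4)
  refine ⟨fun X => (widthE.cst * X ^ widthE.depth + 1) + ((5 + 1) + ((1 + 1) +
      (1 + X * ((e.cst * X ^ e.depth + 1) + 9) + 3))), ?_, fun {n d} I s hκ hd hs => ?_⟩
  · exact ((PolyBdd.time _).add (.const 1)).add ((PolyBdd.const _).add ((PolyBdd.const _).add
      (((PolyBdd.const 1).add (PolyBdd.id.mul (((PolyBdd.time e).add (.const 1)).add
        (.const 9)))).add (.const 3))))
  have hw := I.le_width hκ hd
  have hN := I.le_codes hκ hd
  set N := I.width ^ (3 * I.width) with hNdef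
  refine Runs.seq <| Runs.assign (M := N) (by decide) ?_ fun s₁ h₁ h₁' => ?_
  · have h1 := hs.reg_d
    simp only [widthE, Bdd, eval, true_and, h1]
    omega
  have hB : s₁.reg 4 = I.width := by
    rw [h₁]
    simp only [widthE, eval, hs.reg_kappa, hs.reg_d, Instance.width]
    ring
  have hk₁ : KeyCtx I s₁ := hs.toKeyCtx.congr (h₁'.1 0 (by decide) (by decide))
    (h₁'.1 1 (by decide) (by decide)) (h₁'.2 0 (by decide))
  refine Runs.seq <| Runs.assign (M := 0) (by decide) (by simp [Bdd]) fun s₂ h₂ h₂' => ?_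
  have hk₂ : KeyCtx I s₂ := hk₁.congr (h₂'.1 0 (by decide) (by decide))
    (h₂'.1 1 (by decide) (by decide)) (h₂'.2 0 (by decide))
  have hB₂ : s₂.reg 4 = I.width := (h₂'.1 4 (by decide) (by decide)).trans hB
  have hW₂ : s₂.reg 5 = 3 * I.width := by
    rw [h₂]
    simp only [eval, hB]
    ring
  refine Runs.seq <| Runs.assign (M := 0) (by decide) (by simp [Bdd]) fun s₃ h₃ h₃' => ?_
  refine (Runs.forLoop (I := I) (e := .var 5) (M := 0) (b := 3 * I.width) (T := e.time N + 1)
    (fun i s => KeyCtx I s ∧ s.reg 4 = I.width ∧ s.reg 5 = 3 * I.width ∧ s.reg 6 = I.width ^ i)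
    (by decide) (by decide) (by decide) (by decide) trivial
    ((h₃'.1 5 (by decide) (by decide)).trans hW₂) ?_ ⟨?_, ?_, ?_, ?_⟩ ?_ ?_).mono ?_ fun _ h => h
  · rintro i s s' hs ⟨h1, h2, h3, h4⟩
    exact ⟨h1.congr (hs.1 0 (by decide) (by decide)) (hs.1 1 (by decide) (by decide))
      (hs.2 0 (by decide)), (hs.1 4 (by decide) (by decide)).trans h2,
      (hs.1 5 (by decide) (by decide)).trans h3, (hs.1 6 (by decide) (by decide)).trans h4⟩
  · exact hk₂.congr (h₃'.1 0 (by decide) (by decide)) (h₃'.1 1 (by decide) (by decide))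
      (h₃'.2 0 (by decide))
  · exact (h₃'.1 4 (by decide) (by decide)).trans hB₂
  · exact (h₃'.1 5 (by decide) (by decide)).trans hW₂
  · rw [h₃, pow_zero]
    rfl
  · rintro i s hi ⟨h1, h2, h3, h4⟩ hx hc
    refine Runs.assign (M := N) (by decide) ?_ fun s' hr hr' => ?_
    · simp only [Bdd, eval, true_and, h2]
      omega
    · refine ⟨(hr'.1 7 (by decide) (by decide)).trans hx,
        (hr'.1 9 (by decide) (by decide)).trans hc,
        h1.congr (hr'.1 0 (by decide) (by decide)) (hr'.1 1 (by decide) (by decide))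
          (hr'.2 0 (by decide)), (hr'.1 4 (by decide) (by decide)).trans h2,
        (hr'.1 5 (by decide) (by decide)).trans h3, ?_⟩
      rw [hr, pow_succ]
      simp only [eval, h4, h2]
  · rintro s' ⟨h1, h2, h3, h4⟩
    exact ⟨h1, h1.reg_n, h1.reg_d, h2, h3, h4⟩
  · refine Nat.add_le_add_right (Nat.add_le_add le_rfl ?_) 3
    exact Nat.mul_le_mul_right _ (by omega)

/-- Positions are obtained by counting smaller keys, and the agent is stored at its padded index:
sorting in quadratic time without further queries. -/
theorem exists_run_ordProg : ∃ C, ∀ {n d : ℕ} (I : Instance n d) (s : State), 0 < n →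
    KeyCtx I s → WidthCtx I s →
    Runs I ordProg s (C * n ^ 2) fun s' => WidthCtx I s' ∧ ∀ a, s'.arr 1 (I.idx a) = a := by
  refine ⟨2 * idxE.cst + 15, fun {n d} I s hn hs hs' => ?_⟩
  have ht : idxE.time n ≤ idxE.cst * (n + 1) ^ 1 := time_le (by decide)
  refine Runs.mono (Runs.forLoop (M := 0) (b := n) (T := idxE.time n + (1 + 1))
    (fun i s => KeyCtx I s ∧ WidthCtx I s ∧ ∀ a : Fin n, a < i → s.arr 1 (I.idx a) = a)
    (by decide) (by decide) (by decide) (by decide) trivial hs.reg_n ?_ ⟨hs, hs', by simp⟩ ?_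
    (fun s' h => ⟨h.2.1, fun a => h.2.2 a a.2⟩)) ?_ fun _ h => h
  · rintro i s s' hs ⟨h0, h1, h2⟩
    exact ⟨h0.congr (hs.1 0 (by decide) (by decide)) (hs.1 1 (by decide) (by decide))
      (hs.2 0 (by decide)), h1.congr (hs.low (by decide)),
      fun a ha => hs.2 1 (by decide) ▸ h2 a ha⟩
  · rintro i s hi ⟨h0, h1, h2⟩ hx hc
    have hev : idxE.eval I s = I.idx ⟨i, hi⟩ := by
      classical
      have : (Expr.sum 13 (var 0) (lt (load 0 (var 13)) (load 0 (var 7)))).eval I s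
          = I.pos ⟨i, hi⟩ := by
        rw [eval_sum_agents (I := I) (s := s) (x := 13) (b := var 0)
          (e := lt (load 0 (var 13)) (load 0 (var 7)))
          (R := fun b => I.key b < I.key ⟨i, hi⟩) h0.reg_n fun a => decides_lt.congr ?_]
        · unfold Instance.pos
          congr!
        · have h3 := h0.arr_key a
          have h4 := h0.arr_key ⟨i, hi⟩
          simp only at h4
          simp [eval, hx, h3, h4]
      rw [idxE, eval_add, this]
      simp only [eval, h1.reg_B, Instance.idx]
    refine Runs.storeAt (M := n) (M' := 0) (by decide) (by decide) ?_ trivial ?_ (by decide)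
    · simp [idxE, Expr.lt, Expr.le, Bdd, eval, h0.reg_n]
    · intro s' ha hr hr'
      refine ⟨(hr 7 (by decide)).trans hx, (hr 9 (by decide)).trans hc,
        h0.congr (hr 0 (by decide)) (hr 1 (by decide)) (hr' 0 (by decide) (by decide)),
        h1.congr fun y hy => hr y (hy.trans (by decide)), fun a hai => ?_⟩
      rw [ha, hev]
      split_ifs with hai'
      · rw [I.idx_injective hai']
        simpa [eval] using hx
      · refine h2 a (lt_of_le_of_ne (by omega) fun h => hai' ?_)
        congr 1
        exact Fin.ext h
  · have h5 : n * (idxE.time n + (1 + 1) + 9) ≤ n * ((2 * idxE.cst + 11) * n) := by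
      refine Nat.mul_le_mul_left _ ?_
      nlinarith
    have h6 : (var 0).time 0 = 1 := rfl
    rw [h6]
    nlinarith

/-- Division is replaced by counting the multiples of `B` up to `x`. -/
theorem card_filter_mul_le {B : ℕ} (hB : 0 < B) (x : ℕ) :
    #{z ∈ range x | (z + 1) * B ≤ x} = x / B := by
  have : {z ∈ range x | (z + 1) * B ≤ x} = range (x / B) := by
    ext z
    rw [mem_filter, mem_range, mem_range, ← Nat.le_div_iff_mul_le hB]
    have := Nat.div_le_self x B
    omega
  rw [this, card_range]

theorem eval_quotE {I : Instance n d} {s : State} (hB : 0 < s.reg 4) :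
    quotE.eval I s = s.reg 17 / s.reg 4 := by
  rw [← card_filter_mul_le hB, quotE, card_filter, eval]
  refine sum_congr rfl fun z _ => Decides.eq_ite ?_
  exact decides_le.congr (by simp [eval])

/-- Distinct pairs have distinct cells in a table with rows of length `W`. -/
theorem mul_add_ne {W k k' v v' : ℕ} (hk : k' < k) (hv : v' < W) : k' * W + v' ≠ k * W + v := by
  have h := Nat.mul_le_mul_right W (Nat.succ_le_of_lt hk)
  rw [Nat.succ_mul] at h
  omega

theorem exists_run_digitRow : ∃ T, PolyBdd T ∧ ∀ {n d : ℕ} (I : Instance n d) (s : State) (k : ℕ),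
    1 ≤ I.kappa → 0 < d → k < I.width ^ (3 * I.width) → WidthCtx I s → s.reg 8 = k →
    Runs I digitRow s (T (I.width ^ (3 * I.width) + 1)) fun s' => WidthCtx I s' ∧
      s'.reg 8 = k ∧ s'.reg 10 = s.reg 10 ∧ s'.arr 1 = s.arr 1 ∧
      (∀ v < 3 * I.width, s'.arr 2 (k * (3 * I.width) + v) = dig I.width k v) ∧
      ∀ k' < k, ∀ v < 3 * I.width,
        s'.arr 2 (k' * (3 * I.width) + v) = s.arr 2 (k' * (3 * I.width) + v) := by
  let a : Expr := .add (.mul (.var 8) (.var 5)) (.var 7)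
  let e : Expr := .sub (.var 17) (.mul (.var 18) (.var 4))
  refine ⟨fun X => (1 + 1) + (1 + X * (((quotE.cst * X ^ quotE.depth + 1) +
    ((a.cst * X ^ a.depth + (e.cst * X ^ e.depth + 1)) + (1 + 1))) + 9) + 3), ?_,
    fun {n d} I s k hκ hd hk hs h8 => ?_⟩
  · exact (PolyBdd.const _).add (((PolyBdd.const 1).add (PolyBdd.id.mul
      ((((PolyBdd.time _).add (.const 1)).add (((PolyBdd.time _).add ((PolyBdd.time _).add
        (.const 1))).add (.const _))).add (.const 9)))).add (.const 3))
  have hw := I.le_width hκ hd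
  have hN := I.le_codes hκ hd
  set N := I.width ^ (3 * I.width) with hNdef
  refine Runs.seq <| Runs.assign (M := 0) (by decide) trivial fun s₁ h₁ h₁' => ?_
  have hs₁ : WidthCtx I s₁ := hs.congr (h₁'.low (by decide))
  refine (Runs.forLoop (I := I) (e := .var 5) (M := 0) (b := 3 * I.width)
    (T := (quotE.time N + 1) + ((a.time N + (e.time N + 1)) + (1 + 1)))
    (fun j s' => WidthCtx I s' ∧ s'.reg 8 = k ∧ s'.reg 10 = s.reg 10 ∧ s'.arr 1 = s.arr 1 ∧
      (∀ v < j, s'.arr 2 (k * (3 * I.width) + v) = dig I.width k v) ∧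
      (∀ k' < k, ∀ v < 3 * I.width,
        s'.arr 2 (k' * (3 * I.width) + v) = s.arr 2 (k' * (3 * I.width) + v)) ∧
      -- Register `17` holds what remains of the code after `j` digits; the next digit is its
      -- remainder modulo the width.
      s'.reg 17 = k / I.width ^ j)
    (by decide) (by decide) (by decide) (by decide) trivial hs₁.reg_W ?_
    ⟨hs₁, (h₁'.1 8 (by decide) (by decide)).trans h8, h₁'.1 10 (by decide) (by decide),
      h₁'.2 1 (by decide), by simp, fun k' _ v _ => by rw [h₁'.2 2 (by decide)], ?_⟩ ?_ ?_).mono ?_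
    fun _ h => h
  · rintro j s s' hs ⟨h1, h2, h3, h4, h5, h6, h7⟩
    have ha := hs.2 2 (by decide)
    exact ⟨h1.congr (hs.low (by decide)), (hs.1 8 (by decide) (by decide)).trans h2,
      (hs.1 10 (by decide) (by decide)).trans h3, (hs.2 1 (by decide)).trans h4,
      fun v hv => ha ▸ h5 v hv, fun k' hk' v hv => ha ▸ h6 k' hk' v hv,
      (hs.1 17 (by decide) (by decide)).trans h7⟩
  · rw [h₁, pow_zero, Nat.div_one]
    exact h8
  · rintro j s₂ hj ⟨h1, h2, h3, h4, h5, h6, h7⟩ hx hc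
    have hle : s₂.reg 17 ≤ N := h7 ▸ (Nat.div_le_self _ _).trans hk.le
    refine Runs.seq <| Runs.assign (M := N) (by decide) ?_ fun s₃ h₃ h₃' => ?_
    · simp only [quotE, Expr.le, Bdd, eval, true_and, and_true, State.reg_setReg]
      refine ⟨hle, fun i _ => ?_⟩
      simp [h1.reg_B]
      omega
    have hs₃ : WidthCtx I s₃ := h1.congr (h₃'.low (by decide))
    rw [eval_quotE (by rw [h1.reg_B]; omega), h1.reg_B] at h₃
    have h17 := (h₃'.1 17 (by decide) (by decide)).trans h7
    have h83 := (h₃'.1 8 (by decide) (by decide)).trans h2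
    have h73 := (h₃'.1 7 (by decide) (by decide)).trans hx
    refine Runs.seq <| Runs.storeAt (M := N) (M' := N) (by decide) (by decide) ?_ ?_
      (fun s₄ h₄ hr hr' => ?_) (by decide)
    · simp only [Bdd, eval, true_and, and_true, hs₃.reg_W]
      exact hN
    · simp only [Bdd, eval, true_and, hs₃.reg_B]
      omega
    refine Runs.assign (M := 0) (by decide) trivial fun s₅ h₅ h₅' => ?_
    have hidx : (Expr.add (.mul (.var 8) (.var 5)) (.var 7)).eval I s₃ = k * (3 * I.width) + j := by
      simp only [eval, h83, h73, hs₃.reg_W]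
    have hval : (Expr.sub (.var 17) (.mul (.var 18) (.var 4))).eval I s₃ = dig I.width k j := by
      simp only [eval, h17, h₃, h7, hs₃.reg_B, dig]
      rw [Nat.mod_eq_sub_div_mul]
    have harr : ∀ i, s₅.arr 2 i = if i = k * (3 * I.width) + j then dig I.width k j
        else s₂.arr 2 i := fun i => by
      rw [h₅'.2 2 (by decide), h₄, hidx, hval, h₃'.2 2 (by decide)]
    have hreg : ∀ y < userBound, y ≠ 17 → y ≠ 18 → s₅.reg y = s₂.reg y := fun y hy h h' => by
      rw [h₅'.1 y hy (by simpa using h), hr y hy, h₃'.1 y hy (by simpa using h')]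
    refine ⟨(hreg 7 (by decide) (by decide) (by decide)).trans hx,
      (hreg 9 (by decide) (by decide) (by decide)).trans hc,
      h1.congr fun y hy => hreg y (hy.trans (by decide)) (by omega) (by omega),
      (hreg 8 (by decide) (by decide) (by decide)).trans h2,
      (hreg 10 (by decide) (by decide) (by decide)).trans h3, ?_, ?_, ?_, ?_⟩
    · rw [h₅'.2 1 (by decide), hr' 1 (by decide) (by decide), h₃'.2 1 (by decide), h4]
    · intro v hv
      rw [harr]
      split_ifs with hvj
      · rw [Nat.add_left_cancel hvj]
      · exact h5 v (by omega)
    · intro k' hk' v hv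
      rw [harr, if_neg (mul_add_ne hk' hv)]
      exact h6 k' hk' v hv
    · rw [h₅]
      simp only [eval]
      rw [hr 18 (by decide), h₃, h7, Nat.div_div_eq_div_mul, pow_succ]
  · rintro s' ⟨h1, h2, h3, h4, h5, h6, -⟩
    exact ⟨h1, h2, h3, h4, h5, h6⟩
  · refine Nat.add_le_add_right (Nat.add_le_add le_rfl ?_) 3
    exact Nat.mul_le_mul_right _ (by omega)

theorem exists_run_digitProg : ∃ T, PolyBdd T ∧ ∀ {n d : ℕ} (I : Instance n d) (s : State),
    1 ≤ I.kappa → 0 < d → WidthCtx I s →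
    Runs I digitProg s (T (I.width ^ (3 * I.width) + 1)) fun s' =>
      DPCtx I s' ∧ s'.arr 1 = s.arr 1 := by
  obtain ⟨T, hT, hrun⟩ := exists_run_digitRow
  refine ⟨fun X => 1 + X * (T X + 9) + 3, ((PolyBdd.const 1).add (PolyBdd.id.mul
    (hT.add (.const 9)))).add (.const 3), fun {n d} I s hκ hd hs => ?_⟩
  set N := I.width ^ (3 * I.width) with hNdef
  refine (Runs.forLoop (I := I) (e := .var 6) (M := 0) (b := N) (T := T (N + 1))
    (fun k s' => WidthCtx I s' ∧ s'.arr 1 = s.arr 1 ∧ ∀ k' < k, ∀ v < 3 * I.width,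
      s'.arr 2 (k' * (3 * I.width) + v) = dig I.width k' v)
    (by decide) (by decide) (by decide) (by decide) trivial hs.reg_N ?_ ⟨hs, rfl, by simp⟩ ?_
    fun s' h => ⟨⟨h.1, h.2.2⟩, h.2.1⟩).mono ?_ fun _ h => h
  · rintro k s s' hs ⟨h1, h2, h3⟩
    exact ⟨h1.congr (hs.low (by decide)), (hs.2 1 (by decide)).trans h2,
      fun k' hk' v hv => hs.2 2 (by decide) ▸ h3 k' hk' v hv⟩
  · rintro k s₂ hk ⟨h1, h2, h3⟩ hx hc
    refine (hrun I s₂ k hκ hd hk h1 hx).mono le_rfl ?_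
    rintro s' ⟨g1, g2, g3, g4, g5, g6⟩
    refine ⟨g2, g3.trans hc, g1, g4.trans h2, fun k' hk' v hv => ?_⟩
    by_cases hkk : k' = k
    · subst hkk
      exact g5 v hv
    · rw [g6 k' (by omega) v hv]
      exact h3 k' (by omega) v hv
  · refine Nat.add_le_add_right (Nat.add_le_add le_rfl ?_) 3
    exact Nat.mul_le_mul_right _ (by omega)

/-- The first `i` rows of the table are correct. -/
def TableCorrect (I : Instance n d) (o : ℕ → ℕ) (s : State) (i : ℕ) : Prop :=
  ∀ i' < i, ∀ k < I.width ^ (3 * I.width),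
    Decides (s.arr 3 (i' * I.width ^ (3 * I.width) + k))
      (Reach I.width (3 * I.width) (I.WinGood o) i' k)

theorem DPCtx.congr {I : Instance n d} {s s' : State} (h : DPCtx I s)
    (hs : ∀ y < 7, s'.reg y = s.reg y) (ha : s'.arr 2 = s.arr 2) : DPCtx I s' :=
  ⟨h.toWidthCtx.congr hs, fun k hk v hv => ha ▸ h.arr_dig k hk v hv⟩

theorem exists_run_tableRow : ∃ T, PolyBdd T ∧ ∀ {n d : ℕ} (I : Instance n d) (s : State) (i : ℕ),
    1 ≤ I.kappa → 0 < d → DPCtx I s → TableCorrect I (s.arr 1) s i → s.reg 7 = i →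
    Runs I tableRow s (T (I.width ^ (3 * I.width) + 1)) fun s' => DPCtx I s' ∧
      s'.arr 1 = s.arr 1 ∧ s'.reg 7 = i ∧ s'.reg 9 = s.reg 9 ∧
      TableCorrect I (s.arr 1) s' (i + 1) := by
  let a : Expr := .add (.mul (.var 7) (.var 6)) (.var 8)
  refine ⟨fun X => 1 + X * ((a.cst * X ^ a.depth + (stepE.cst * X ^ stepE.depth + 1)) + 9) + 3, ?_,
    fun {n d} I s i hκ hd hs htab h7 => ?_⟩
  · exact ((PolyBdd.const 1).add (PolyBdd.id.mul (((PolyBdd.time _).add ((PolyBdd.time _).add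
      (.const 1))).add (.const 9)))).add (.const 3)
  have hw := I.le_width hκ hd
  have hN := I.le_codes hκ hd
  refine (Runs.forLoop (I := I) (e := .var 6) (M := 0) (b := I.width ^ (3 * I.width))
    (T := a.time (I.width ^ (3 * I.width)) + (stepE.time (I.width ^ (3 * I.width)) + 1))
    (fun k s' => DPCtx I s' ∧ s'.arr 1 = s.arr 1 ∧ s'.reg 7 = i ∧ s'.reg 9 = s.reg 9 ∧
      TableCorrect I (s.arr 1) s' i ∧ ∀ k' < k,
        Decides (s'.arr 3 (i * I.width ^ (3 * I.width) + k'))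
          (Reach I.width (3 * I.width) (I.WinGood (s.arr 1)) i k'))
    (by decide) (by decide) (by decide) (by decide) trivial hs.reg_N ?_
    ⟨hs, rfl, h7, rfl, htab, by simp⟩ ?_ ?_).mono ?_ fun _ h => h
  · rintro k s s' hs ⟨h1, h2, h3, h4, h5, h6⟩
    have ha := hs.2 3 (by decide)
    refine ⟨h1.congr (hs.low (by decide)) (hs.2 2 (by decide)), (hs.2 1 (by decide)).trans h2,
      (hs.1 7 (by decide) (by decide)).trans h3, (hs.1 9 (by decide) (by decide)).trans h4,
      fun i' hi' k hk => ?_, fun k' hk' => ?_⟩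
    · rw [ha]
      exact h5 i' hi' k hk
    · rw [ha]
      exact h6 k' hk'
  · rintro k s₂ hk ⟨h1, h2, h3, h4, h5, h6⟩ hx hc
    refine Runs.storeAt (M := I.width ^ (3 * I.width)) (M' := I.width ^ (3 * I.width)) (by decide)
      (by decide) ?_ (h1.bdd_stepE (by omega) hN le_rfl) (fun s₃ h₃ hr hr' => ?_) (by decide)
    · simp [Bdd, eval, h1.reg_N]
    have hidx : (Expr.add (.mul (.var 7) (.var 6)) (.var 8)).eval I s₂
        = i * I.width ^ (3 * I.width) + k := by
      simp only [eval, h3, h1.reg_N, hx]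
    have hstep := h1.decides_stepE (by rw [hx]; exact hk) fun j hj k' hk' => by
      rw [h2]
      exact h5 j (by omega) k' hk'
    rw [h2, h3, hx] at hstep
    refine ⟨(hr 8 (by decide)).trans hx, (hr 10 (by decide)).trans hc,
      h1.congr (fun y hy => hr y (hy.trans (by decide))) (hr' 2 (by decide) (by decide)),
      (hr' 1 (by decide) (by decide)).trans h2, (hr 7 (by decide)).trans h3,
      (hr 9 (by decide)).trans h4, fun i' hi' k' hk' => ?_, fun k' hk' => ?_⟩
    · rw [h₃, hidx, if_neg (mul_add_ne hi' hk')]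
      exact h5 i' hi' k' hk'
    · rw [h₃, hidx]
      split_ifs with hkk
      · rw [Nat.add_left_cancel hkk]
        exact hstep
      · exact h6 k' (by omega)
  · rintro s' ⟨h1, h2, h3, h4, h5, h6⟩
    refine ⟨h1, h2, h3, h4, fun i' hi' k hk => ?_⟩
    by_cases hii : i' = i
    · subst hii
      exact h6 k hk
    · exact h5 i' (by omega) k hk
  · refine Nat.add_le_add_right (Nat.add_le_add le_rfl ?_) 3
    exact Nat.mul_le_mul_right _ (by omega)

theorem exists_run_tableProg : ∃ T, PolyBdd T ∧ ∀ {n d : ℕ} (I : Instance n d) (s : State), 0 < n →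
    1 ≤ I.kappa → 0 < d → DPCtx I s →
    Runs I tableProg s (n * T (I.width ^ (3 * I.width) + 1)) fun s' =>
      DPCtx I s' ∧ TableCorrect I (s.arr 1) s' n := by
  obtain ⟨T, hT, hrun⟩ := exists_run_tableRow
  refine ⟨fun X => T X + 13, hT.add (.const 13), fun {n d} I s hn hκ hd hs => ?_⟩
  refine (Runs.forLoop (I := I) (e := .var 0) (M := 0) (b := n) (T := T (I.width ^ (3 * I.width) + 1))
    (fun i s' => DPCtx I s' ∧ s'.arr 1 = s.arr 1 ∧ TableCorrect I (s.arr 1) s' i)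
    (by decide) (by decide) (by decide) (by decide) trivial hs.reg_n ?_
    ⟨hs, rfl, fun i' hi' => absurd hi' (Nat.not_lt_zero _)⟩ ?_ fun s' h => ⟨h.1, h.2.2⟩).mono ?_
    fun _ h => h
  · rintro k s s' hs ⟨h1, h2, h3⟩
    refine ⟨h1.congr (hs.low (by decide)) (hs.2 2 (by decide)), (hs.2 1 (by decide)).trans h2,
      fun i' hi' k hk => ?_⟩
    rw [hs.2 3 (by decide)]
    exact h3 i' hi' k hk
  · rintro i s₂ hi ⟨h1, h2, h3⟩ hx hc
    refine (hrun I s₂ i hκ hd h1 (h2 ▸ h3) hx).mono le_rfl ?_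
    rintro s' ⟨g1, g2, g3, g4, g5⟩
    exact ⟨g3, g4.trans hc, g1, g2.trans h2, h2 ▸ g5⟩
  · have h6 : (var 0).time 0 = 1 := rfl
    rw [h6]
    nlinarith

theorem exists_run_dpProg : ∃ (C : ℕ) (T : ℕ → ℕ), PolyBdd T ∧ ∀ {n d : ℕ} (I : Instance n d)
    (s : State), 0 < n → 1 ≤ I.kappa → 0 < d → PreCtx I s →
    Runs I dpProg s (C * n ^ 2 + n * T (I.width ^ (3 * I.width) + 1)) fun s' =>
      s'.reg 0 ≠ 0 ↔ I.HasStableMatching := by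
  obtain ⟨T₁, hT₁, h₁⟩ := exists_run_widthProg
  obtain ⟨C, h₂⟩ := exists_run_ordProg
  obtain ⟨T₃, hT₃, h₃⟩ := exists_run_digitProg
  obtain ⟨T₄, hT₄, h₄⟩ := exists_run_tableProg
  refine ⟨C, fun X => (T₁ X + T₃ X) + (T₄ X + (finalE.cst * X ^ finalE.depth + 1)),
    (hT₁.add hT₃).add (hT₄.add ((PolyBdd.time _).add (.const 1))),
    fun {n d} I s hn hκ hd hs => ?_⟩
  refine Runs.mono (Runs.seq <| (h₁ I s hκ hd hs).mono le_rfl fun s₁ hs₁ => Runs.seq <|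
    (h₂ I s₁ hn hs₁.1 hs₁.2).mono le_rfl fun s₂ hs₂ => Runs.seq <|
    (h₃ I s₂ hκ hd hs₂.1).mono le_rfl fun s₃ hs₃ => Runs.seq <|
    (h₄ I s₃ hn hκ hd hs₃.1).mono le_rfl fun s₄ hs₄ =>
      Runs.assign (M := I.width ^ (3 * I.width)) (by decide) ?_ fun s₅ h₅ _ => ?_) ?_ fun _ h => h
  · simp [finalE, ex, Expr.pos, Bdd, eval, hs₄.1.reg_N]
  · rw [h₅]
    have hord : ∀ a, s₃.arr 1 (I.idx a) = a := fun a => by rw [hs₃.2]; exact hs₂.2 a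
    -- A stable matching exists exactly if the last row of the table, number `n - 1`, has a nonzero
    -- entry.
    rw [Instance.hasStableMatching_iff_reach hκ hd hn hord]
    refine Decides.ne_zero_iff ((decides_ex (R := fun k =>
      Reach I.width (3 * I.width) (I.WinGood (s₃.arr 1)) (n - 1) k) fun k hk => ?_).congr ?_)
    · have hk' : k < I.width ^ (3 * I.width) := by simpa [eval, hs₄.1.reg_N] using hk
      have := hs₄.2 (n - 1) (by omega) k hk'
      simpa [eval, hs₄.1.reg_n, hs₄.1.reg_N] using this
    · simp only [eval, hs₄.1.reg_N]
  · simp only [time]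
    generalize I.width ^ (3 * I.width) + 1 = X
    -- The work that is not repeated for each window is absorbed into the term linear in `n`.
    have e1 : 1 * (T₁ X + T₃ X + (finalE.cst * X ^ finalE.depth + 1))
      ≤ n * (T₁ X + T₃ X + (finalE.cst * X ^ finalE.depth + 1)) := Nat.mul_le_mul_right _ hn
    have e2 : n * (T₁ X + T₃ X + (T₄ X + (finalE.cst * X ^ finalE.depth + 1)))
      = n * (T₁ X + T₃ X + (finalE.cst * X ^ finalE.depth + 1)) + n * T₄ X := by ring
    omega

/-! ### The algorithm -/

/-- The condition under which the dynamic program is run. -/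
def smallE : Expr := .and (.lt (.var 1) (.var 3)) (.lt (.lit 1) (.var 1))

/-- The algorithm. -/
def algorithm : Program := .seq setupProg (branch smallE dpProg (assign 0 (.lit 1)))

theorem Runs.solves {I : Instance n d} {p : Program} {T : ℕ}
    (h : Runs I p (State.init n d) T fun s => s.reg 0 ≠ 0 ↔ I.HasStableMatching) :
    ∃ t ≤ T, p.Solves I t := by
  obtain ⟨t, s, he, ht, hs⟩ := h
  exact ⟨t, ht, s, he, hs⟩

theorem exists_algorithm_time : ∃ (C : ℕ) (T : ℕ → ℕ), PolyBdd T ∧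
    ∀ {n d : ℕ} (I : Instance n d), 0 < n → 0 < d → ∃ t, algorithm.Solves I t ∧
      (4 * I.kappa * 2 ^ (4 * I.kappa) ≤ d ∨ d = 1 → t ≤ C * n ^ 2) ∧
      (d < 4 * I.kappa * 2 ^ (4 * I.kappa) →
        t ≤ C * n ^ 2 + n * T (I.width ^ (3 * I.width) + 1)) := by
  obtain ⟨C₁, h₁⟩ := exists_run_setupProg
  obtain ⟨C₂, T, hT, h₂⟩ := exists_run_dpProg
  refine ⟨C₁ + C₂ + smallE.cst + 3, T, hT, fun {n d} I hn hd => ?_⟩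
  have hn2 : 1 ≤ n ^ 2 := Nat.one_le_pow _ _ hn
  have e1 : ∀ e : Expr, e.time 0 = e.cst := fun e => by simp [time]
  have hexp : (C₁ + C₂ + smallE.cst + 3) * n ^ 2
      = C₁ * n ^ 2 + C₂ * n ^ 2 + (smallE.cst + 3) * n ^ 2 := by ring
  have hexp' : (smallE.cst + 3) * 1 ≤ (smallE.cst + 3) * n ^ 2 := Nat.mul_le_mul_left _ hn2
  have hsmall : ∀ s : State, s.reg 1 = d → s.reg 3 = 4 * I.kappa * 2 ^ (4 * I.kappa) →
      Decides (smallE.eval I s) (d < 4 * I.kappa * 2 ^ (4 * I.kappa) ∧ 1 < d) := fun s h1 h3 =>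
    (decides_and decides_lt fun _ => decides_lt).congr (by simp only [eval, h1, h3])
  -- The strict inequality forces `κ ≥ 1`. In the other branch `d = 1` or `d` reaches the threshold,
  -- and yes is the right answer.
  by_cases hcase : d < 4 * I.kappa * 2 ^ (4 * I.kappa) ∧ 1 < d
  · have hκ : 1 ≤ I.kappa := by
      by_contra h
      have : I.kappa = 0 := by omega
      simp [this] at hcase
    obtain ⟨t, ht, hsol⟩ := Runs.solves (Runs.seq (p := setupProg)
      (q := branch smallE dpProg (assign 0 (.lit 1))) <| (h₁ I hn).mono le_rfl fun s hs =>
      Runs.branch (M := 0) (by decide) (by simp [smallE, Expr.and, Expr.lt, Expr.le, Bdd])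
        (fun s' _ h' => h₂ I s' hn hκ hd (hs.1.congr (h'.1 0 (by decide) (by decide))
          (h'.1 1 (by decide) (by decide)) (h'.1 2 (by decide) (by decide)) (h'.2 0 (by decide))))
        (fun s' h0 _ => absurd ((hsmall s hs.1.reg_d hs.2).1 hcase) (by omega)))
    rw [e1] at ht
    refine ⟨t, hsol, fun h => ?_, fun _ => ?_⟩
    · rcases h with h | h <;> omega
    · omega
  · obtain ⟨t, ht, hsol⟩ := Runs.solves (Runs.seq (p := setupProg)
      (q := branch smallE dpProg (assign 0 (.lit 1))) <| (h₁ I hn).mono le_rfl fun s hs =>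
      Runs.branch (M := 0) (T := 1 + 1) (by decide)
        (by simp [smallE, Expr.and, Expr.lt, Expr.le, Bdd])
        (fun s' h0 _ => absurd ((hsmall s hs.1.reg_d hs.2).2 hcase) h0)
        (fun s' _ _ => Runs.assign (M := 0) (by decide) trivial fun s₂ h₂ _ => by
          rw [h₂]
          refine iff_of_true one_ne_zero ?_
          by_cases h1 : d = 1
          · exact I.hasStableMatching_of_eq_one h1
          · exact I.hasStableMatching_of_large hd (by omega)))
    rw [e1] at ht
    have : t ≤ (C₁ + C₂ + smallE.cst + 3) * n ^ 2 := by omega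
    exact ⟨t, hsol, fun _ => this, fun _ => this.trans (Nat.le_add_right _ _)⟩

/-! ### Arithmetic of the bounds -/

/-- From `q ≥ 16` follow `7 * q ≤ q ^ 2` and `21 * q + 1 ≤ 22 * q`, which puts everything over the
base `q`. -/
theorem codes_pow_le {q : ℕ} (hq : 16 ≤ q) (c : ℕ) :
    ((7 * q) ^ (3 * (7 * q)) + 1) ^ c ≤ q ^ (44 * c * q) := by
  have h1 : (7 * q) ^ (3 * (7 * q)) + 1 ≤ q ^ (44 * q) := by
    calc (7 * q) ^ (3 * (7 * q)) + 1 ≤ (7 * q) ^ (3 * (7 * q)) * (7 * q) := by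
          have := Nat.one_le_pow (3 * (7 * q)) (7 * q) (by omega)
          nlinarith
      _ = (7 * q) ^ (3 * (7 * q) + 1) := (pow_succ _ _).symm
      _ ≤ (7 * q) ^ (22 * q) := Nat.pow_le_pow_right (by omega) (by omega)
      _ ≤ (q ^ 2) ^ (22 * q) := Nat.pow_le_pow_left (by nlinarith) _
      _ = q ^ (44 * q) := by rw [← pow_mul]; congr 1; ring
  calc _ ≤ (q ^ (44 * q)) ^ c := Nat.pow_le_pow_left h1 c
    _ = q ^ (44 * c * q) := by rw [← pow_mul]; congr 1; ring

theorem param_le {k d : ℕ} (h : d < 4 * k * 2 ^ (4 * k)) :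
    k * d ^ 4 ≤ 256 * (k ^ 5 * 2 ^ (16 * k)) := by
  calc k * d ^ 4 ≤ k * (4 * k * 2 ^ (4 * k)) ^ 4 :=
        Nat.mul_le_mul_left _ (Nat.pow_le_pow_left h.le 4)
    _ = 256 * (k ^ 5 * 2 ^ (16 * k)) := by
      rw [mul_pow, ← pow_mul, show 4 * k * 4 = 16 * k by ring]
      ring

/-- The base is compared by `q ≤ 256 * X ≤ X ^ 2`, the exponent by `q ≤ 256 * X`. -/
theorem pow_param_le {q X c : ℕ} (hq : 1 ≤ q) (hX : 256 ≤ X) (h : q ≤ 256 * X) :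
    q ^ (c * q) ≤ X ^ (512 * c * X) := by
  calc q ^ (c * q) ≤ q ^ (c * (256 * X)) :=
        Nat.pow_le_pow_right hq (Nat.mul_le_mul_left _ h)
    _ ≤ (X ^ 2) ^ (c * (256 * X)) := Nat.pow_le_pow_left (by nlinarith) _
    _ = X ^ (512 * c * X) := by rw [← pow_mul]; congr 1; ring

theorem le_param {k : ℕ} (hk : 1 ≤ k) : 256 ≤ k ^ 5 * 2 ^ (16 * k) := by
  calc 256 ≤ 1 * 2 ^ 16 := by norm_num
    _ ≤ k ^ 5 * 2 ^ (16 * k) :=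
      Nat.mul_le_mul (Nat.one_le_pow _ _ hk) (Nat.pow_le_pow_right (by omega) (by omega))

theorem primrec_pow : Primrec₂ ((· ^ ·) : ℕ → ℕ → ℕ) := by
  have h : Primrec₂ fun (a b : ℕ) => Nat.rec (motive := fun _ => ℕ) 1 (fun _ IH => IH * a) b :=
    (Primrec.nat_rec (f := fun _ : ℕ => 1) (g := fun a p => p.2 * a) (Primrec.const 1)
      (Primrec.nat_mul.comp (Primrec.snd.comp Primrec.snd) Primrec.fst).to₂)
  refine h.of_eq fun a b => ?_
  induction b with
  | zero => rfl
  | succ b ih => simp only [pow_succ, ← ih]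

theorem computable_timeBound (C : ℕ) : Computable fun k : ℕ =>
    C + (k ^ 5 * 2 ^ (16 * k)) ^ (C * (k ^ 5 * 2 ^ (16 * k))) := by
  have h : Primrec fun k : ℕ => k ^ 5 * 2 ^ (16 * k) :=
    Primrec.nat_mul.comp (primrec_pow.comp .id (.const 5))
      (primrec_pow.comp (.const 2) (Primrec.nat_mul.comp (.const 16) .id))
  exact (Primrec.nat_add.comp (.const C)
    (primrec_pow.comp h (Primrec.nat_mul.comp (.const C) h))).to_comp

theorem exists_algorithm_bound : ∃ C : ℕ, ∀ (n d : ℕ), 1 ≤ n → 1 ≤ d → ∀ I : Instance n d,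
    ∃ t : ℕ, algorithm.Solves I t ∧
      t ≤ C * n ^ 2 +
        (I.kappa ^ 5 * 2 ^ (16 * I.kappa)) ^ (C * (I.kappa ^ 5 * 2 ^ (16 * I.kappa))) * n ∧
      (4 * I.kappa * 2 ^ (4 * I.kappa) ≤ d → I.HasStableMatching ∧ t ≤ C * n ^ 2) ∧
      (d < 4 * I.kappa * 2 ^ (4 * I.kappa) →
        t ≤ C * n ^ 2 + (I.kappa * d ^ 4) ^ (C * (I.kappa * d ^ 4)) * n) := by
  obtain ⟨C, T, ⟨c, hc⟩, h⟩ := exists_algorithm_time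
  -- The constant must dominate the quadratic part, the exponent `44 * c` over `κ * d ^ 4`, and the
  -- exponent `512 * (44 * c)` over `κ ^ 5 * 2 ^ (16 * κ)`.
  refine ⟨C + 44 * c + 512 * (44 * c), fun n d hn hd I => ?_⟩
  obtain ⟨t, hsol, hbig, hsmall⟩ := h I hn hd
  set C' := C + 44 * c + 512 * (44 * c) with hC'
  have hCn : C * n ^ 2 ≤ C' * n ^ 2 := Nat.mul_le_mul_right _ (by omega)
  refine ⟨t, hsol, ?_⟩
  -- The case `d = 1` is separated because `κ * d ^ 4` may then be `1`, whose powers bound nothing;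
  -- there the time is quadratic anyway. For `d ≥ 2` the base is at least `16`.
  by_cases hcase : d < 4 * I.kappa * 2 ^ (4 * I.kappa) ∧ d ≠ 1
  · have hκ : 1 ≤ I.kappa := by
      by_contra h
      have : I.kappa = 0 := by omega
      simp [this] at hcase
    set q := I.kappa * d ^ 4 with hq
    set X := I.kappa ^ 5 * 2 ^ (16 * I.kappa) with hX
    have hq16 : 16 ≤ q := by
      calc 16 = 1 * 2 ^ 4 := by norm_num
        _ ≤ I.kappa * d ^ 4 := Nat.mul_le_mul hκ (Nat.pow_le_pow_left (by omega) 4)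
    have hX256 : 256 ≤ X := le_param hκ
    have hT : T (I.width ^ (3 * I.width) + 1) ≤ q ^ (44 * c * q) := by
      have hw : I.width = 7 * q := rfl
      refine (hc _ ?_).trans ?_
      · have := I.le_codes hκ hd
        have := (I.le_width hκ hd).1
        omega
      · rw [hw]
        exact codes_pow_le hq16 c
    have ht := hsmall hcase.1
    have h1 : n * T (I.width ^ (3 * I.width) + 1) ≤ q ^ (C' * q) * n := by
      rw [mul_comm]
      refine Nat.mul_le_mul_right _ (hT.trans (Nat.pow_le_pow_right (by omega) ?_))
      exact Nat.mul_le_mul_right _ (by omega)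
    have h2 : n * T (I.width ^ (3 * I.width) + 1) ≤ X ^ (C' * X) * n := by
      rw [mul_comm]
      refine Nat.mul_le_mul_right _ (hT.trans
        ((pow_param_le (by omega) hX256 (param_le hcase.1)).trans
          (Nat.pow_le_pow_right (by omega) ?_)))
      exact Nat.mul_le_mul_right _ (by omega)
    refine ⟨by omega, fun h => ?_, fun _ => by omega⟩
    omega
  · have ht := hbig (by omega)
    refine ⟨by omega, fun h => ⟨I.hasStableMatching_of_large hd h, by omega⟩, fun _ => by omega⟩

end MDSR

theorem mainTheorem1 :
    ∃ (p : MDSR.Program) (C : ℕ),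
      (∀ (n d : ℕ), 1 ≤ n → 1 ≤ d → ∀ I : MDSR.Instance n d, ∃ t : ℕ,
        p.Solves I t ∧
        t ≤ C * n ^ 2 +
          (I.kappa ^ 5 * 2 ^ (16 * I.kappa)) ^ (C * (I.kappa ^ 5 * 2 ^ (16 * I.kappa))) * n ∧
        (4 * I.kappa * 2 ^ (4 * I.kappa) ≤ d → I.HasStableMatching ∧ t ≤ C * n ^ 2) ∧
        (d < 4 * I.kappa * 2 ^ (4 * I.kappa) →
          t ≤ C * n ^ 2 + (I.kappa * d ^ 4) ^ (C * (I.kappa * d ^ 4)) * n)) ∧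
      ∃ (f : ℕ → ℕ) (c : ℕ), Computable f ∧
        ∀ (n d : ℕ), 1 ≤ n → 1 ≤ d → ∀ I : MDSR.Instance n d, ∃ t : ℕ,
          p.Solves I t ∧ t ≤ f I.kappa * n ^ c := by
  obtain ⟨C, h⟩ := MDSR.exists_algorithm_bound
  refine ⟨MDSR.algorithm, C, h, _, 2, MDSR.computable_timeBound C, fun n d hn hd I => ?_⟩
  obtain ⟨t, hsol, ht, -⟩ := h n d hn hd I
  refine ⟨t, hsol, ht.trans ?_⟩
  -- The function `f` is the constant plus the parameter term, and `n ≤ n ^ 2` puts both under the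
  -- exponent `2`.
  rw [Nat.add_mul]
  exact Nat.add_le_add_left (Nat.mul_le_mul_left _ (Nat.le_self_pow (by omega) n)) _
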